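/- **Setting.** Let $\Omega=(0,L_1)\times(0,L_2)$, and consider with periodic boundary conditions the symmetric hyperbolic system $$B_0u_t+B_1u_x+B_2u_y=0\quad\text{in }\Omega\times(0,T],\qquad u(0)=u_0,\qquad u=u(x,y,t)\in\mathbb R^m,$$ where $B_0$ is a positive, piecewise constant diagonal matrix and $B_1,B_2\in\mathbb R^{m\times m}$ are constant symmetric matrices. Assume that for every unit vector $n$ the matrix $B_n=n_xB_1+n_yB_2$ has as many positive as negative eigenvalues, say $r_n$ of each (paired eigenvalues), and fix an orthogonal decomposition $B_n=S_n\Lambda_nS_n^{-1}$ with $$\Lambda_n=\operatorname{diag}(\lambda^+_{n,1},\dots,\lambda^+_{n,r_n},0,\dots,0,\lambda^-_{n,r_n},\dots,\lambda^-_{n,1})$$ in descending order. Let $R_\mu$ be the antisymmetric matrix whose only nonzero entries are $R_\mu(\mu,m+1-\mu)=1$ and $R_\mu(m+1-\mu,\mu)=-1$. **Method.** For a conforming periodic mesh $\Omega_h$ of $\overline\Omega$ by triangles and rectangles, let $V_h^k$ be the space of functions that are in $P^k(K)$ on each triangle $K$ and in the tensor-product space $Q^k(K)$ on each rectangle $K$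 ($k\ge0$), and let $h$ be the largest element diameter. For an edge $E$, let $n^-$ be the one of its two unit normals with $n^-_x+n^-_y>0$, or with $n^-_x>0$ if $n^-_x+n^-_y=0$; let $K^-$ be the adjacent element whose outward normal is $n^-$, let $K^+$ be the other one, and write $\{v\}=\frac12(v^++v^-)$, $[v]=v^+-v^-$. The semi-discrete energy-conserving DG method seeks $u_h(t)\in[V_h^k]^m$ such that for all $t\in(0,T]$, all $K\in\Omega_h$ and all $v_h\in[V_h^k]^m$ $$\int_KB_0(u_h)_t\cdot v_h-\int_KB_1u_h\cdot(v_h)_x-\int_KB_2u_h\cdot(v_h)_y+\int_{\partial K}\widehat{B_nu_h}\cdot v_h=0,$$ $$\widehat{B_{n^-}u_h}=B_{n^-}\{u_h\}+\tfrac12\sum_{\mu=1}^{r_{n^-}}\sqrt{|\lambda^+_{n^-,\mu}\lambda^-_{n^-,\mu}|}\;S_{n^-}R_\mu S_{n^-}^{-1}[u_h],\qquad\widehat{B_{n^+}u_h}=-\widehat{B_{n^-}u_h},\quad n^+=-n^-.$$ **Claim.** For every $k\ge 0$ there is an $s$, depending only on $k$, such that the following holds for every solution $u$ that is continuous and periodic,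 and of class $C^s$ in space and time up to the boundary of each of finitely many compact pieces on whose interiors $B_0$ is constant (for constant $B_0$ one may take the single piece $\overline\Omega$). For every $\sigma$ there is a constant $C$, independent of the mesh and of $u_h$, such that for every mesh that is shape-regular with constant $\sigma$ (each element $K$ contains a disc of radius $r_K>0$ with $\operatorname{diam}K\le\sigma r_K$) and each of whose elements lies in one of the pieces, and for every solution $u_h$ of the method: 1. (general meshes) $$\|u(t)-u_h(t)\|_{L^2(\Omega)}\le C\bigl(\|u_0-u_h(0)\|_{L^2(\Omega)}+h^{k}\bigr),\qquad 0\le t\le T;$$ 2. (rectangular meshes) if all elements are rectangles with sides parallel to the axes, then $$\|u(t)-u_h(t)\|_{L^2(\Omega)}\le C\bigl(\|u_0-u_h(0)\|_{L^2(\Omega)}+h^{k+1}\bigr),\qquad 0\le t\le T.$$ In particular, if $u_h(0)$ is the $L^2(\Omega)$-projection of $u_0$ onto $[V_h^k]^m$, then $\|u(t)-u_h(t)\|_{L^2(\Omega)}$ is at most $Ch^k$ on general meshes and at most $Ch^{k+1}$ on rectangular meshes. -/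

import Mathlib

open Set MeasureTheory
open scoped Matrix

noncomputable section

namespace EnergyDG

/-! ### Elements and local polynomial spaces -/

/-- Euclidean length of a vector of the plane (the norm of `ℝ × ℝ` in Mathlib is the maximum norm). -/
def len (p : ℝ × ℝ) : ℝ := Real.sqrt (p.1 ^ 2 + p.2 ^ 2)

/-- A nondegenerate triangle with vertices `a, a + v, a + w` (if `isRect = false`), or a
nondegenerate rectangle with vertices `a, a + v, a + v + w, a + w` (if `isRect = true`).
The vertices are listed counterclockwise. -/
structure Element where
  isRect : Bool
  a : ℝ × ℝ
  v : ℝ × ℝ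
  w : ℝ × ℝ
  det_pos : 0 < v.1 * w.2 - v.2 * w.1
  ortho : isRect = true → v.1 * w.1 + v.2 * w.2 = 0

/-- Polynomials in two variables of total degree at most `k`, as functions. -/
def polyP (k : ℕ) : Submodule ℝ (ℝ × ℝ → ℝ) :=
  Submodule.span ℝ {f | ∃ i j : ℕ, i + j ≤ k ∧ f = fun p => p.1 ^ i * p.2 ^ j}

/-- Polynomials in two variables of degree at most `k` in each variable, as functions. -/
def polyQ (k : ℕ) : Submodule ℝ (ℝ × ℝ → ℝ) :=
  Submodule.span ℝ {f | ∃ i j : ℕ, i ≤ k ∧ j ≤ k ∧ f = fun p => p.1 ^ i * p.2 ^ j}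

namespace Element

/-- The affine bijection from the reference cell (unit triangle or unit square) to the element. -/
def map (K : Element) (p : ℝ × ℝ) : ℝ × ℝ := K.a + p.1 • K.v + p.2 • K.w

def refCell (K : Element) : Set (ℝ × ℝ) :=
  if K.isRect then Icc 0 1 ×ˢ Icc 0 1 else {p | 0 ≤ p.1 ∧ 0 ≤ p.2 ∧ p.1 + p.2 ≤ 1}

/-- The closed element as a subset of the plane. -/
def carrier (K : Element) : Set (ℝ × ℝ) := K.map '' K.refCell

/-- The local space `P^k(K)` (triangle) or `Q^k(K)` (rectangle; degrees are taken in the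
coordinates along the sides, that is, in `x` and `y` if the sides are parallel to the axes).
A polynomial on `K` is represented by its unique polynomial extension to the plane. -/
def localSpace (K : Element) (k : ℕ) : Submodule ℝ (ℝ × ℝ → ℝ) :=
  (if K.isRect then polyQ k else polyP k).comap (LinearMap.funLeft ℝ ℝ K.map)

def numSides (K : Element) : ℕ := if K.isRect then 4 else 3

/-- The vertices in counterclockwise order, `vert 0, …, vert (numSides - 1)`, and
`vert numSides = vert 0`. -/
def vert (K : Element) : ℕ → ℝ × ℝ
  | 0 => K.a
  | 1 => K.a + K.v
  | 2 => if K.isRect then K.a + K.v + K.w else K.a + K.w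
  | 3 => if K.isRect then K.a + K.w else K.a
  | _ => K.a

/-- The diameter of the element: the largest distance between two vertices. -/
def diam (K : Element) : ℝ :=
  ⨆ i : Fin K.numSides, ⨆ j : Fin K.numSides, len (K.vert i - K.vert j)

end Element

/-! ### Conforming periodic meshes of the rectangle `[0, L₁] × [0, L₂]` -/

/-- The sides of the elements of a family; each edge of a mesh appears as two sides. -/
abbrev Side {N : ℕ} (elem : Fin N → Element) := (i : Fin N) × Fin (elem i).numSides

def Side.start {N : ℕ} {elem : Fin N → Element} (e : Side elem) : ℝ × ℝ :=
  (elem e.1).vert e.2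

def Side.finish {N : ℕ} {elem : Fin N → Element} (e : Side elem) : ℝ × ℝ :=
  (elem e.1).vert (e.2 + 1)

/-- Unit normal of a side, pointing out of its element. -/
def Side.normal {N : ℕ} {elem : Fin N → Element} (e : Side elem) : ℝ × ℝ :=
  (len (e.finish - e.start))⁻¹ • ((e.finish - e.start).2, -(e.finish - e.start).1)

/-- Integral of a function over a side with respect to arc length. -/
def Side.integral {N : ℕ} {elem : Fin N → Element} (e : Side elem) (f : ℝ × ℝ → ℝ) : ℝ :=
  len (e.finish - e.start) * ∫ s in (0 : ℝ)..1, f (e.start + s • (e.finish - e.start))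

/-- A conforming mesh of `[0, L₁] × [0, L₂]` with triangular and rectangular elements,
compatible with periodic boundary conditions: the elements fill the domain without overlap, and
every side coincides, up to a period, with a full side `nbr e` of the neighbouring element
(traversed in the opposite direction). -/
structure PeriodicMesh (L₁ L₂ : ℝ) where
  N : ℕ
  elem : Fin N → Element
  cover : ⋃ i, (elem i).carrier = Icc 0 L₁ ×ˢ Icc 0 L₂
  disj : Pairwise fun i j => Disjoint (interior (elem i).carrier) (interior (elem j).carrier)
  nbr : Side elem → Side elem
  period : Side elem → ℤ × ℤ
  start_eq : ∀ e, e.start = (nbr e).finish + ((period e).1 * L₁, (period e).2 * L₂)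
  finish_eq : ∀ e, e.finish = (nbr e).start + ((period e).1 * L₁, (period e).2 * L₂)
  nbr_nbr : ∀ e, nbr (nbr e) = e

namespace PeriodicMesh

variable {L₁ L₂ : ℝ}

/-- The translation that carries the side `nbr e` onto `e`. -/
def shift (M : PeriodicMesh L₁ L₂) (e : Side M.elem) : ℝ × ℝ :=
  ((M.period e).1 * L₁, (M.period e).2 * L₂)

/-- The mesh size `h`, the largest diameter of an element. -/
def size (M : PeriodicMesh L₁ L₂) : ℝ := ⨆ i, (M.elem i).diam

/-- Shape regularity: each element contains a disc of radius `r > 0` with `diam ≤ σ r`. -/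
def ShapeRegular (M : PeriodicMesh L₁ L₂) (σ : ℝ) : Prop :=
  ∀ i, ∃ (c : ℝ × ℝ) (r : ℝ), 0 < r ∧ (M.elem i).diam ≤ σ * r ∧
    {x : ℝ × ℝ | len (x - c) ≤ r} ⊆ (M.elem i).carrier

/-- A rectangular mesh: all elements are rectangles with sides parallel to the axes. -/
def IsCartesian (M : PeriodicMesh L₁ L₂) : Prop :=
  ∀ i, (M.elem i).isRect = true ∧ ((M.elem i).v.1 = 0 ∨ (M.elem i).v.2 = 0)

/-- A vector-valued broken function: one function per element. -/
abbrev Broken (M : PeriodicMesh L₁ L₂) (m : ℕ) := Fin M.N → ℝ × ℝ → Fin m → ℝ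

/-- Membership in `[V_h^k]^m`. -/
def InSpace (M : PeriodicMesh L₁ L₂) (k : ℕ) {m : ℕ} (U : M.Broken m) : Prop :=
  ∀ i j, (fun x => U i x j) ∈ (M.elem i).localSpace k

/-- The `L²(Ω)` distance of a function `f` and a broken function `U`. -/
def l2Error (M : PeriodicMesh L₁ L₂) {m : ℕ} (f : ℝ × ℝ → Fin m → ℝ) (U : M.Broken m) : ℝ :=
  Real.sqrt (∑ i, ∫ x in (M.elem i).carrier, ∑ j, (f x j - U i x j) ^ 2)

/-- `U` is the `L²`-orthogonal projection of `f` onto `[V_h^k]^m`. -/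
def IsL2Projection (M : PeriodicMesh L₁ L₂) (k : ℕ) {m : ℕ} (f : ℝ × ℝ → Fin m → ℝ)
    (U : M.Broken m) : Prop :=
  M.InSpace k U ∧ ∀ i, ∀ v : ℝ × ℝ → Fin m → ℝ,
    (∀ j, (fun x => v x j) ∈ (M.elem i).localSpace k) →
    ∫ x in (M.elem i).carrier, (f x - U i x) ⬝ᵥ v x = 0

end PeriodicMesh

/-! ### Systems with paired eigenvalues and the numerical flux -/

section Flux

variable {m : ℕ}

/-- `B_n = n_x B₁ + n_y B₂`. -/
def normalMatrix (B₁ B₂ : Matrix (Fin m) (Fin m) ℝ) (n : ℝ × ℝ) : Matrix (Fin m) (Fin m) ℝ :=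
  n.1 • B₁ + n.2 • B₂

/-- For every direction `n`, `S n` and `lam n` give an orthogonal eigenvalue decomposition
`B_n = S_n Λ_n S_n⁻¹` with the eigenvalues in descending order, and there are as many positive
as negative eigenvalues. So the positive ones stand at the first `r_n` places, and the
negative one paired with the eigenvalue at place `i` stands at the mirrored place `i.rev`. -/
structure IsPairedDecomposition (B₁ B₂ : Matrix (Fin m) (Fin m) ℝ)
    (S : ℝ × ℝ → Matrix (Fin m) (Fin m) ℝ) (lam : ℝ × ℝ → Fin m → ℝ) : Prop where
  orthogonal : ∀ n, len n = 1 → (S n)ᵀ * S n = 1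
  decomp : ∀ n, len n = 1 →
    normalMatrix B₁ B₂ n = S n * Matrix.diagonal (lam n) * (S n)ᵀ
  descending : ∀ n, len n = 1 → Antitone (lam n)
  paired : ∀ n, len n = 1 →
    (Finset.univ.filter fun i => 0 < lam n i).card = (Finset.univ.filter fun i => lam n i < 0).card

/-- The antisymmetric matrix with entry `1` at `(i, i.rev)` and `-1` at `(i.rev, i)`
(for `i ≠ i.rev`). -/
def pairMatrix (i : Fin m) : Matrix (Fin m) (Fin m) ℝ :=
  Matrix.single i i.rev 1 - Matrix.single i.rev i 1

/-- The stabilization matrix `½ ∑_μ √|λ_μ⁺ λ_μ⁻| S_n R_μ S_n⁻¹`. -/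
def stabMatrix (S : ℝ × ℝ → Matrix (Fin m) (Fin m) ℝ) (lam : ℝ × ℝ → Fin m → ℝ) (n : ℝ × ℝ) :
    Matrix (Fin m) (Fin m) ℝ :=
  (1 / 2 : ℝ) • ∑ i ∈ Finset.univ.filter (fun i => 0 < lam n i),
    Real.sqrt |lam n i * lam n i.rev| • (S n * pairMatrix i * (S n)ᵀ)

/-- The numerical flux in the direction `n = n⁻` with the traces `um` from `K⁻` and `up` from
`K⁺`: `B_n {u} + (stabilization matrix) [u]`, where `{u} = (u⁺ + u⁻) / 2` and `[u] = u⁺ - u⁻`. -/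
def numFlux (B₁ B₂ : Matrix (Fin m) (Fin m) ℝ) (S : ℝ × ℝ → Matrix (Fin m) (Fin m) ℝ)
    (lam : ℝ × ℝ → Fin m → ℝ) (n : ℝ × ℝ) (um up : Fin m → ℝ) : Fin m → ℝ :=
  normalMatrix B₁ B₂ n *ᵥ ((1 / 2 : ℝ) • (up + um)) + stabMatrix S lam n *ᵥ (up - um)

/-- The selection rule for the direction `n⁻` of an edge, with reference vector `(1, 1)`. -/
def IsMinusNormal (n : ℝ × ℝ) : Prop := 0 < n.1 + n.2 ∨ (n.1 + n.2 = 0 ∧ 0 < n.1)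

variable {L₁ L₂ : ℝ}

open Classical in
/-- The numerical flux on the side `e` in the direction of the outward normal of its element:
if that normal is `n⁻`, then the element is `K⁻` and its neighbour `K⁺`; otherwise the roles are
exchanged and the flux changes its sign. -/
def outFlux (M : PeriodicMesh L₁ L₂) (B₁ B₂ : Matrix (Fin m) (Fin m) ℝ)
    (S : ℝ × ℝ → Matrix (Fin m) (Fin m) ℝ) (lam : ℝ × ℝ → Fin m → ℝ)
    (U : M.Broken m) (e : Side M.elem) (x : ℝ × ℝ) : Fin m → ℝ :=
  if IsMinusNormal e.normal then
    numFlux B₁ B₂ S lam e.normal (U e.1 x) (U (M.nbr e).1 (x - M.shift e))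
  else
    -numFlux B₁ B₂ S lam (-e.normal) (U (M.nbr e).1 (x - M.shift e)) (U e.1 x)

/-! ### The semi-discrete method and the exact solution -/

/-- The left-hand side of the scheme on the element `i`, for the discrete function `U` with time
derivative `W` and the test function `v`. The diagonal matrix `B₀` is given by its diagonal. -/
def schemeForm (M : PeriodicMesh L₁ L₂) (B₀ : ℝ × ℝ → Fin m → ℝ)
    (B₁ B₂ : Matrix (Fin m) (Fin m) ℝ)
    (S : ℝ × ℝ → Matrix (Fin m) (Fin m) ℝ) (lam : ℝ × ℝ → Fin m → ℝ)
    (U W : M.Broken m) (i : Fin M.N) (v : ℝ × ℝ → Fin m → ℝ) : ℝ :=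
  (∫ x in (M.elem i).carrier, (B₀ x * W i x) ⬝ᵥ v x)
    - (∫ x in (M.elem i).carrier, (B₁ *ᵥ U i x) ⬝ᵥ fderiv ℝ v x (1, 0))
    - (∫ x in (M.elem i).carrier, (B₂ *ᵥ U i x) ⬝ᵥ fderiv ℝ v x (0, 1))
    + ∑ l : Fin (M.elem i).numSides,
        Side.integral (elem := M.elem) ⟨i, l⟩
          (fun x => outFlux M B₁ B₂ S lam U ⟨i, l⟩ x ⬝ᵥ v x)

/-- `U : [0, T] → [V_h^k]^m` solves the semi-discrete energy-conserving DG scheme. -/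
structure IsDGSolution (M : PeriodicMesh L₁ L₂) (k : ℕ) (B₀ : ℝ × ℝ → Fin m → ℝ)
    (B₁ B₂ : Matrix (Fin m) (Fin m) ℝ)
    (S : ℝ × ℝ → Matrix (Fin m) (Fin m) ℝ) (lam : ℝ × ℝ → Fin m → ℝ) (T : ℝ)
    (U : ℝ → M.Broken m) : Prop where
  mem : ∀ t ∈ Icc 0 T, M.InSpace k (U t)
  cont : ∀ i x j, ContinuousOn (fun t => U t i x j) (Icc 0 T)
  diff : ∀ t ∈ Ioc 0 T, ∀ i x j, DifferentiableWithinAt ℝ (fun τ => U τ i x j) (Icc 0 T) t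
  scheme : ∀ t ∈ Ioc 0 T, ∀ i, ∀ v : ℝ × ℝ → Fin m → ℝ,
    (∀ j, (fun x => v x j) ∈ (M.elem i).localSpace k) →
    schemeForm M B₀ B₁ B₂ S lam (U t)
      (fun i x j => derivWithin (fun τ => U τ i x j) (Icc 0 T) t) i v = 0

/-- `u` is a continuous solution on `[0, T]` of `B₀ u_t + B₁ u_x + B₂ u_y = 0` with periods
`L₁, L₂`, which is of class `C^s` up to the boundary on each of the pieces `D p`. (With a single
piece, the whole rectangle, this is a `C^s` solution.) -/
structure IsSmoothSolution (s : ℕ) (L₁ L₂ T : ℝ) (B₀ : ℝ × ℝ → Fin m → ℝ)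
    (B₁ B₂ : Matrix (Fin m) (Fin m) ℝ) {P : ℕ} (D : Fin P → Set (ℝ × ℝ))
    (u : ℝ → ℝ × ℝ → Fin m → ℝ) : Prop where
  cont : ContinuousOn (fun q : ℝ × (ℝ × ℝ) => u q.1 q.2) (Icc 0 T ×ˢ univ)
  periodic_x : ∀ t ∈ Icc 0 T, ∀ x : ℝ × ℝ, u t (x.1 + L₁, x.2) = u t x
  periodic_y : ∀ t ∈ Icc 0 T, ∀ x : ℝ × ℝ, u t (x.1, x.2 + L₂) = u t x
  smooth : ∀ p, ContDiffOn ℝ s (fun q : ℝ × (ℝ × ℝ) => u q.1 q.2) (Icc 0 T ×ˢ D p)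
  pde : ∀ t ∈ Ioc 0 T, ∀ p, ∀ x ∈ interior (D p),
    B₀ x * derivWithin (fun τ => u τ x) (Icc 0 T) t
      + B₁ *ᵥ fderiv ℝ (u t) x (1, 0) + B₂ *ᵥ fderiv ℝ (u t) x (0, 1) = 0

end Flux

end EnergyDG

end

/-!
The spatial part of the method, `convForm`, is skew-symmetric: after integration by parts in each
element only the edges contribute to `∑ i, convForm U i (U i)`, and there the normal matrices
(symmetric) and the stabilization matrices (antisymmetric) cancel between the two sides
(`sum_convForm_self`). Hence, if a curve `V` in the discrete space stays within `ρ` of the exact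
solution `u` and satisfies the scheme up to a residual of size `ρ` (`IsConsistent`), the weighted
energy of `V - U` changes only by the residual tested with `V - U`. An inverse inequality and
Gronwall's lemma then give `‖u - U‖ ≤ C (‖u(0) - U(0)‖ + ρ)`, and for the `L²` projection as initial
value the first term is itself of size `ρ` (`exists_l2Error_le`). It remains to find consistent
curves.

On general meshes the Taylor polynomials of degree `k` of `u` about a point of each element serve
(`exists_isConsistent`). In the strong form of the scheme they violate the differential equation by
`O(h ^ k)` and jump across the edges by `O(h ^ (k + 1))`. Shape regularity bounds the ratio of the
length of the boundary to the area of an element by a multiple of the inverse of its diameter, so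
`ρ = O(h ^ k)`.

On rectangular meshes one order is gained (`exists_isConsistent_of_isAxisParallel`). The Taylor
polynomial of degree `k + 1` has residual `O(h ^ (k + 1))`, but its terms `x ^ (k + 1)` and
`y ^ (k + 1)` lie outside `Q^k`. Each of them is removed at the cost of a correction
(`RadauSplitting.corr`) that is invisible to the method to leading order. The reason is that paired
eigenvalues make the numerical flux an alternating flux: in each direction the identity splits as
`P + Q` such that the flux does not see the part `Q` of the trace from `K⁺` and the part `P` of the
trace from `K⁻` (`exists_alternating_splitting`). The correction consists of Radau polynomials that
vanish at the lower end of the element in the part `P` and at the upper end in the part `Q`.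
Therefore it has no flux through the edges orthogonal to its direction. It is orthogonal to the
derivatives of test functions in its own direction, because Radau polynomials of degree `k + 1` are
orthogonal to polynomials of degree less than `k`. Only its jumps across the edges parallel to its
direction remain, and these are `O(h ^ (k + 2))`, since the jumps of the leading Taylor coefficients
are controlled by the jumps of the Taylor polynomials themselves (`exists_lead_jump_le`).

The exact solution is smooth only up to the boundary of pieces that may be very irregular compact
sets. All that is used is that its derivatives are bounded, uniformly, in the interior of every
element (`exists_iteratedFDeriv_bound`) and that it is continuous across the edges.
-/

noncomputable section

namespace EnergyDG

/-! ### The numerical flux as an alternating flux -/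

section Pairing

variable {m : ℕ} {B₁ B₂ : Matrix (Fin m) (Fin m) ℝ}
  {S : ℝ × ℝ → Matrix (Fin m) (Fin m) ℝ} {lam : ℝ × ℝ → Fin m → ℝ} {n : ℝ × ℝ}

/-- A descending family with as many positive as negative members has a positive member exactly
opposite to each negative one. -/
theorem pos_iff_neg_rev {l : Fin m → ℝ} (hl : Antitone l)
    (hc : (Finset.univ.filter fun i => 0 < l i).card = (Finset.univ.filter fun i => l i < 0).card)
    (i : Fin m) : 0 < l i ↔ l i.rev < 0 := by
  classical
  have hrev : (Finset.univ.filter fun i : Fin m => l i.rev < 0).card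
      = (Finset.univ.filter fun i => l i < 0).card := by
    refine Finset.card_bij' (fun i _ => i.rev) (fun i _ => i.rev) ?_ ?_ ?_ ?_ <;> simp
  rw [← hrev] at hc
  have hchain : (Finset.univ.filter fun i : Fin m => 0 < l i)
        ⊆ (Finset.univ.filter fun i : Fin m => l i.rev < 0) ∨
      (Finset.univ.filter fun i : Fin m => l i.rev < 0)
        ⊆ (Finset.univ.filter fun i : Fin m => 0 < l i) := by
    -- both sets are initial segments, so one contains the other
    by_contra! h
    obtain ⟨h1, h2⟩ := h
    obtain ⟨a, ha, ha'⟩ := Finset.not_subset.1 h1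
    obtain ⟨b, hb, hb'⟩ := Finset.not_subset.1 h2
    simp only [Finset.mem_filter, Finset.mem_univ, true_and] at ha ha' hb hb'
    rcases le_total a b with hab | hab
    · exact ha' ((hl (Fin.rev_le_rev.2 hab)).trans_lt hb)
    · exact hb' (ha.trans_le (hl hab))
  have heq : (Finset.univ.filter fun i : Fin m => 0 < l i)
      = (Finset.univ.filter fun i : Fin m => l i.rev < 0) := by
    rcases hchain with h | h
    · exact Finset.eq_of_subset_of_card_le h hc.ge
    · exact (Finset.eq_of_subset_of_card_le h hc.le).symm
  have := Finset.ext_iff.1 heq i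
  simpa using this

/-- Coordinates of `2 • stabMatrix` in the eigenvector basis. -/
def pairJ (l : Fin m → ℝ) : Matrix (Fin m) (Fin m) ℝ :=
  Matrix.of fun a b => if b = a.rev then SignType.sign (l a) * Real.sqrt |l a * l a.rev| else 0

/-- The swap of paired coordinates, rescaled so that it intertwines `diagonal l` and `pairJ l`. -/
def pairG (l : Fin m → ℝ) : Matrix (Fin m) (Fin m) ℝ :=
  Matrix.of fun a b => if b = a.rev then Real.sqrt (|l a.rev| / |l a|) else 0

theorem sum_pairMatrix {l : Fin m → ℝ} (h : ∀ i, 0 < l i ↔ l i.rev < 0) :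
    ∑ i ∈ Finset.univ.filter (fun i => 0 < l i), Real.sqrt |l i * l i.rev| • pairMatrix i
      = pairJ l := by
  classical
  ext a b
  simp only [Matrix.sum_apply, Matrix.smul_apply, pairMatrix, Matrix.sub_apply,
    Matrix.single_apply, smul_eq_mul, pairJ, Matrix.of_apply]
  have h' : ∀ i, 0 < l i.rev ↔ l i < 0 := fun i => by simpa using h i.rev
  by_cases hb : b = a.rev
  · subst hb
    simp only [if_true]
    rw [Finset.sum_filter]
    rcases lt_trichotomy (l a) 0 with ha | ha | ha
    · rw [Finset.sum_eq_single a.rev]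
      · have hne : a.rev ≠ a := fun h0 => by
          have := (h' a).2 ha; rw [h0] at this; linarith
        simp [(h' a).2 ha, hne, ha, mul_comm]
      · intro i _ hi
        have h1 : ¬ (i = a) ∨ ¬ 0 < l i := by
          by_cases hia : i = a
          · right; rw [hia]; exact not_lt.2 ha.le
          · left; exact hia
        have h2 : i.rev ≠ a := fun h0 => hi (by rw [← h0, Fin.rev_rev])
        rcases h1 with h1 | h1 <;> simp [h1, h2]
      · simp
    · have h0 : ¬ 0 < l a.rev := by rw [h']; simp [ha]
      rw [Finset.sum_eq_zero]
      · simp [ha]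
      · intro i _
        by_cases hi : 0 < l i
        · have h1 : i ≠ a := fun h1 => by rw [h1] at hi; linarith
          have h2 : i.rev ≠ a := fun h2 => h0 (by rw [← h2, Fin.rev_rev]; exact hi)
          simp [h1, h2]
        · simp [hi]
    · rw [Finset.sum_eq_single a]
      · have hne : a.rev ≠ a := fun h0 => by
          have := (h a).1 ha; rw [h0] at this; linarith
        simp [ha, hne]
      · intro i _ hi
        have h2 : 0 < l i → i.rev ≠ a := fun h1 h0 => by
          have := (h i).1 h1; rw [h0] at this; linarith
        by_cases h1 : 0 < l i
        · simp [hi, h2 h1]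
        · simp [h1]
      · simp
  · rw [Finset.sum_eq_zero]
    · simp [hb]
    · intro i _
      have h1 : ¬ (i = a ∧ i.rev = b) := by rintro ⟨rfl, rfl⟩; exact hb rfl
      have h2 : ¬ (i.rev = a ∧ i = b) := by rintro ⟨rfl, rfl⟩; simp at hb
      simp [h1, h2]

theorem diagonal_mul_pairG {l : Fin m → ℝ} :
    Matrix.diagonal l * pairG l = pairJ l := by
  ext a b
  simp only [Matrix.diagonal_mul, pairG, pairJ, Matrix.of_apply]
  split_ifs with hb
  · rcases eq_or_ne (l a) 0 with h0 | h0
    · simp [h0]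
    · have hp : 0 < |l a| := abs_pos.2 h0
      have : Real.sqrt |l a * l a.rev| = |l a| * Real.sqrt (|l a.rev| / |l a|) := by
        rw [abs_mul, show |l a| * |l a.rev| = |l a| ^ 2 * (|l a.rev| / |l a|) by field_simp,
          Real.sqrt_mul (sq_nonneg _), Real.sqrt_sq hp.le]
      rw [this, ← mul_assoc, sign_mul_abs]
  · simp

theorem pairJ_mul_pairG {l : Fin m → ℝ} (h : ∀ i, 0 < l i ↔ l i.rev < 0) :
    pairJ l * pairG l = Matrix.diagonal l := by
  classical
  ext a b
  rw [Matrix.mul_apply, Finset.sum_eq_single a.rev (fun j _ hj => by simp [pairJ, hj]) (by simp)]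
  simp only [pairG, pairJ, Matrix.of_apply, Fin.rev_rev, Matrix.diagonal_apply, mul_ite, mul_zero,
    if_true]
  by_cases hb : a = b
  · subst hb
    simp only [if_true]
    rcases eq_or_ne (l a) 0 with h0 | h0
    · simp [h0]
    · have hp : 0 < |l a| := abs_pos.2 h0
      have hq : 0 < |l a.rev| := by
        rw [abs_pos]
        rcases lt_or_gt_of_ne h0 with h1 | h1
        · have := (h a.rev).2 (by simpa using h1); exact this.ne'
        · exact ((h a).1 h1).ne
      have : Real.sqrt |l a * l a.rev| * Real.sqrt (|l a| / |l a.rev|) = |l a| := by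
        rw [← Real.sqrt_mul (abs_nonneg _), abs_mul,
          show |l a| * |l a.rev| * (|l a| / |l a.rev|) = |l a| ^ 2 by field_simp,
          Real.sqrt_sq hp.le]
      rw [mul_assoc, this, sign_mul_abs]
  · have : ¬ b = a := fun h => hb h.symm
    simp [hb, this]

theorem stabMatrix_eq (hd : IsPairedDecomposition B₁ B₂ S lam) (hn : len n = 1) :
    stabMatrix S lam n = (1 / 2 : ℝ) • (S n * pairJ (lam n) * (S n)ᵀ) := by
  rw [stabMatrix, ← sum_pairMatrix (pos_iff_neg_rev (hd.descending n hn) (hd.paired n hn)),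
    Matrix.mul_sum, Matrix.sum_mul]
  congr 1
  refine Finset.sum_congr rfl fun i _ => ?_
  simp

theorem stabMatrix_transpose : (stabMatrix S lam n)ᵀ = -stabMatrix S lam n := by
  simp only [stabMatrix, Matrix.transpose_smul, Matrix.transpose_sum, ← smul_neg,
    ← Finset.sum_neg_distrib]
  congr 1
  refine Finset.sum_congr rfl fun i _ => ?_
  congr 1
  simp [pairMatrix, Matrix.transpose_mul, Matrix.mul_assoc, Matrix.mul_sub, Matrix.sub_mul]

theorem normalMatrix_transpose (h₁ : B₁.IsSymm) (h₂ : B₂.IsSymm) :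
    (normalMatrix B₁ B₂ n)ᵀ = normalMatrix B₁ B₂ n := by
  simp [normalMatrix, Matrix.transpose_add, h₁.eq, h₂.eq]

/-- The numerical flux is an alternating flux: the matrices that multiply the traces from `K⁺` and
`K⁻` annihilate complementary matrices `Q`, `P` with `P + Q = 1`. -/
theorem exists_alternating_splitting (hd : IsPairedDecomposition B₁ B₂ S lam) (hn : len n = 1) :
    ∃ P Q : Matrix (Fin m) (Fin m) ℝ, P + Q = 1 ∧
      ((1 / 2 : ℝ) • normalMatrix B₁ B₂ n + stabMatrix S lam n) * Q = 0 ∧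
      ((1 / 2 : ℝ) • normalMatrix B₁ B₂ n - stabMatrix S lam n) * P = 0 := by
  have hp := pos_iff_neg_rev (hd.descending n hn) (hd.paired n hn)
  set G := S n * pairG (lam n) * (S n)ᵀ with hG
  have hSS := hd.orthogonal n hn
  have key : ∀ X Y : Matrix (Fin m) (Fin m) ℝ,
      S n * X * (S n)ᵀ * (S n * Y * (S n)ᵀ) = S n * (X * Y) * (S n)ᵀ := fun X Y => by
    rw [show S n * X * (S n)ᵀ * (S n * Y * (S n)ᵀ) = S n * X * ((S n)ᵀ * S n) * Y * (S n)ᵀ by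
      simp only [Matrix.mul_assoc], hSS, Matrix.mul_one]
    simp only [Matrix.mul_assoc]
  -- multiplication by `G` exchanges `½ B_n` and the stabilization matrix, so `(1 ± G) / 2` will do
  have h1 : normalMatrix B₁ B₂ n * G = (2 : ℝ) • stabMatrix S lam n := by
    rw [stabMatrix_eq hd hn, hd.decomp n hn, hG, key, diagonal_mul_pairG, smul_smul]
    norm_num
  have h2 : stabMatrix S lam n * G = (1 / 2 : ℝ) • normalMatrix B₁ B₂ n := by
    rw [stabMatrix_eq hd hn, hd.decomp n hn, hG, Matrix.smul_mul, key, pairJ_mul_pairG hp]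
  refine ⟨(1 / 2 : ℝ) • (1 + G), (1 / 2 : ℝ) • (1 - G), ?_, ?_, ?_⟩
  · rw [← smul_add, add_add_sub_cancel, ← two_smul ℝ, smul_smul]; norm_num
  · rw [Matrix.mul_smul, Matrix.mul_sub, Matrix.add_mul, Matrix.add_mul, Matrix.smul_mul,
      Matrix.smul_mul, h1, h2, Matrix.mul_one, Matrix.mul_one, smul_smul]
    norm_num [add_comm]
  · rw [Matrix.mul_smul, Matrix.mul_add, Matrix.sub_mul, Matrix.smul_mul, Matrix.sub_mul,
      Matrix.smul_mul, h1, h2, Matrix.mul_one, Matrix.mul_one, smul_smul]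
    norm_num

theorem abs_le_one_of_orthogonal {Q : Matrix (Fin m) (Fin m) ℝ} (h : Qᵀ * Q = 1)
    (a b : Fin m) : |Q a b| ≤ 1 := by
  have h1 : ∑ j, Q j b * Q j b = 1 := by
    have := congrFun (congrFun h b) b
    simpa [Matrix.mul_apply] using this
  have h2 : Q a b * Q a b ≤ 1 := by
    rw [← h1]
    exact Finset.single_le_sum (f := fun j => Q j b * Q j b) (fun j _ => mul_self_nonneg _)
      (Finset.mem_univ a)
  exact abs_le_one_iff_mul_self_le_one.2 h2

theorem abs_mul_mul_apply_le {X Y Z : Matrix (Fin m) (Fin m) ℝ} {x y z : ℝ} (hx0 : 0 ≤ x)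
    (hy0 : 0 ≤ y) (hX : ∀ a b, |X a b| ≤ x) (hY : ∀ a b, |Y a b| ≤ y) (hZ : ∀ a b, |Z a b| ≤ z)
    (a b : Fin m) : |(X * Y * Z) a b| ≤ (m * (m * (x * y) * z) : ℝ) := by
  have h1 : ∀ a b, |(X * Y) a b| ≤ (m * (x * y) : ℝ) := fun a b => by
    rw [Matrix.mul_apply]
    refine (Finset.abs_sum_le_sum_abs _ _).trans ?_
    refine (Finset.sum_le_card_nsmul _ _ (x * y) fun j _ => ?_).trans (by simp)
    rw [abs_mul]
    exact mul_le_mul (hX _ _) (hY _ _) (abs_nonneg _) hx0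
  rw [Matrix.mul_apply]
  refine (Finset.abs_sum_le_sum_abs _ _).trans ?_
  refine (Finset.sum_le_card_nsmul _ _ ((m * (x * y)) * z : ℝ) fun j _ => ?_).trans (by simp)
  rw [abs_mul]
  exact mul_le_mul (h1 _ _) (hZ _ _) (abs_nonneg _) (by positivity)

theorem abs_fst_le_len (p : ℝ × ℝ) : |p.1| ≤ len p := by
  rw [len, ← Real.sqrt_sq_eq_abs]; exact Real.sqrt_le_sqrt (by nlinarith [sq_nonneg p.2])

theorem abs_snd_le_len (p : ℝ × ℝ) : |p.2| ≤ len p := by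
  rw [len, ← Real.sqrt_sq_eq_abs]; exact Real.sqrt_le_sqrt (by nlinarith [sq_nonneg p.1])

theorem exists_abs_apply_le (X : Matrix (Fin m) (Fin m) ℝ) :
    ∃ C : ℝ, 0 ≤ C ∧ ∀ a b, |X a b| ≤ C :=
  ⟨∑ a, ∑ b, |X a b|, by positivity, fun a b =>
    (Finset.single_le_sum (f := fun b => |X a b|) (fun _ _ => abs_nonneg _)
      (Finset.mem_univ b)).trans (Finset.single_le_sum (f := fun a => ∑ b, |X a b|)
        (fun _ _ => Finset.sum_nonneg fun _ _ => abs_nonneg _) (Finset.mem_univ a))⟩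

/-- The flux matrices are bounded uniformly in the direction, although the decomposition
`S n`, `lam n` need not depend continuously on `n`. -/
theorem exists_flux_bound (hd : IsPairedDecomposition B₁ B₂ S lam) :
    ∃ C : ℝ, 0 ≤ C ∧ ∀ n, len n = 1 → ∀ a b,
      |normalMatrix B₁ B₂ n a b| ≤ C ∧ |stabMatrix S lam n a b| ≤ C := by
  classical
  obtain ⟨C₁, hC₁, h₁⟩ := exists_abs_apply_le B₁
  obtain ⟨C₂, hC₂, h₂⟩ := exists_abs_apply_le B₂
  have hB : ∀ n, len n = 1 → ∀ a b, |normalMatrix B₁ B₂ n a b| ≤ C₁ + C₂ := by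
    intro n hn a b
    have e1 : |n.1| ≤ 1 := hn ▸ abs_fst_le_len n
    have e2 : |n.2| ≤ 1 := hn ▸ abs_snd_le_len n
    simp only [normalMatrix, Matrix.add_apply, Matrix.smul_apply, smul_eq_mul]
    refine (abs_add_le _ _).trans (add_le_add ?_ ?_)
    · rw [abs_mul]; exact (mul_le_mul e1 (h₁ a b) (abs_nonneg _) zero_le_one).trans (by simp)
    · rw [abs_mul]; exact (mul_le_mul e2 (h₂ a b) (abs_nonneg _) zero_le_one).trans (by simp)
  set Λ : ℝ := m * (m * (1 * (C₁ + C₂)) * 1) with hΛ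
  have hΛ0 : 0 ≤ Λ := by positivity
  -- the eigenvalues are the diagonal entries of `Sᵀ B_n S`
  have hlam : ∀ n, len n = 1 → ∀ a, |lam n a| ≤ Λ := by
    intro n hn a
    have hS := hd.orthogonal n hn
    have e : Matrix.diagonal (lam n) = (S n)ᵀ * normalMatrix B₁ B₂ n * S n := by
      rw [hd.decomp n hn, show (S n)ᵀ * (S n * Matrix.diagonal (lam n) * (S n)ᵀ) * S n
        = ((S n)ᵀ * S n) * Matrix.diagonal (lam n) * ((S n)ᵀ * S n) by
        simp only [Matrix.mul_assoc], hS]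
      simp
    have := abs_mul_mul_apply_le (X := (S n)ᵀ) (Y := normalMatrix B₁ B₂ n) (Z := S n)
      zero_le_one (add_nonneg hC₁ hC₂)
      (fun a b => abs_le_one_of_orthogonal hS b a) (hB n hn)
      (fun a b => abs_le_one_of_orthogonal hS a b) a a
    rw [← e, Matrix.diagonal_apply_eq] at this
    exact this
  have hJ : ∀ n, len n = 1 → ∀ a b, |pairJ (lam n) a b| ≤ Λ := by
    intro n hn a b
    simp only [pairJ, Matrix.of_apply]
    split_ifs
    · rw [abs_mul, abs_of_nonneg (Real.sqrt_nonneg _)]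
      have e1 : |((SignType.sign (lam n a) : SignType) : ℝ)| ≤ 1 := by
        rcases lt_trichotomy (lam n a) 0 with h | h | h <;> simp [h]
      have e2 : Real.sqrt |lam n a * lam n a.rev| ≤ Λ := by
        rw [Real.sqrt_le_left hΛ0, abs_mul, sq]
        exact mul_le_mul (hlam n hn _) (hlam n hn _) (abs_nonneg _) hΛ0
      exact (mul_le_mul e1 e2 (Real.sqrt_nonneg _) zero_le_one).trans (by simp)
    · simpa using hΛ0
  refine ⟨(C₁ + C₂) + m * (m * (1 * Λ) * 1), by positivity, fun n hn a b => ⟨?_, ?_⟩⟩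
  · exact (hB n hn a b).trans (le_add_of_nonneg_right (by positivity))
  · have hS := hd.orthogonal n hn
    rw [stabMatrix_eq hd hn, Matrix.smul_apply, smul_eq_mul, abs_mul]
    have := abs_mul_mul_apply_le (X := S n) (Y := pairJ (lam n)) (Z := (S n)ᵀ)
      zero_le_one hΛ0 (fun a b => abs_le_one_of_orthogonal hS a b) (hJ n hn)
      (fun a b => abs_le_one_of_orthogonal hS b a) a b
    have h0 : 0 ≤ (m * (m * (1 * Λ) * 1) : ℝ) := by positivity
    norm_num at this h0 ⊢
    nlinarith [abs_nonneg ((S n * pairJ (lam n) * (S n)ᵀ) a b)]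

end Pairing

/-! ### Polynomial spaces, nodal bases and Radau polynomials -/

section Polynomials

theorem polyP_le_polyQ (k : ℕ) : polyP k ≤ polyQ k :=
  Submodule.span_mono fun _ ⟨i, j, h, hf⟩ => ⟨i, j, by omega, by omega, hf⟩

theorem polyP_mono {k l : ℕ} (h : k ≤ l) : polyP k ≤ polyP l :=
  Submodule.span_mono fun _ ⟨i, j, h', hf⟩ => ⟨i, j, by omega, hf⟩

theorem monomial_mem_polyP {k i j : ℕ} (h : i + j ≤ k) :
    (fun p : ℝ × ℝ => p.1 ^ i * p.2 ^ j) ∈ polyP k :=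
  Submodule.subset_span ⟨i, j, h, rfl⟩

theorem monomial_mem_polyQ {k i j : ℕ} (hi : i ≤ k) (hj : j ≤ k) :
    (fun p : ℝ × ℝ => p.1 ^ i * p.2 ^ j) ∈ polyQ k :=
  Submodule.subset_span ⟨i, j, hi, hj, rfl⟩

theorem mul_mem_polyP {k l : ℕ} {f g : ℝ × ℝ → ℝ} (hf : f ∈ polyP k) (hg : g ∈ polyP l) :
    (fun p => f p * g p) ∈ polyP (k + l) := by
  change f * g ∈ _
  induction hf using Submodule.span_induction with
  | mem f hf =>
    obtain ⟨i, j, hij, rfl⟩ := hf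
    induction hg using Submodule.span_induction with
    | mem g hg =>
      obtain ⟨i', j', hij', rfl⟩ := hg
      have := monomial_mem_polyP (k := k + l) (i := i + i') (j := j + j') (by omega)
      convert this using 1
      ext p; simp only [Pi.mul_apply]; ring
    | zero => simp
    | add x y _ _ hx hy => rw [mul_add]; exact add_mem hx hy
    | smul a x _ hx => rw [mul_smul_comm]; exact Submodule.smul_mem _ _ hx
  | zero => simp
  | add x y _ _ hx hy => rw [add_mul]; exact add_mem hx hy
  | smul a x _ hx => rw [smul_mul_assoc]; exact Submodule.smul_mem _ _ hx

theorem affine_mem_polyP (a b c : ℝ) : (fun p : ℝ × ℝ => a + b * p.1 + c * p.2) ∈ polyP 1 := by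
  have h0 := (polyP 1).smul_mem a (monomial_mem_polyP (k := 1) (i := 0) (j := 0) (by omega))
  have h1 := (polyP 1).smul_mem b (monomial_mem_polyP (k := 1) (i := 1) (j := 0) (by omega))
  have h2 := (polyP 1).smul_mem c (monomial_mem_polyP (k := 1) (i := 0) (j := 1) (by omega))
  convert add_mem (add_mem h0 h1) h2 using 1
  ext p; simp

theorem pow_mem_polyP {f : ℝ × ℝ → ℝ} (hf : f ∈ polyP 1) (i : ℕ) :
    (fun p => f p ^ i) ∈ polyP i := by
  induction i with
  | zero => simpa using monomial_mem_polyP (k := 0) (i := 0) (j := 0) (by omega)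
  | succ i ih => simpa [pow_succ] using mul_mem_polyP ih hf

theorem eval_fst_mem_polyQ {k : ℕ} {q : Polynomial ℝ} (hq : q.natDegree ≤ k) :
    (fun p : ℝ × ℝ => q.eval p.1) ∈ polyQ k := by
  have : (fun p : ℝ × ℝ => q.eval p.1)
      = ∑ i ∈ Finset.range (k + 1), q.coeff i • fun p : ℝ × ℝ => p.1 ^ i * p.2 ^ 0 := by
    ext p
    simp [Polynomial.eval_eq_sum_range' (Nat.lt_succ_of_le hq)]
  rw [this]
  exact sum_mem fun i hi => Submodule.smul_mem _ _
    (monomial_mem_polyQ (by simpa [Nat.lt_succ_iff] using hi) (by omega))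

theorem eval_snd_mem_polyQ {k : ℕ} {q : Polynomial ℝ} (hq : q.natDegree ≤ k) :
    (fun p : ℝ × ℝ => q.eval p.2) ∈ polyQ k := by
  have : (fun p : ℝ × ℝ => q.eval p.2)
      = ∑ i ∈ Finset.range (k + 1), q.coeff i • fun p : ℝ × ℝ => p.1 ^ 0 * p.2 ^ i := by
    ext p
    simp [Polynomial.eval_eq_sum_range' (Nat.lt_succ_of_le hq)]
  rw [this]
  exact sum_mem fun i hi => Submodule.smul_mem _ _
    (monomial_mem_polyQ (by omega) (by simpa [Nat.lt_succ_iff] using hi))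

/-- The product of two univariate polynomials, one in each variable. -/
theorem eval_mul_eval_mem_polyQ {k : ℕ} {q r : Polynomial ℝ} (hq : q.natDegree ≤ k)
    (hr : r.natDegree ≤ k) : (fun p : ℝ × ℝ => q.eval p.1 * r.eval p.2) ∈ polyQ k := by
  have : (fun p : ℝ × ℝ => q.eval p.1 * r.eval p.2)
      = ∑ i ∈ Finset.range (k + 1), ∑ j ∈ Finset.range (k + 1),
          (q.coeff i * r.coeff j) • fun p : ℝ × ℝ => p.1 ^ i * p.2 ^ j := by
    ext p
    rw [Polynomial.eval_eq_sum_range' (Nat.lt_succ_of_le hq),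
      Polynomial.eval_eq_sum_range' (Nat.lt_succ_of_le hr), Finset.sum_mul_sum]
    simp only [Finset.sum_apply, Pi.smul_apply, smul_eq_mul]
    exact Finset.sum_congr rfl fun i _ => Finset.sum_congr rfl fun j _ => by ring
  rw [this]
  exact sum_mem fun i hi => sum_mem fun j hj => Submodule.smul_mem _ _
    (monomial_mem_polyQ (by simpa [Nat.lt_succ_iff] using hi)
      (by simpa [Nat.lt_succ_iff] using hj))

/-- The interpolation nodes `i / (2 (k + 1))`, `i ≤ k`. They lie in `[0, 1/2]`, so that the nodes of
the square below lie in both reference cells. -/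
def node (k : ℕ) (i : Fin (k + 1)) : ℝ := i / (2 * (k + 1))

theorem node_mem (k : ℕ) (i : Fin (k + 1)) : node k i ∈ Icc (0 : ℝ) (1 / 2) := by
  have h : (i : ℝ) ≤ k := by exact_mod_cast Nat.lt_succ_iff.1 i.2
  refine ⟨by unfold node; positivity, ?_⟩
  rw [node, div_le_iff₀ (by positivity)]; linarith

theorem node_injective (k : ℕ) : Function.Injective (node k) := by
  intro i j h
  unfold node at h
  rw [div_left_inj' (by positivity)] at h
  exact Fin.ext (by exact_mod_cast h)

/-- The Lagrange polynomials of the nodes. -/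
def lagrange (k : ℕ) (i : Fin (k + 1)) : Polynomial ℝ := Lagrange.basis Finset.univ (node k) i

theorem eq_sum_lagrange {k : ℕ} {q : Polynomial ℝ} (hq : q.natDegree ≤ k) :
    q = ∑ i, Polynomial.C (q.eval (node k i)) * lagrange k i := by
  have := Lagrange.eq_interpolate (s := Finset.univ) (v := node k) (f := q)
    (node_injective k).injOn (by
      rw [Finset.card_univ, Fintype.card_fin]
      exact Polynomial.degree_le_natDegree.trans_lt (by exact_mod_cast Nat.lt_succ_of_le hq))
  rwa [Lagrange.interpolate_apply] at this

theorem pow_eq_sum_lagrange {k i : ℕ} (hi : i ≤ k) (x : ℝ) :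
    x ^ i = ∑ j, node k j ^ i * (lagrange k j).eval x := by
  have := congrArg (Polynomial.eval x)
    (eq_sum_lagrange (k := k) (q := Polynomial.X ^ i) (by simpa using hi))
  simpa [Polynomial.eval_finsetSum] using this

/-- The leading coefficient of a polynomial on an interval is controlled by its values. -/
theorem exists_abs_leading_le (n : ℕ) : ∃ C : ℝ, 0 ≤ C ∧ ∀ (d : ℕ → ℝ) (y₀ h δ : ℝ), 0 < h →
    (∀ τ ∈ Icc (0 : ℝ) 1, |∑ l ∈ Finset.range (n + 1), d l * (y₀ + h * τ) ^ l| ≤ δ) →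
    h ^ n * |d n| ≤ C * δ := by
  refine ⟨∑ i, |(lagrange n i).coeff n|, by positivity, fun d y₀ h δ hh hd => ?_⟩
  set q : Polynomial ℝ := ∑ l ∈ Finset.range (n + 1),
    Polynomial.C (d l) * (Polynomial.C y₀ + Polynomial.C h * Polynomial.X) ^ l with hq
  have hlin : (Polynomial.C y₀ + Polynomial.C h * Polynomial.X).natDegree = 1 := by
    rw [add_comm]; exact Polynomial.natDegree_linear hh.ne'
  have hdeg : ∀ l, ((Polynomial.C (d l) *
      (Polynomial.C y₀ + Polynomial.C h * Polynomial.X) ^ l)).natDegree ≤ l := fun l => by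
    refine (Polynomial.natDegree_C_mul_le _ _).trans (Polynomial.natDegree_pow_le.trans ?_)
    rw [hlin, mul_one]
  have hqd : q.natDegree ≤ n := Polynomial.natDegree_sum_le_of_forall_le _ _ fun l hl =>
    (hdeg l).trans (by simpa [Nat.lt_succ_iff] using hl)
  have hcoeff : q.coeff n = h ^ n * d n := by
    rw [hq, Polynomial.finsetSum_coeff, Finset.sum_eq_single n]
    · rw [Polynomial.coeff_C_mul]
      have h1 := Polynomial.coeff_pow_mul_natDegree
        (Polynomial.C y₀ + Polynomial.C h * Polynomial.X) n
      rw [hlin, mul_one] at h1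
      have h3 : (Polynomial.C y₀ + Polynomial.C h * Polynomial.X).coeff 1 = h := by simp
      rw [h1, Polynomial.leadingCoeff, hlin, h3, mul_comm]
    · intro l hl hne
      refine Polynomial.coeff_eq_zero_of_natDegree_lt ((hdeg l).trans_lt ?_)
      have := Finset.mem_range.1 hl
      omega
    · simp
  have heval : ∀ τ, q.eval τ = ∑ l ∈ Finset.range (n + 1), d l * (y₀ + h * τ) ^ l := fun τ => by
    simp [hq, Polynomial.eval_finsetSum]
  have h2 : q.coeff n = ∑ i, q.eval (node n i) * (lagrange n i).coeff n := by
    conv_lhs => rw [eq_sum_lagrange hqd]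
    simp [Polynomial.coeff_C_mul]
  rw [show h ^ n * |d n| = |q.coeff n| by rw [hcoeff, abs_mul, abs_of_pos (pow_pos hh n)], h2,
    Finset.sum_mul]
  refine (Finset.abs_sum_le_sum_abs _ _).trans (Finset.sum_le_sum fun i _ => ?_)
  rw [abs_mul, mul_comm]
  refine mul_le_mul_of_nonneg_left ?_ (abs_nonneg _)
  rw [heval]
  exact hd _ ⟨(node_mem n i).1, (node_mem n i).2.trans (by norm_num)⟩

/-- The nodes of the reference square. -/
def refNode (k : ℕ) (a : Fin (k + 1) × Fin (k + 1)) : ℝ × ℝ := (node k a.1, node k a.2)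

/-- The nodal basis of `Q^k` on the reference square. -/
def refBasis (k : ℕ) (a : Fin (k + 1) × Fin (k + 1)) (p : ℝ × ℝ) : ℝ :=
  (lagrange k a.1).eval p.1 * (lagrange k a.2).eval p.2

theorem contDiff_refBasis (k : ℕ) (a : Fin (k + 1) × Fin (k + 1)) {n : WithTop ℕ∞} :
    ContDiff ℝ n (refBasis k a) := by
  have h : ∀ q : Polynomial ℝ, ContDiff ℝ n fun x => q.eval x := fun q => by
    simpa using q.contDiff_aeval (𝕜 := ℝ) n
  exact ((h _).comp contDiff_fst).mul ((h _).comp contDiff_snd)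

theorem eq_sum_refBasis {k : ℕ} {f : ℝ × ℝ → ℝ} (hf : f ∈ polyQ k) (p : ℝ × ℝ) :
    f p = ∑ a, f (refNode k a) * refBasis k a p := by
  induction hf using Submodule.span_induction with
  | mem f hf =>
    obtain ⟨i, j, hi, hj, rfl⟩ := hf
    simp only [refNode, refBasis]
    rw [pow_eq_sum_lagrange hi, pow_eq_sum_lagrange hj, Finset.sum_mul_sum,
      Fintype.sum_prod_type]
    exact Finset.sum_congr rfl fun i _ => Finset.sum_congr rfl fun j _ => by ring
  | zero => simp
  | add x y _ _ hx hy =>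
    rw [Pi.add_apply, hx, hy, ← Finset.sum_add_distrib]
    exact Finset.sum_congr rfl fun i _ => by rw [Pi.add_apply]; ring
  | smul a x _ hx =>
    rw [Pi.smul_apply, smul_eq_mul, hx, Finset.mul_sum]
    exact Finset.sum_congr rfl fun i _ => by rw [Pi.smul_apply, smul_eq_mul]; ring

/-- A positive continuous function which is homogeneous of degree two dominates the square of
the norm. -/
theorem exists_sq_norm_le {ι : Type*} [Fintype ι] {F : (ι → ℝ) → ℝ} (hF : Continuous F)
    (hom : ∀ (s : ℝ) c, F (s • c) = s ^ 2 * F c) (hpos : ∀ c, c ≠ 0 → 0 < F c) :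
    ∃ C : ℝ, 0 ≤ C ∧ ∀ c, ‖c‖ ^ 2 ≤ C * F c := by
  have h0 : F 0 = 0 := by simpa using hom 0 0
  rcases (Metric.sphere (0 : ι → ℝ) 1).eq_empty_or_nonempty with he | hne
  · refine ⟨0, le_rfl, fun c => ?_⟩
    have : c = 0 := by
      by_contra hc
      have : ‖c‖⁻¹ • c ∈ Metric.sphere (0 : ι → ℝ) 1 := by
        simp [norm_smul, norm_ne_zero_iff.2 hc]
      rw [he] at this; exact this
    simp [this]
  · obtain ⟨c₀, hc₀, hmin⟩ := (isCompact_sphere (0 : ι → ℝ) 1).exists_isMinOn hne hF.continuousOn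
    have hc₀' : 0 < F c₀ := hpos _ fun h => by simp [h] at hc₀
    refine ⟨(F c₀)⁻¹, (inv_pos.2 hc₀').le, fun c => ?_⟩
    rcases eq_or_ne c 0 with rfl | hc
    · simp [h0]
    · have hn := norm_pos_iff.2 hc
      have h1 : F c₀ ≤ F (‖c‖⁻¹ • c) := hmin (by simp [norm_smul, hn.ne'])
      rw [hom] at h1
      rw [inv_mul_eq_div, le_div_iff₀ hc₀']
      calc ‖c‖ ^ 2 * F c₀ ≤ ‖c‖ ^ 2 * (‖c‖⁻¹ ^ 2 * F c) := by gcongr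
        _ = F c := by field_simp

/-- Inverse inequality on the reference square. The square `[0, 1/2]²` on which the integral is
taken lies in both reference cells. -/
theorem exists_sq_le_integral_polyQ (k : ℕ) : ∃ C : ℝ, 0 ≤ C ∧ ∀ f ∈ polyQ k,
    ∀ p ∈ Icc (0 : ℝ) 1 ×ˢ Icc (0 : ℝ) 1,
      f p ^ 2 ≤ C * ∫ x in Icc (0 : ℝ) (1 / 2) ×ˢ Icc (0 : ℝ) (1 / 2), f x ^ 2 := by
  set A : Set (ℝ × ℝ) := Icc (0 : ℝ) (1 / 2) ×ˢ Icc (0 : ℝ) (1 / 2) with hA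
  have hAc : IsCompact A := isCompact_Icc.prod isCompact_Icc
  set ι := Fin (k + 1) × Fin (k + 1)
  have hcont : ∀ a, Continuous (refBasis k a) := fun a =>
    (contDiff_refBasis k a (n := 0)).continuous
  set g : (ι → ℝ) → ℝ × ℝ → ℝ := fun c p => ∑ a, c a * refBasis k a p with hg
  have hgc : ∀ c, Continuous (g c) := fun c =>
    continuous_finsetSum _ fun a _ => continuous_const.mul (hcont a)
  -- the integral is a positive definite quadratic form in the nodal values
  obtain ⟨C₁, hC₁, h₁⟩ := exists_sq_norm_le (F := fun c : ι → ℝ => ∫ x in A, g c x ^ 2) (by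
      have : (fun c : ι → ℝ => ∫ x in A, g c x ^ 2) = fun c => ∑ a, ∑ b,
          c a * c b * ∫ x in A, refBasis k a x * refBasis k b x := by
        ext c
        have hi : ∀ a b, IntegrableOn (fun x => c a * c b * (refBasis k a x * refBasis k b x)) A :=
          fun a b => (continuous_const.mul
            ((hcont a).mul (hcont b))).continuousOn.integrableOn_compact
            hAc
        have he : (fun x => g c x ^ 2)
            = fun x => ∑ a, ∑ b, c a * c b * (refBasis k a x * refBasis k b x) := by
          ext x
          rw [hg, sq, Finset.sum_mul_sum]
          refine Finset.sum_congr rfl fun a _ => ?_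
          exact Finset.sum_congr rfl fun b _ => by ring
        rw [he, integral_finsetSum _ fun a _ => integrable_finsetSum _ fun b _ => hi a b]
        refine Finset.sum_congr rfl fun a _ => ?_
        rw [integral_finsetSum _ fun b _ => hi a b]
        exact Finset.sum_congr rfl fun b _ => integral_const_mul _ _
      rw [this]
      fun_prop) (fun s c => by
      rw [← integral_const_mul]
      congr 1; ext x
      simp only [hg, Pi.smul_apply, smul_eq_mul, mul_assoc, ← Finset.mul_sum]; ring) (fun c hc => by
      refine lt_of_le_of_ne (integral_nonneg fun _ => sq_nonneg _) fun h => hc ?_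
      have h2 := (setIntegral_eq_zero_iff_of_nonneg_ae (μ := volume) (s := A)
        (Filter.Eventually.of_forall fun x => sq_nonneg (g c x))
        (((hgc c).pow 2).continuousOn.integrableOn_compact hAc)).1 h.symm
      have h3 : EqOn (fun x => g c x ^ 2) 0 A :=
        Measure.eqOn_of_ae_eq h2 ((hgc c).pow 2).continuousOn continuousOn_const (by
          rw [hA, interior_prod_eq, interior_Icc, closure_prod_eq, closure_Ioo (by norm_num)])
      ext b
      have h4 := h3 (show refNode k b ∈ A from ⟨node_mem k b.1, node_mem k b.2⟩)
      simp only [Pi.zero_apply, pow_eq_zero_iff two_ne_zero, hg] at h4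
      have hone : ∀ a, refBasis k a (refNode k b) = if a = b then 1 else 0 := fun a => by
        have e : ∀ i j : Fin (k + 1), (lagrange k i).eval (node k j) = if i = j then 1 else 0 := by
          intro i j
          split_ifs with hij
          · subst hij
            exact Lagrange.eval_basis_self (node_injective k).injOn (Finset.mem_univ _)
          · exact Lagrange.eval_basis_of_ne (fun h => hij h) (Finset.mem_univ _)
        simp only [refBasis, refNode, e]
        by_cases h1 : a.1 = b.1 <;> by_cases h2 : a.2 = b.2 <;> simp [h1, h2, Prod.ext_iff]
      simpa [hone] using h4)
  have hbd : ∀ a, ∃ b : ℝ, ∀ p ∈ Icc (0 : ℝ) 1 ×ˢ Icc (0 : ℝ) 1, |refBasis k a p| ≤ b := fun a => by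
    obtain ⟨b, hb⟩ := (isCompact_Icc.prod isCompact_Icc).exists_bound_of_continuousOn
      (s := Icc (0 : ℝ) 1 ×ˢ Icc (0 : ℝ) 1) (hcont a).continuousOn
    exact ⟨b, hb⟩
  choose b hb using hbd
  refine ⟨(∑ a, b a) ^ 2 * C₁, by positivity, fun f hf p hp => ?_⟩
  set c : ι → ℝ := fun a => f (refNode k a) with hc
  have hfg : ∀ x, f x = g c x := fun x => eq_sum_refBasis hf x
  have h5 : |f p| ≤ (∑ a, b a) * ‖c‖ := by
    rw [hfg, Finset.sum_mul]
    refine (Finset.abs_sum_le_sum_abs _ _).trans (Finset.sum_le_sum fun a _ => ?_)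
    rw [abs_mul, mul_comm]
    exact mul_le_mul (hb a p hp) (norm_le_pi_norm c a) (abs_nonneg _)
      ((abs_nonneg _).trans (hb a p hp))
  calc f p ^ 2 = |f p| ^ 2 := (sq_abs _).symm
    _ ≤ ((∑ a, b a) * ‖c‖) ^ 2 := by gcongr
    _ = (∑ a, b a) ^ 2 * ‖c‖ ^ 2 := by ring
    _ ≤ (∑ a, b a) ^ 2 * (C₁ * ∫ x in A, g c x ^ 2) := by gcongr; exact h₁ c
    _ = _ := by simp_rw [hfg]; ring

/-- The Radau polynomial: monic of degree `k + 1`, orthogonal on `[0, 1]` to all polynomials of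
degree less than `k`, with value `0` at the left end point. -/
theorem exists_radau_left (k : ℕ) : ∃ R : Polynomial ℝ, R.Monic ∧ R.natDegree = k + 1 ∧
    R.eval 0 = 0 ∧ ∀ i < k, ∫ x in (0 : ℝ)..1, R.eval x * x ^ i = 0 := by
  -- `R = X * (X ^ k + ∑ c l X ^ l)`, and the moments of `X * ∑ c l X ^ l` determine `c`
  set p : (Fin k → ℝ) → ℝ → ℝ := fun c x => ∑ l, c l * x ^ (l : ℕ) with hp
  have hpc : ∀ c, Continuous (p c) := fun c => by simp only [hp]; fun_prop
  let A : (Fin k → ℝ) →ₗ[ℝ] (Fin k → ℝ) :=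
    { toFun := fun c i => ∫ x in (0 : ℝ)..1, x * p c x * x ^ (i : ℕ)
      map_add' := fun c d => by
        ext i
        rw [Pi.add_apply, ← intervalIntegral.integral_add]
        · congr 1; ext x; simp only [hp, Pi.add_apply, add_mul, Finset.sum_add_distrib]; ring
        · have := hpc c; exact (by fun_prop : Continuous _).intervalIntegrable _ _
        · have := hpc d; exact (by fun_prop : Continuous _).intervalIntegrable _ _
      map_smul' := fun s c => by
        ext i
        rw [Pi.smul_apply, smul_eq_mul, RingHom.id_apply, ← intervalIntegral.integral_const_mul]
        congr 1; ext x
        simp only [hp, Pi.smul_apply, smul_eq_mul, mul_assoc, ← Finset.mul_sum]; ring }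
  have hinj : Function.Injective A := by
    rw [← LinearMap.ker_eq_bot, LinearMap.ker_eq_bot']
    intro c hc
    have hz : ∫ x in (0 : ℝ)..1, x * p c x ^ 2 = 0 := by
      have h1 : ∀ i : Fin k, ∫ x in (0 : ℝ)..1, x * p c x * x ^ (i : ℕ) = 0 := congrFun hc
      have h2 : (fun x => x * p c x ^ 2)
          = fun x => ∑ i : Fin k, c i * (x * p c x * x ^ (i : ℕ)) := by
        ext x
        rw [sq]
        nth_rewrite 2 [hp]
        simp only [Finset.mul_sum]
        exact Finset.sum_congr rfl fun i _ => by ring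
      rw [h2, intervalIntegral.integral_finsetSum]
      · simp [intervalIntegral.integral_const_mul, h1]
      · intro i _
        have := hpc c
        exact (by fun_prop : Continuous _).intervalIntegrable _ _
    have hzero : ∀ x ∈ Ioc (0 : ℝ) 1, p c x = 0 := by
      intro x hx
      by_contra hne
      have := hpc c
      have hpos : 0 < ∫ x in (0 : ℝ)..1, x * p c x ^ 2 :=
        intervalIntegral.integral_pos zero_lt_one (by fun_prop)
          (fun y hy => mul_nonneg hy.1.le (sq_nonneg _))
          ⟨x, ⟨hx.1.le, hx.2⟩, mul_pos hx.1 (by positivity)⟩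
      exact hpos.ne' hz
    set q : Polynomial ℝ := ∑ l : Fin k, Polynomial.C (c l) * Polynomial.X ^ (l : ℕ) with hq
    have hq0 : q = 0 := by
      refine Polynomial.eq_zero_of_infinite_isRoot q
        ((Ioc_infinite (zero_lt_one' ℝ)).mono fun x hx => ?_)
      have := hzero x hx
      simpa [hq, Polynomial.eval_finsetSum, hp] using this
    ext l
    have := congrArg (fun r : Polynomial ℝ => r.coeff l) hq0
    simpa [hq, Polynomial.finsetSum_coeff, Polynomial.coeff_C_mul, Polynomial.coeff_X_pow,
      Fin.val_inj] using this
  obtain ⟨c, hc⟩ := LinearMap.injective_iff_surjective.1 hinj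
    (fun i => -∫ x in (0 : ℝ)..1, x * x ^ k * x ^ (i : ℕ))
  set q : Polynomial ℝ := ∑ l : Fin k, Polynomial.C (c l) * Polynomial.X ^ (l : ℕ) with hq
  have hqd : q.degree < k := by
    refine (Polynomial.degree_sum_le _ _).trans_lt ?_
    rw [Finset.sup_lt_iff (by exact WithBot.bot_lt_coe k)]
    intro l _
    exact (Polynomial.degree_C_mul_X_pow_le _ _).trans_lt (by exact_mod_cast l.2)
  have hmon : (Polynomial.X ^ k + q).Monic := Polynomial.monic_X_pow_add hqd
  have hnat : (Polynomial.X ^ k + q).natDegree = k := by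
    rw [Polynomial.natDegree_add_eq_left_of_degree_lt] <;> simp [hqd]
  refine ⟨Polynomial.X * (Polynomial.X ^ k + q), Polynomial.monic_X.mul hmon, ?_, by simp, ?_⟩
  · rw [Polynomial.monic_X.natDegree_mul hmon, hnat, Polynomial.natDegree_X, add_comm]
  · intro i hi
    have h1 : (∫ x in (0 : ℝ)..1, x * p c x * x ^ i) = -∫ x in (0 : ℝ)..1, x * x ^ k * x ^ i :=
      congrFun hc ⟨i, hi⟩
    have h2 : (fun x : ℝ => (Polynomial.X * (Polynomial.X ^ k + q)).eval x * x ^ i)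
        = fun x => x * x ^ k * x ^ i + x * p c x * x ^ i := by
      ext x; simp [hq, hp, Polynomial.eval_finsetSum]; ring
    have := hpc c
    rw [h2, intervalIntegral.integral_add
      ((by fun_prop : Continuous _).intervalIntegrable _ _)
      ((by fun_prop : Continuous _).intervalIntegrable _ _), h1, add_neg_cancel]

/-- The mirror image of a Radau polynomial, with value `0` at the right end point. -/
theorem exists_radau_right (k : ℕ) : ∃ R : Polynomial ℝ, R.Monic ∧ R.natDegree = k + 1 ∧
    R.eval 1 = 0 ∧ ∀ i < k, ∫ x in (0 : ℝ)..1, R.eval x * x ^ i = 0 := by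
  obtain ⟨R, hm, hd, h0, ho⟩ := exists_radau_left k
  have hl : (1 - Polynomial.X : Polynomial ℝ) = -(Polynomial.X - Polynomial.C 1) := by simp
  have hl1 : (1 - Polynomial.X : Polynomial ℝ).natDegree = 1 := by
    rw [hl, Polynomial.natDegree_neg, Polynomial.natDegree_X_sub_C]
  have hlc : (1 - Polynomial.X : Polynomial ℝ).leadingCoeff = -1 := by
    rw [hl, Polynomial.leadingCoeff_neg, Polynomial.leadingCoeff_X_sub_C]
  -- orthogonality to powers of `x` gives orthogonality to powers of `1 - x`
  have ho' : ∀ i < k, ∫ x in (0 : ℝ)..1, R.eval x * (1 - x) ^ i = 0 := by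
    intro i hi
    have : (fun x : ℝ => R.eval x * (1 - x) ^ i) = fun x => ∑ j ∈ Finset.range (i + 1),
        ((-1) ^ j * (i.choose j)) * (R.eval x * x ^ j) := by
      ext x
      rw [sub_eq_neg_add, add_pow, Finset.mul_sum]
      exact Finset.sum_congr rfl fun j _ => by rw [neg_pow]; ring
    rw [this, intervalIntegral.integral_finsetSum]
    · refine Finset.sum_eq_zero fun j hj => ?_
      rw [intervalIntegral.integral_const_mul, ho j (by have := Finset.mem_range.1 hj; omega),
        mul_zero]
    · intro j _
      have := R.continuous
      exact (by fun_prop : Continuous _).intervalIntegrable _ _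
  refine ⟨Polynomial.C ((-1) ^ (k + 1)) * R.comp (1 - Polynomial.X), ?_, ?_, by simp [h0], ?_⟩
  · rw [Polynomial.Monic, Polynomial.leadingCoeff_mul, Polynomial.leadingCoeff_C,
      Polynomial.leadingCoeff_comp (by rw [hl1]; exact one_ne_zero), hm.leadingCoeff, hlc, hd,
      one_mul, ← mul_pow]
    norm_num
  · rw [Polynomial.natDegree_C_mul (pow_ne_zero _ (by norm_num)), Polynomial.natDegree_comp, hd,
      hl1, mul_one]
  · intro i hi
    have := intervalIntegral.integral_comp_sub_left
      (fun x : ℝ => R.eval x * (1 - x) ^ i) (a := 0) (b := 1) 1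
    simp only [sub_self, sub_zero, ho' i hi, sub_sub_cancel] at this
    simp only [Polynomial.eval_mul, Polynomial.eval_C, Polynomial.eval_comp, Polynomial.eval_sub,
      Polynomial.eval_one, Polynomial.eval_X, mul_assoc, intervalIntegral.integral_const_mul, this,
      mul_zero]

end Polynomials

/-! ### Geometry of the elements and the divergence theorem -/

namespace Element

/-- The Jacobian determinant of `K.map`, comparable to the area of `K`. -/
def jac (K : Element) : ℝ := K.v.1 * K.w.2 - K.v.2 * K.w.1

theorem jac_pos (K : Element) : 0 < K.jac := K.det_pos

/-- The inverse of `K.map`. -/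
def inv (K : Element) (x : ℝ × ℝ) : ℝ × ℝ :=
  ((K.w.2 * (x.1 - K.a.1) - K.w.1 * (x.2 - K.a.2)) / K.jac,
    (K.v.1 * (x.2 - K.a.2) - K.v.2 * (x.1 - K.a.1)) / K.jac)

theorem inv_map (K : Element) (p : ℝ × ℝ) : K.inv (K.map p) = p := by
  have h := K.jac_pos.ne'
  ext
  · simp only [inv, map, Prod.fst_add, Prod.snd_add, Prod.smul_fst, Prod.smul_snd, smul_eq_mul]
    rw [div_eq_iff h, jac]; ring
  · simp only [inv, map, Prod.fst_add, Prod.snd_add, Prod.smul_fst, Prod.smul_snd, smul_eq_mul]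
    rw [div_eq_iff h, jac]; ring

theorem map_inv (K : Element) (x : ℝ × ℝ) : K.map (K.inv x) = x := by
  have h := K.jac_pos.ne'
  ext
  · simp only [inv, map, Prod.fst_add, Prod.smul_fst, smul_eq_mul]
    field_simp; rw [jac]; ring
  · simp only [inv, map, Prod.snd_add, Prod.smul_snd, smul_eq_mul]
    field_simp; rw [jac]; ring

theorem contDiff_inv (K : Element) {n : WithTop ℕ∞} : ContDiff ℝ n K.inv := by
  unfold inv; fun_prop

theorem contDiff_map (K : Element) {n : WithTop ℕ∞} : ContDiff ℝ n K.map := by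
  unfold map; fun_prop

theorem continuous_map (K : Element) : Continuous K.map := K.contDiff_map (n := 0).continuous

theorem carrier_eq_preimage (K : Element) : K.carrier = K.inv ⁻¹' K.refCell := by
  ext x
  constructor
  · rintro ⟨p, hp, rfl⟩; simpa [inv_map] using hp
  · intro hx; exact ⟨K.inv x, hx, K.map_inv x⟩

theorem refCell_subset (K : Element) : K.refCell ⊆ Icc (0 : ℝ) 1 ×ˢ Icc (0 : ℝ) 1 := by
  unfold refCell
  split_ifs
  · rfl
  · rintro p ⟨h1, h2, h3⟩
    exact ⟨⟨h1, by linarith⟩, ⟨h2, by linarith⟩⟩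

theorem subset_refCell (K : Element) : Icc (0 : ℝ) (1 / 2) ×ˢ Icc (0 : ℝ) (1 / 2) ⊆ K.refCell := by
  unfold refCell
  rintro p ⟨⟨h1, h2⟩, ⟨h3, h4⟩⟩
  split_ifs
  · exact ⟨⟨h1, by linarith⟩, ⟨h3, by linarith⟩⟩
  · exact ⟨h1, h3, by linarith⟩

theorem isClosed_refCell (K : Element) : IsClosed K.refCell := by
  unfold refCell
  split_ifs
  · exact isClosed_Icc.prod isClosed_Icc
  · exact (isClosed_le continuous_const continuous_fst).inter
      ((isClosed_le continuous_const continuous_snd).inter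
        (isClosed_le (continuous_fst.add continuous_snd) continuous_const))

theorem isCompact_refCell (K : Element) : IsCompact K.refCell :=
  (isCompact_Icc.prod isCompact_Icc).of_isClosed_subset K.isClosed_refCell K.refCell_subset

theorem convex_refCell (K : Element) : Convex ℝ K.refCell := by
  unfold refCell
  split_ifs
  · exact (convex_Icc 0 1).prod (convex_Icc 0 1)
  · rintro p ⟨h1, h2, h3⟩ q ⟨h4, h5, h6⟩ s t hs ht hst
    simp only [mem_ofPred_eq, Prod.fst_add, Prod.snd_add, Prod.smul_fst, Prod.smul_snd, smul_eq_mul]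
    refine ⟨by positivity, by positivity, ?_⟩
    nlinarith

theorem isCompact_carrier (K : Element) : IsCompact K.carrier :=
  K.isCompact_refCell.image K.continuous_map

theorem convex_carrier (K : Element) : Convex ℝ K.carrier := by
  rintro _ ⟨p, hp, rfl⟩ _ ⟨q, hq, rfl⟩ s t hs ht hst
  refine ⟨s • p + t • q, K.convex_refCell hp hq hs ht hst, ?_⟩
  have h : K.a = s • K.a + t • K.a := by rw [← add_smul, hst, one_smul]
  simp only [map, Prod.fst_add, Prod.snd_add, Prod.smul_fst, Prod.smul_snd, smul_eq_mul]
  nth_rewrite 1 [h]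
  module

theorem measurableSet_carrier (K : Element) : MeasurableSet K.carrier :=
  K.isCompact_carrier.measurableSet

theorem volume_frontier_carrier (K : Element) : volume (frontier K.carrier) = 0 :=
  K.convex_carrier.addHaar_frontier volume

theorem interior_carrier_nonempty (K : Element) : (interior K.carrier).Nonempty := by
  refine ⟨K.map (1 / 4, 1 / 4), mem_interior.2
    ⟨K.inv ⁻¹' (Ioo (0 : ℝ) (1 / 2) ×ˢ Ioo (0 : ℝ) (1 / 2)), ?_, ?_, ?_⟩⟩
  · rw [carrier_eq_preimage]
    exact preimage_mono ((prod_mono Ioo_subset_Icc_self Ioo_subset_Icc_self).trans K.subset_refCell)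
  · exact (isOpen_Ioo.prod isOpen_Ioo).preimage (K.contDiff_inv (n := 0)).continuous
  · rw [mem_preimage, inv_map]; norm_num

theorem closure_interior_carrier (K : Element) : closure (interior K.carrier) = K.carrier := by
  rw [K.convex_carrier.closure_interior_eq_closure_of_nonempty_interior K.interior_carrier_nonempty,
    K.isCompact_carrier.isClosed.closure_eq]

theorem ae_restrict_mem_interior (K : Element) :
    ∀ᵐ x ∂volume.restrict K.carrier, x ∈ interior K.carrier := by
  rw [ae_restrict_iff' K.measurableSet_carrier]
  have h := measure_eq_zero_iff_ae_notMem.1 K.volume_frontier_carrier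
  filter_upwards [h] with x hx hxK
  by_contra hi
  exact hx ⟨subset_closure hxK, hi⟩

/-- The linear part of `K.map`. -/
def linMap (K : Element) : ℝ × ℝ →L[ℝ] ℝ × ℝ :=
  (ContinuousLinearMap.fst ℝ ℝ ℝ).smulRight K.v + (ContinuousLinearMap.snd ℝ ℝ ℝ).smulRight K.w

theorem det_linMap (K : Element) : K.linMap.det = K.jac := by
  have : (K.linMap : ℝ × ℝ →ₗ[ℝ] ℝ × ℝ) = Matrix.toLin (Module.Basis.finTwoProd ℝ)
      (Module.Basis.finTwoProd ℝ) !![K.v.1, K.w.1; K.v.2, K.w.2] := by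
    rw [Matrix.toLin_finTwoProd]
    ext <;> simp [linMap]
  rw [ContinuousLinearMap.det, this, LinearMap.det_toLin, Matrix.det_fin_two_of, jac]
  ring

theorem hasFDerivAt_map (K : Element) (p : ℝ × ℝ) : HasFDerivAt K.map K.linMap p := by
  have h : K.map = fun p => K.a + K.linMap p := by
    ext p <;> simp [map, linMap, add_assoc]
  rw [h]
  exact K.linMap.hasFDerivAt.const_add _

theorem setIntegral_carrier (K : Element) (g : ℝ × ℝ → ℝ) :
    ∫ x in K.carrier, g x = K.jac * ∫ p in K.refCell, g (K.map p) := by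
  rw [carrier, integral_image_eq_integral_abs_det_fderiv_smul volume
    K.isClosed_refCell.measurableSet (fun p _ => (K.hasFDerivAt_map p).hasFDerivWithinAt)
    (Function.LeftInverse.injective K.inv_map).injOn]
  simp_rw [det_linMap, abs_of_pos K.jac_pos, smul_eq_mul]
  rw [integral_const_mul]

theorem integrableOn_carrier (K : Element) {g : ℝ × ℝ → ℝ} (hg : ContinuousOn g K.carrier) :
    IntegrableOn g K.carrier := hg.integrableOn_compact K.isCompact_carrier

theorem volume_carrier_le (K : Element) : volume.real K.carrier ≤ K.jac := by
  have h := K.setIntegral_carrier fun _ => 1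
  simp only [setIntegral_const, smul_eq_mul, mul_one] at h
  rw [h]
  have h1 : volume.real K.refCell ≤ volume.real (Icc (0 : ℝ) 1 ×ˢ Icc (0 : ℝ) 1) :=
    measureReal_mono K.refCell_subset (isCompact_Icc.prod isCompact_Icc).measure_ne_top
  have h2 : volume.real (Icc (0 : ℝ) 1 ×ˢ Icc (0 : ℝ) 1) = 1 := by
    rw [Measure.volume_eq_prod, measureReal_prod_prod]; simp
  nlinarith [K.jac_pos]

theorem jac_le_volume_carrier (K : Element) : K.jac ≤ 4 * volume.real K.carrier := by
  have h := K.setIntegral_carrier fun _ => 1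
  simp only [setIntegral_const, smul_eq_mul, mul_one] at h
  rw [h]
  have h1 : volume.real (Icc (0 : ℝ) (1 / 2) ×ˢ Icc (0 : ℝ) (1 / 2)) ≤ volume.real K.refCell :=
    measureReal_mono K.subset_refCell K.isCompact_refCell.measure_ne_top
  have h2 : volume.real (Icc (0 : ℝ) (1 / 2) ×ˢ Icc (0 : ℝ) (1 / 2)) = 1 / 4 := by
    rw [Measure.volume_eq_prod, measureReal_prod_prod]; simp; norm_num
  nlinarith [K.jac_pos]

theorem vert_mem_carrier (K : Element) (l : ℕ) : K.vert l ∈ K.carrier := by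
  have h : ∃ p ∈ K.refCell, K.map p = K.vert l := by
    unfold refCell
    rcases l with _ | _ | _ | _ | l
    · exact ⟨(0, 0), by split_ifs <;> simp, by simp [map, vert]⟩
    · exact ⟨(1, 0), by split_ifs <;> simp, by simp [map, vert]⟩
    · rcases hK : K.isRect
      · exact ⟨(0, 1), by simp, by simp [map, vert, hK]⟩
      · exact ⟨(1, 1), by simp, by simp [map, vert, hK]⟩
    · rcases hK : K.isRect
      · exact ⟨(0, 0), by simp, by simp [map, vert, hK]⟩
      · exact ⟨(0, 1), by simp, by simp [map, vert, hK]⟩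
    · exact ⟨(0, 0), by split_ifs <;> simp, by simp [map, vert]⟩
  obtain ⟨p, hp, h⟩ := h
  exact ⟨p, hp, h⟩

/-- The edge vector from the vertex `l` to the next one. -/
def edge (K : Element) (l : ℕ) : ℝ × ℝ := K.vert (l + 1) - K.vert l

theorem edge_mem_carrier (K : Element) (l : ℕ) {s : ℝ} (hs : s ∈ Icc (0 : ℝ) 1) :
    K.vert l + s • K.edge l ∈ K.carrier := by
  have := K.convex_carrier (K.vert_mem_carrier l) (K.vert_mem_carrier (l + 1))
    (sub_nonneg.2 hs.2) hs.1 (by ring)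
  convert this using 1
  rw [edge]; module

theorem setIntegral_square {G : ℝ × ℝ → ℝ} (hG : Continuous G) :
    ∫ p in Icc (0 : ℝ) 1 ×ˢ Icc (0 : ℝ) 1, G p
      = ∫ x in (0 : ℝ)..1, ∫ y in (0 : ℝ)..1, G (x, y) := by
  rw [Measure.volume_eq_prod, setIntegral_prod G
    (hG.continuousOn.integrableOn_compact (isCompact_Icc.prod isCompact_Icc))]
  simp only [integral_Icc_eq_integral_Ioc, intervalIntegral.integral_of_le zero_le_one]

theorem setIntegral_triangle {G : ℝ × ℝ → ℝ} (hG : Continuous G) :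
    ∫ p in {p : ℝ × ℝ | 0 ≤ p.1 ∧ 0 ≤ p.2 ∧ p.1 + p.2 ≤ 1}, G p
      = ∫ x in (0 : ℝ)..1, ∫ y in (0 : ℝ)..(1 - x), G (x, y) := by
  set A : Set (ℝ × ℝ) := {p : ℝ × ℝ | 0 ≤ p.1 ∧ 0 ≤ p.2 ∧ p.1 + p.2 ≤ 1} with hA
  have hcl : IsClosed A := (isClosed_le continuous_const continuous_fst).inter
      ((isClosed_le continuous_const continuous_snd).inter
        (isClosed_le (continuous_fst.add continuous_snd) continuous_const))
  have hsub : A ⊆ Icc (0 : ℝ) 1 ×ˢ Icc (0 : ℝ) 1 := by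
    rintro p ⟨h1, h2, h3⟩
    exact ⟨⟨h1, by linarith⟩, ⟨h2, by linarith⟩⟩
  have hc : IsCompact A := (isCompact_Icc.prod isCompact_Icc).of_isClosed_subset hcl hsub
  have hi : Integrable (A.indicator G) (volume.prod volume) := by
    rw [← Measure.volume_eq_prod, integrable_indicator_iff hcl.measurableSet]
    exact hG.continuousOn.integrableOn_compact hc
  rw [← integral_indicator hcl.measurableSet, Measure.volume_eq_prod, integral_prod _ hi,
    intervalIntegral.integral_of_le zero_le_one, ← integral_Icc_eq_integral_Ioc,
    ← integral_indicator measurableSet_Icc]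
  congr 1
  ext x
  by_cases hx : x ∈ Icc (0 : ℝ) 1
  · rw [indicator_of_mem hx, intervalIntegral.integral_of_le (sub_nonneg.2 hx.2),
      ← integral_Icc_eq_integral_Ioc, ← integral_indicator measurableSet_Icc]
    congr 1
    ext y
    by_cases hy : y ∈ Icc (0 : ℝ) (1 - x)
    · rw [indicator_of_mem hy, indicator_of_mem (show (x, y) ∈ A from ⟨hx.1, hy.1, by
        have := hy.2; simp only; linarith⟩)]
    · rw [indicator_of_notMem hy, indicator_of_notMem (fun h : (x, y) ∈ A => hy ⟨h.2.1, by
        have := h.2.2; simp only at this; linarith⟩)]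
  · rw [indicator_of_notMem hx]
    have : ∀ y, A.indicator G (x, y) = 0 := fun y =>
      indicator_of_notMem (fun h : (x, y) ∈ A => hx ⟨h.1, by
        have h2 := h.2.1; have h3 := h.2.2; simp only at h2 h3; linarith⟩) _
    simp [this]

theorem setIntegral_comp_swap {A : Set (ℝ × ℝ)} (G : ℝ × ℝ → ℝ) (hA : Prod.swap ⁻¹' A = A) :
    ∫ p in A, G p.swap = ∫ p in A, G p := by
  have := (Measure.measurePreserving_swap (μ := (volume : Measure ℝ))
    (ν := (volume : Measure ℝ))).setIntegral_preimage_emb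
    MeasurableEquiv.prodComm.measurableEmbedding G A
  rwa [hA] at this

section FTC

variable {G : ℝ × ℝ → ℝ}

theorem integral_fderiv_snd (hG : ContDiff ℝ 1 G) (x a b : ℝ) :
    ∫ y in a..b, fderiv ℝ G (x, y) (0, 1) = G (x, b) - G (x, a) := by
  refine intervalIntegral.integral_eq_sub_of_hasDerivAt (f := fun y => G (x, y)) (fun y _ => ?_) ?_
  · exact ((hG.differentiable one_ne_zero (x, y)).hasFDerivAt.comp_hasDerivAt y
      ((hasDerivAt_const y x).prodMk (hasDerivAt_id y)))
  · have := hG.continuous_fderiv one_ne_zero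
    exact (by fun_prop : Continuous _).intervalIntegrable _ _

theorem integral_fderiv_fst (hG : ContDiff ℝ 1 G) (y a b : ℝ) :
    ∫ x in a..b, fderiv ℝ G (x, y) (1, 0) = G (b, y) - G (a, y) := by
  refine intervalIntegral.integral_eq_sub_of_hasDerivAt (f := fun x => G (x, y)) (fun x _ => ?_) ?_
  · exact ((hG.differentiable one_ne_zero (x, y)).hasFDerivAt.comp_hasDerivAt x
      ((hasDerivAt_id x).prodMk (hasDerivAt_const x y)))
  · have := hG.continuous_fderiv one_ne_zero
    exact (by fun_prop : Continuous _).intervalIntegrable _ _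

theorem setIntegral_square_fderiv (hG : ContDiff ℝ 1 G) :
    (∫ p in Icc (0 : ℝ) 1 ×ˢ Icc (0 : ℝ) 1, fderiv ℝ G p (1, 0)
      = (∫ s in (0 : ℝ)..1, G (1, s)) - ∫ s in (0 : ℝ)..1, G (0, s)) ∧
    (∫ p in Icc (0 : ℝ) 1 ×ˢ Icc (0 : ℝ) 1, fderiv ℝ G p (0, 1)
      = (∫ s in (0 : ℝ)..1, G (s, 1)) - ∫ s in (0 : ℝ)..1, G (s, 0)) := by
  have hc := hG.continuous
  have hf := hG.continuous_fderiv one_ne_zero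
  constructor
  · rw [← setIntegral_comp_swap _ (by ext p; simp),
      setIntegral_square (by fun_prop)]
    simp only [Prod.swap_prod_mk, integral_fderiv_fst hG]
    exact intervalIntegral.integral_sub ((by fun_prop : Continuous _).intervalIntegrable _ _)
      ((by fun_prop : Continuous _).intervalIntegrable _ _)
  · rw [setIntegral_square (by fun_prop)]
    simp only [integral_fderiv_snd hG]
    exact intervalIntegral.integral_sub ((by fun_prop : Continuous _).intervalIntegrable _ _)
      ((by fun_prop : Continuous _).intervalIntegrable _ _)

theorem setIntegral_triangle_fderiv (hG : ContDiff ℝ 1 G) :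
    (∫ p in {p : ℝ × ℝ | 0 ≤ p.1 ∧ 0 ≤ p.2 ∧ p.1 + p.2 ≤ 1}, fderiv ℝ G p (1, 0)
      = (∫ s in (0 : ℝ)..1, G (1 - s, s)) - ∫ s in (0 : ℝ)..1, G (0, s)) ∧
    (∫ p in {p : ℝ × ℝ | 0 ≤ p.1 ∧ 0 ≤ p.2 ∧ p.1 + p.2 ≤ 1}, fderiv ℝ G p (0, 1)
      = (∫ s in (0 : ℝ)..1, G (s, 1 - s)) - ∫ s in (0 : ℝ)..1, G (s, 0)) := by
  have hc := hG.continuous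
  have hf := hG.continuous_fderiv one_ne_zero
  constructor
  · rw [← setIntegral_comp_swap _ (by ext p; simp [and_left_comm, add_comm]),
      setIntegral_triangle (by fun_prop)]
    simp only [Prod.swap_prod_mk, integral_fderiv_fst hG]
    exact intervalIntegral.integral_sub ((by fun_prop : Continuous _).intervalIntegrable _ _)
      ((by fun_prop : Continuous _).intervalIntegrable _ _)
  · rw [setIntegral_triangle (by fun_prop)]
    simp only [integral_fderiv_snd hG]
    exact intervalIntegral.integral_sub ((by fun_prop : Continuous _).intervalIntegrable _ _)
      ((by fun_prop : Continuous _).intervalIntegrable _ _)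

end FTC

theorem integral_comp_one_sub (f : ℝ → ℝ) :
    ∫ s in (0 : ℝ)..1, f (1 - s) = ∫ s in (0 : ℝ)..1, f s := by
  rw [intervalIntegral.integral_comp_sub_left (fun s => f s)]; simp

/-- The divergence theorem on an element, in a fixed direction `d`. -/
theorem setIntegral_fderiv (K : Element) {g : ℝ × ℝ → ℝ} (hg : ContDiff ℝ 1 g) (d : ℝ × ℝ) :
    ∫ x in K.carrier, fderiv ℝ g x d = ∑ l : Fin K.numSides,
      (d.1 * (K.edge l).2 - d.2 * (K.edge l).1)
        * ∫ s in (0 : ℝ)..1, g (K.vert l + s • K.edge l) := by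
  set G : ℝ × ℝ → ℝ := fun p => g (K.map p) with hGdef
  have hG : ContDiff ℝ 1 G := hg.comp K.contDiff_map
  have hf := hG.continuous_fderiv one_ne_zero
  have hGd : ∀ p q, fderiv ℝ G p q = fderiv ℝ g (K.map p) (K.linMap q) := fun p q => by
    have := ((hg.differentiable one_ne_zero (K.map p)).hasFDerivAt.comp p (K.hasFDerivAt_map p))
    rw [show G = g ∘ K.map from rfl, this.fderiv]
    rfl
  have hd : ∀ p, K.jac * fderiv ℝ g (K.map p) d = (d.1 * K.w.2 - d.2 * K.w.1) * fderiv ℝ G p (1, 0)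
      + (d.2 * K.v.1 - d.1 * K.v.2) * fderiv ℝ G p (0, 1) := fun p => by
    have hv : K.jac • d = (d.1 * K.w.2 - d.2 * K.w.1) • K.linMap (1, 0)
        + (d.2 * K.v.1 - d.1 * K.v.2) • K.linMap (0, 1) := by
      ext
      · simp [linMap, jac]; ring
      · simp [linMap, jac]; ring
    have := congrArg (fderiv ℝ g (K.map p)) hv
    simpa only [map_smul, map_add, smul_eq_mul, ← hGd] using this
  rw [setIntegral_carrier, ← integral_const_mul]
  simp_rw [hd]
  have hint : ∀ q : ℝ × ℝ, ∀ c : ℝ, IntegrableOn (fun p => c * fderiv ℝ G p q) K.refCell :=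
    fun q c =>
      (by fun_prop : Continuous fun p => c * fderiv ℝ G p q).continuousOn.integrableOn_compact
      K.isCompact_refCell
  rw [integral_add (hint _ _) (hint _ _), integral_const_mul, integral_const_mul,
    Fin.sum_univ_eq_sum_range (fun l => (d.1 * (K.edge l).2 - d.2 * (K.edge l).1)
        * ∫ s in (0 : ℝ)..1, g (K.vert l + s • K.edge l))]
  have hpt : ∀ (x y : ℝ × ℝ), x = y → g x = g y := fun x y h => by rw [h]
  rcases hK : K.isRect
  · have e0 : ∫ s in (0 : ℝ)..1, g (K.vert 0 + s • K.edge 0) = ∫ s in (0 : ℝ)..1, G (s, 0) := by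
      congr 1; ext s; apply hpt
      ext <;> simp [vert, edge, map]
    have e1 : ∫ s in (0 : ℝ)..1, g (K.vert 1 + s • K.edge 1) = ∫ s in (0 : ℝ)..1, G (1 - s, s) := by
      congr 1; ext s; apply hpt
      ext <;> simp [vert, edge, map, hK] <;> ring
    have e2 : ∫ s in (0 : ℝ)..1, g (K.vert 2 + s • K.edge 2) = ∫ s in (0 : ℝ)..1, G (0, s) := by
      rw [← integral_comp_one_sub fun s => G (0, s)]
      congr 1; ext s; apply hpt
      ext <;> simp [vert, edge, map, hK] <;> ring
    have e3 : ∫ s in (0 : ℝ)..1, G (s, 1 - s) = ∫ s in (0 : ℝ)..1, G (1 - s, s) := by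
      rw [← integral_comp_one_sub fun s => G (s, 1 - s)]
      simp
    have href : K.refCell = {p : ℝ × ℝ | 0 ≤ p.1 ∧ 0 ≤ p.2 ∧ p.1 + p.2 ≤ 1} := by
      simp [refCell, hK]
    have hns : K.numSides = 3 := by simp [numSides, hK]
    rw [href, (setIntegral_triangle_fderiv hG).1, (setIntegral_triangle_fderiv hG).2, hns]
    simp only [Finset.sum_range_succ, Finset.range_zero, Finset.sum_empty, e0, e1, e2, e3]
    simp [edge, vert, hK]
    ring
  · have e0 : ∫ s in (0 : ℝ)..1, g (K.vert 0 + s • K.edge 0) = ∫ s in (0 : ℝ)..1, G (s, 0) := by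
      congr 1; ext s; apply hpt
      ext <;> simp [vert, edge, map]
    have e1 : ∫ s in (0 : ℝ)..1, g (K.vert 1 + s • K.edge 1) = ∫ s in (0 : ℝ)..1, G (1, s) := by
      congr 1; ext s; apply hpt
      ext <;> simp [vert, edge, map, hK]
    have e2 : ∫ s in (0 : ℝ)..1, g (K.vert 2 + s • K.edge 2) = ∫ s in (0 : ℝ)..1, G (s, 1) := by
      rw [← integral_comp_one_sub fun s => G (s, 1)]
      congr 1; ext s; apply hpt
      ext <;> simp [vert, edge, map, hK] <;> ring
    have e3 : ∫ s in (0 : ℝ)..1, g (K.vert 3 + s • K.edge 3) = ∫ s in (0 : ℝ)..1, G (0, s) := by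
      rw [← integral_comp_one_sub fun s => G (0, s)]
      congr 1; ext s; apply hpt
      ext <;> simp [vert, edge, map, hK] <;> ring
    have href : K.refCell = Icc 0 1 ×ˢ Icc 0 1 := by simp [refCell, hK]
    have hns : K.numSides = 4 := by simp [numSides, hK]
    rw [href, (setIntegral_square_fderiv hG).1, (setIntegral_square_fderiv hG).2, hns]
    simp only [Finset.sum_range_succ, Finset.range_zero, Finset.sum_empty, e0, e1, e2, e3]
    simp [edge, vert, hK]
    ring

end Element

/-! ### Size of the elements and their local spaces -/

theorem len_nonneg (p : ℝ × ℝ) : 0 ≤ len p := Real.sqrt_nonneg _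

theorem len_neg (p : ℝ × ℝ) : len (-p) = len p := by simp [len]

theorem norm_le_len (p : ℝ × ℝ) : ‖p‖ ≤ len p := by
  rw [Prod.norm_def]; exact max_le (abs_fst_le_len p) (abs_snd_le_len p)

theorem len_le_abs_add_abs (p : ℝ × ℝ) : len p ≤ |p.1| + |p.2| := by
  rw [len, Real.sqrt_le_left (by positivity)]
  nlinarith [sq_abs p.1, sq_abs p.2, mul_nonneg (abs_nonneg p.1) (abs_nonneg p.2)]

theorem cross_le_len_mul_len (p q : ℝ × ℝ) : p.1 * q.2 - p.2 * q.1 ≤ len p * len q := by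
  rw [len, len, ← Real.sqrt_mul (by positivity)]
  apply Real.le_sqrt_of_sq_le
  nlinarith [sq_nonneg (p.1 * q.1 + p.2 * q.2)]

namespace Element

theorem len_vert_sub_le_diam (K : Element) {i j : ℕ} (hi : i < K.numSides) (hj : j < K.numSides) :
    len (K.vert i - K.vert j) ≤ K.diam :=
  le_ciSup_of_le (Set.finite_range _).bddAbove (⟨i, hi⟩ : Fin K.numSides)
    (le_ciSup (f := fun j : Fin K.numSides => len (K.vert i - K.vert j))
      (Set.finite_range _).bddAbove ⟨j, hj⟩)

theorem vert_numSides (K : Element) : K.vert K.numSides = K.vert 0 := by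
  rcases hK : K.isRect <;> simp [numSides, vert, hK]

theorem three_le_numSides (K : Element) : 3 ≤ K.numSides := by
  unfold numSides; split_ifs <;> norm_num

theorem len_edge_le_diam (K : Element) {l : ℕ} (hl : l < K.numSides) : len (K.edge l) ≤ K.diam := by
  rcases Nat.lt_or_ge (l + 1) K.numSides with h | h
  · exact K.len_vert_sub_le_diam h hl
  · have h1 : l + 1 = K.numSides := by omega
    rw [edge, h1, vert_numSides]
    exact K.len_vert_sub_le_diam (by omega) hl

theorem len_v_le_diam (K : Element) : len K.v ≤ K.diam := by
  have := K.len_edge_le_diam (l := 0) (by have := K.three_le_numSides; omega)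
  simpa [edge, vert] using this

theorem len_w_le_diam (K : Element) : len K.w ≤ K.diam := by
  have h := K.len_edge_le_diam (l := K.numSides - 1) (by have := K.three_le_numSides; omega)
  rw [← len_neg]
  rcases hK : K.isRect
  · simpa [edge, vert, numSides, hK] using h
  · simpa [edge, vert, numSides, hK] using h

theorem jac_le_sq_diam (K : Element) : K.jac ≤ K.diam ^ 2 := by
  have := cross_le_len_mul_len K.v K.w
  have h0 := len_nonneg K.v
  have h1 := len_nonneg K.w
  nlinarith [K.len_v_le_diam, K.len_w_le_diam, show K.jac = K.v.1 * K.w.2 - K.v.2 * K.w.1 from rfl]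

theorem diam_pos (K : Element) : 0 < K.diam := by
  have h := K.jac_le_sq_diam
  have h0 : 0 ≤ K.diam := (len_nonneg _).trans K.len_v_le_diam
  have := K.jac_pos
  rcases h0.eq_or_lt with h1 | h1
  · rw [← h1] at h; norm_num at h; linarith
  · exact h1

theorem jac_le_len_edge_mul_diam (K : Element) {l : ℕ} (hl : l < K.numSides) :
    K.jac ≤ len (K.edge l) * K.diam := by
  have hv := K.len_v_le_diam
  have hw := K.len_w_le_diam
  have hw' : len (-K.w) ≤ K.diam := by rwa [len_neg]
  have hv' : len (-K.v) ≤ K.diam := by rwa [len_neg]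
  have key : ∀ p q : ℝ × ℝ, K.jac = p.1 * q.2 - p.2 * q.1 → len q ≤ K.diam →
      K.jac ≤ len p * K.diam := fun p q h h1 => by
    rw [h]
    exact (cross_le_len_mul_len p q).trans (mul_le_mul_of_nonneg_left h1 (len_nonneg _))
  rcases hK : K.isRect
  · have : l < 3 := by simpa [numSides, hK] using hl
    interval_cases l
    · exact key _ K.w (by simp [edge, vert, jac]) hw
    · exact key _ (-K.v) (by simp [edge, vert, jac, hK]; ring) hv'
    · exact key _ K.v (by simp [edge, vert, jac, hK]; ring) hv
  · have : l < 4 := by simpa [numSides, hK] using hl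
    interval_cases l
    · exact key _ K.w (by simp [edge, vert, jac]) hw
    · exact key _ (-K.v) (by simp [edge, vert, jac, hK]; ring) hv'
    · exact key _ (-K.w) (by simp [edge, vert, jac, hK]) hw'
    · exact key _ K.v (by simp [edge, vert, jac, hK]; ring) hv

theorem len_edge_pos (K : Element) {l : ℕ} (hl : l < K.numSides) : 0 < len (K.edge l) := by
  have := K.jac_le_len_edge_mul_diam hl
  by_contra h
  have h0 : len (K.edge l) = 0 := le_antisymm (not_lt.1 h) (len_nonneg _)
  rw [h0, zero_mul] at this
  linarith [K.jac_pos]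

theorem norm_sub_le_diam (K : Element) {x c : ℝ × ℝ} (hx : x ∈ K.carrier) (hc : c ∈ K.carrier) :
    ‖x - c‖ ≤ 2 * K.diam := by
  obtain ⟨p, hp, rfl⟩ := hx
  obtain ⟨q, hq, rfl⟩ := hc
  have hp' := K.refCell_subset hp
  have hq' := K.refCell_subset hq
  have : K.map p - K.map q = (p.1 - q.1) • K.v + (p.2 - q.2) • K.w := by
    simp only [map]; module
  rw [this]
  refine (norm_add_le _ _).trans ?_
  rw [norm_smul, norm_smul, two_mul]
  have e1 : ‖p.1 - q.1‖ ≤ 1 := by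
    rw [Real.norm_eq_abs, abs_le]; constructor <;> linarith [hp'.1.1, hp'.1.2, hq'.1.1, hq'.1.2]
  have e2 : ‖p.2 - q.2‖ ≤ 1 := by
    rw [Real.norm_eq_abs, abs_le]; constructor <;> linarith [hp'.2.1, hp'.2.2, hq'.2.1, hq'.2.2]
  refine add_le_add ?_ ?_
  · exact (mul_le_of_le_one_left (norm_nonneg _) e1).trans ((norm_le_len _).trans K.len_v_le_diam)
  · exact (mul_le_of_le_one_left (norm_nonneg _) e2).trans ((norm_le_len _).trans K.len_w_le_diam)

/-- The area of a shape-regular element is comparable to the square of its diameter: an inscribed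
disc of radius `r` contains a square with sides of length `r`. -/
theorem sq_diam_le_of_disc (K : Element) {σ r : ℝ} {c : ℝ × ℝ} (hr : 0 < r)
    (hd : K.diam ≤ σ * r) (hsub : {x : ℝ × ℝ | len (x - c) ≤ r} ⊆ K.carrier) :
    K.diam ^ 2 ≤ σ ^ 2 * K.jac := by
  have hbox : Icc (c.1 - r / 2) (c.1 + r / 2) ×ˢ Icc (c.2 - r / 2) (c.2 + r / 2) ⊆ K.carrier := by
    rintro x ⟨⟨h1, h2⟩, ⟨h3, h4⟩⟩
    apply hsub
    refine (len_le_abs_add_abs _).trans ?_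
    have e1 : |(x - c).1| ≤ r / 2 := by rw [Prod.fst_sub, abs_le]; constructor <;> linarith
    have e2 : |(x - c).2| ≤ r / 2 := by rw [Prod.snd_sub, abs_le]; constructor <;> linarith
    linarith
  have hvol := measureReal_mono (μ := volume) hbox K.isCompact_carrier.measure_ne_top
  rw [Measure.volume_eq_prod, measureReal_prod_prod, ← Measure.volume_eq_prod] at hvol
  rw [Real.volume_real_Icc_of_le (by linarith), Real.volume_real_Icc_of_le (by linarith)] at hvol
  have h1 : r ^ 2 ≤ K.jac := by nlinarith [K.volume_carrier_le]
  calc K.diam ^ 2 ≤ (σ * r) ^ 2 := pow_le_pow_left₀ K.diam_pos.le hd 2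
    _ = σ ^ 2 * r ^ 2 := by ring
    _ ≤ _ := by gcongr

/-- The images in `K` of the nodes of the reference square. For a triangle some of them are not
needed for unisolvence. -/
def nodePt (K : Element) (k : ℕ) (a : Fin (k + 1) × Fin (k + 1)) : ℝ × ℝ := K.map (refNode k a)

/-- The nodal basis of `Q^k`, in the coordinates along the sides of `K`. -/
def nodalBasis (K : Element) (k : ℕ) (a : Fin (k + 1) × Fin (k + 1)) (x : ℝ × ℝ) : ℝ :=
  refBasis k a (K.inv x)

theorem contDiff_nodalBasis (K : Element) (k : ℕ) (a) {n : WithTop ℕ∞} :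
    ContDiff ℝ n (K.nodalBasis k a) := (contDiff_refBasis k a).comp K.contDiff_inv

theorem comp_map_mem_polyQ {K : Element} {k : ℕ} {f : ℝ × ℝ → ℝ} (hf : f ∈ K.localSpace k) :
    (fun p => f (K.map p)) ∈ polyQ k := by
  unfold localSpace at hf
  rw [Submodule.mem_comap] at hf
  split_ifs at hf
  · exact hf
  · exact polyP_le_polyQ k hf

theorem eq_sum_nodalBasis {K : Element} {k : ℕ} {f : ℝ × ℝ → ℝ} (hf : f ∈ K.localSpace k)
    (x : ℝ × ℝ) : f x = ∑ a, f (K.nodePt k a) * K.nodalBasis k a x := by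
  have := eq_sum_refBasis (comp_map_mem_polyQ hf) (K.inv x)
  rwa [map_inv] at this

theorem contDiff_of_mem_localSpace {K : Element} {k : ℕ} {f : ℝ × ℝ → ℝ} (hf : f ∈ K.localSpace k)
    {n : WithTop ℕ∞} : ContDiff ℝ n f := by
  rw [show f = _ from funext (eq_sum_nodalBasis hf)]
  exact ContDiff.sum fun a _ => contDiff_const.mul (K.contDiff_nodalBasis k a)

theorem continuous_of_mem_localSpace {K : Element} {k : ℕ} {f : ℝ × ℝ → ℝ}
    (hf : f ∈ K.localSpace k) : Continuous f := (contDiff_of_mem_localSpace hf (n := 0)).continuous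

theorem monomial_mem_localSpace (K : Element) {k i j : ℕ} (hij : i + j ≤ k) (c : ℝ × ℝ) :
    (fun x : ℝ × ℝ => (x.1 - c.1) ^ i * (x.2 - c.2) ^ j) ∈ K.localSpace k := by
  have h : (fun p => (fun x : ℝ × ℝ => (x.1 - c.1) ^ i * (x.2 - c.2) ^ j) (K.map p)) ∈ polyP k := by
    refine polyP_mono hij (mul_mem_polyP (pow_mem_polyP ?_ i) (pow_mem_polyP ?_ j))
    · convert affine_mem_polyP (K.a.1 - c.1) K.v.1 K.w.1 using 1
      ext p; simp [map]; ring
    · convert affine_mem_polyP (K.a.2 - c.2) K.v.2 K.w.2 using 1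
      ext p; simp [map]; ring
  unfold localSpace
  rw [Submodule.mem_comap]
  split_ifs
  · exact polyP_le_polyQ k h
  · exact h

end Element

/-- Inverse inequality on the elements. -/
theorem exists_sq_le_integral_localSpace (k : ℕ) : ∃ C : ℝ, 0 ≤ C ∧ ∀ (K : Element),
    ∀ f ∈ K.localSpace k, ∀ x ∈ K.carrier, f x ^ 2 * K.jac ≤ C * ∫ y in K.carrier, f y ^ 2 := by
  obtain ⟨C, hC, h⟩ := exists_sq_le_integral_polyQ k
  refine ⟨C, hC, fun K f hf x hx => ?_⟩
  have h1 := h _ (Element.comp_map_mem_polyQ hf) (K.inv x)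
    (K.refCell_subset (by rwa [Element.carrier_eq_preimage] at hx))
  simp only [Element.map_inv] at h1
  rw [K.setIntegral_carrier]
  have h2 : ∫ p in Icc (0 : ℝ) (1 / 2) ×ˢ Icc (0 : ℝ) (1 / 2), f (K.map p) ^ 2
      ≤ ∫ p in K.refCell, f (K.map p) ^ 2 := by
    refine setIntegral_mono_set ?_ (Filter.Eventually.of_forall fun _ => sq_nonneg _)
      K.subset_refCell.eventuallyLE
    exact (((Element.continuous_of_mem_localSpace hf).comp K.continuous_map).pow
      2).continuousOn.integrableOn_compact K.isCompact_refCell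
  have hj := K.jac_pos
  calc f x ^ 2 * K.jac ≤ (C * ∫ p in K.refCell, f (K.map p) ^ 2) * K.jac := by
        gcongr; exact h1.trans (by gcongr)
    _ = _ := by ring

/-! ### Sides of a mesh, integration by parts and conservation of energy -/

namespace Side

variable {N : ℕ} {elem : Fin N → Element}

/-- The point of a side with parameter `s`. -/
def pt (e : Side elem) (s : ℝ) : ℝ × ℝ := e.start + s • (e.finish - e.start)

theorem pt_mem_carrier (e : Side elem) {s : ℝ} (hs : s ∈ Icc (0 : ℝ) 1) :
    e.pt s ∈ (elem e.1).carrier := (elem e.1).edge_mem_carrier e.2 hs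

theorem continuous_pt (e : Side elem) : Continuous e.pt := by unfold pt; fun_prop

theorem len_pos (e : Side elem) : 0 < len (e.finish - e.start) := (elem e.1).len_edge_pos e.2.2

theorem len_normal (e : Side elem) : len e.normal = 1 := by
  have h := e.len_pos
  have : len e.normal ^ 2 = 1 := by
    have h2 : len (e.finish - e.start) ^ 2 = (e.finish - e.start).1 ^ 2
        + (e.finish - e.start).2 ^ 2 := Real.sq_sqrt (by positivity)
    rw [len, Real.sq_sqrt (by positivity)]
    simp only [normal, Prod.smul_fst, Prod.smul_snd, smul_eq_mul]
    rw [mul_pow, mul_pow, ← mul_add, neg_sq, add_comm ((e.finish - e.start).2 ^ 2), ← h2, inv_pow,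
      inv_mul_cancel₀ (by positivity)]
  exact (pow_eq_one_iff_of_nonneg (len_nonneg _) two_ne_zero).1 this

theorem integral_eq (e : Side elem) (f : ℝ × ℝ → ℝ) :
    e.integral f = len (e.finish - e.start) * ∫ s in (0 : ℝ)..1, f (e.pt s) := rfl

theorem integral_add (e : Side elem) {f g : ℝ × ℝ → ℝ} (hf : Continuous f) (hg : Continuous g) :
    e.integral (fun x => f x + g x) = e.integral f + e.integral g := by
  have := e.continuous_pt
  rw [integral_eq, intervalIntegral.integral_add
    ((by fun_prop : Continuous _).intervalIntegrable _ _)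
    ((by fun_prop : Continuous _).intervalIntegrable _ _), mul_add]
  rfl

theorem integral_const_mul (e : Side elem) (c : ℝ) (f : ℝ × ℝ → ℝ) :
    e.integral (fun x => c * f x) = c * e.integral f := by
  rw [integral_eq, integral_eq, intervalIntegral.integral_const_mul]; ring

theorem integral_sub (e : Side elem) {f g : ℝ × ℝ → ℝ} (hf : Continuous f) (hg : Continuous g) :
    e.integral (fun x => f x - g x) = e.integral f - e.integral g := by
  have := e.continuous_pt
  rw [integral_eq, intervalIntegral.integral_sub
    ((by fun_prop : Continuous _).intervalIntegrable _ _)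
    ((by fun_prop : Continuous _).intervalIntegrable _ _), mul_sub]
  rfl

theorem abs_integral_le (e : Side elem) {f : ℝ × ℝ → ℝ} {b : ℝ}
    (hf : ∀ s ∈ Icc (0 : ℝ) 1, |f (e.pt s)| ≤ b) :
    |e.integral f| ≤ len (e.finish - e.start) * b := by
  rw [integral_eq, abs_mul, abs_of_pos e.len_pos]
  have := intervalIntegral.norm_integral_le_of_norm_le_const (a := (0 : ℝ)) (b := 1)
    (f := fun s => f (e.pt s)) (C := b) fun s hs => by
      rw [uIoc_of_le zero_le_one] at hs
      exact hf s ⟨hs.1.le, hs.2⟩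
  refine mul_le_mul_of_nonneg_left ?_ e.len_pos.le
  simpa using this

end Side

/-- The divergence theorem, with unit normals and arc length. -/
theorem setIntegral_fderiv_eq_sum_side {N : ℕ} {elem : Fin N → Element} (i : Fin N)
    {g : ℝ × ℝ → ℝ} (hg : ContDiff ℝ 1 g) (d : ℝ × ℝ) :
    ∫ x in (elem i).carrier, fderiv ℝ g x d = ∑ l : Fin (elem i).numSides,
      (d.1 * (Side.normal (elem := elem) ⟨i, l⟩).1 + d.2 * (Side.normal (elem := elem) ⟨i, l⟩).2)
        * Side.integral (elem := elem) ⟨i, l⟩ g := by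
  rw [Element.setIntegral_fderiv _ hg]
  refine Finset.sum_congr rfl fun l _ => ?_
  have h := (Side.len_pos (elem := elem) ⟨i, l⟩).ne'
  simp only [Side.normal, Side.integral, Prod.smul_fst, Prod.smul_snd, smul_eq_mul]
  have e1 : (Side.finish (elem := elem) ⟨i, l⟩ - Side.start (elem := elem) ⟨i, l⟩)
      = (elem i).edge l := rfl
  have e2 : Side.start (elem := elem) ⟨i, l⟩ = (elem i).vert l := rfl
  rw [e1] at h
  rw [e1, e2]
  field_simp
  ring

section Bilinear

variable {m : ℕ}

theorem continuous_mulVec_dotProduct (B : Matrix (Fin m) (Fin m) ℝ) {f g : ℝ × ℝ → Fin m → ℝ}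
    (hf : Continuous f) (hg : Continuous g) : Continuous fun x => (B *ᵥ f x) ⬝ᵥ g x :=
  (continuous_const.matrix_mulVec hf).dotProduct hg

theorem hasFDerivAt_mulVec_dotProduct (B : Matrix (Fin m) (Fin m) ℝ) {f g : ℝ × ℝ → Fin m → ℝ}
    (hf : ContDiff ℝ 1 f) (hg : ContDiff ℝ 1 g) (x d : ℝ × ℝ) :
    fderiv ℝ (fun x => (B *ᵥ f x) ⬝ᵥ g x) x d
      = (B *ᵥ fderiv ℝ f x d) ⬝ᵥ g x + (B *ᵥ f x) ⬝ᵥ fderiv ℝ g x d := by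
  have hf' := fun b => hasFDerivAt_pi'.1 (hf.differentiable one_ne_zero x).hasFDerivAt b
  have hg' := fun b => hasFDerivAt_pi'.1 (hg.differentiable one_ne_zero x).hasFDerivAt b
  have h := HasFDerivAt.fun_sum (u := Finset.univ) fun a _ =>
    (HasFDerivAt.fun_sum (u := Finset.univ) fun b _ => (hf' b).const_mul (B a b)).fun_mul (hg' a)
  have h2 : (fun x => (B *ᵥ f x) ⬝ᵥ g x) = fun y => ∑ a, (∑ b, B a b * f y b) * g y a := by
    ext y; simp [Matrix.mulVec, dotProduct]
  rw [h2, h.fderiv]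
  simp [Matrix.mulVec, dotProduct, Finset.sum_add_distrib, Finset.sum_mul, mul_comm, add_comm]

/-- Integration by parts on an element. -/
theorem setIntegral_mulVec_fderiv {N : ℕ} {elem : Fin N → Element} (i : Fin N)
    (B : Matrix (Fin m) (Fin m) ℝ) {f g : ℝ × ℝ → Fin m → ℝ} (hf : ContDiff ℝ 1 f)
    (hg : ContDiff ℝ 1 g) (d : ℝ × ℝ) :
    ∫ x in (elem i).carrier, (B *ᵥ f x) ⬝ᵥ fderiv ℝ g x d
      = (∑ l : Fin (elem i).numSides,
        (d.1 * (Side.normal (elem := elem) ⟨i, l⟩).1 + d.2 * (Side.normal (elem := elem) ⟨i, l⟩).2)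
          * Side.integral (elem := elem) ⟨i, l⟩ (fun x => (B *ᵥ f x) ⬝ᵥ g x))
        - ∫ x in (elem i).carrier, (B *ᵥ fderiv ℝ f x d) ⬝ᵥ g x := by
  have hq : ContDiff ℝ 1 fun x => (B *ᵥ f x) ⬝ᵥ g x := by
    have hf' := contDiff_pi.1 hf
    have hg' := contDiff_pi.1 hg
    simp only [Matrix.mulVec, dotProduct]
    exact ContDiff.sum fun a _ => (ContDiff.sum fun b _ => contDiff_const.mul (hf' b)).mul (hg' a)
  have hf1 : Continuous fun x => fderiv ℝ f x d :=
    (hf.continuous_fderiv one_ne_zero).clm_apply continuous_const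
  have hg1 : Continuous fun x => fderiv ℝ g x d :=
    (hg.continuous_fderiv one_ne_zero).clm_apply continuous_const
  rw [← setIntegral_fderiv_eq_sum_side i hq d, eq_sub_iff_add_eq, ← integral_add]
  · exact integral_congr_ae (Filter.Eventually.of_forall fun x => by
      simp only [hasFDerivAt_mulVec_dotProduct B hf hg, add_comm])
  · exact (elem i).integrableOn_carrier
      (continuous_mulVec_dotProduct B hf.continuous hg1).continuousOn
  · exact (elem i).integrableOn_carrier
      (continuous_mulVec_dotProduct B hf1 hg.continuous).continuousOn

end Bilinear

section Conservation

variable {m : ℕ} {L₁ L₂ : ℝ} {B₁ B₂ : Matrix (Fin m) (Fin m) ℝ}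
  {S : ℝ × ℝ → Matrix (Fin m) (Fin m) ℝ} {lam : ℝ × ℝ → Fin m → ℝ} (M : PeriodicMesh L₁ L₂)

namespace PeriodicMesh

theorem start_sub_shift (e : Side M.elem) : e.start - M.shift e = (M.nbr e).finish :=
  sub_eq_of_eq_add (M.start_eq e)

theorem finish_sub_shift (e : Side M.elem) : e.finish - M.shift e = (M.nbr e).start :=
  sub_eq_of_eq_add (M.finish_eq e)

theorem shift_nbr (e : Side M.elem) : M.shift (M.nbr e) = -M.shift e := by
  have h1 := M.start_sub_shift (M.nbr e)
  rw [M.nbr_nbr, ← M.finish_sub_shift e] at h1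
  rw [sub_sub, sub_eq_self] at h1
  exact (neg_eq_of_add_eq_zero_right h1).symm

theorem finish_sub_start_nbr (e : Side M.elem) :
    (M.nbr e).finish - (M.nbr e).start = -(e.finish - e.start) := by
  rw [← M.start_sub_shift, ← M.finish_sub_shift]; abel

theorem normal_nbr (e : Side M.elem) : (M.nbr e).normal = -e.normal := by
  simp only [Side.normal, finish_sub_start_nbr, len_neg]
  ext <;> simp <;> ring

theorem pt_sub_shift (e : Side M.elem) (s : ℝ) : e.pt s - M.shift e = (M.nbr e).pt (1 - s) := by
  rw [Side.pt, Side.pt, finish_sub_start_nbr, ← M.finish_sub_shift]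
  module

theorem pt_sub_shift_mem (e : Side M.elem) {s : ℝ} (hs : s ∈ Icc (0 : ℝ) 1) :
    e.pt s - M.shift e ∈ (M.elem (M.nbr e).1).carrier := by
  rw [pt_sub_shift]
  exact Side.pt_mem_carrier _ ⟨by linarith [hs.2], by linarith [hs.1]⟩

theorem integral_nbr (e : Side M.elem) (f : ℝ × ℝ → ℝ) :
    (M.nbr e).integral f = e.integral fun x => f (x - M.shift e) := by
  rw [Side.integral_eq, Side.integral_eq, finish_sub_start_nbr, len_neg]
  simp only [pt_sub_shift]
  rw [Element.integral_comp_one_sub fun s => f ((M.nbr e).pt s)]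

end PeriodicMesh

theorem isMinusNormal_neg {n : ℝ × ℝ} (hn : len n = 1) :
    IsMinusNormal (-n) ↔ ¬ IsMinusNormal n := by
  have h0 : ¬ (n.1 = 0 ∧ n.2 = 0) := fun h => by simp [len, h.1, h.2] at hn
  simp only [IsMinusNormal, Prod.fst_neg, Prod.snd_neg, not_or, not_and, not_lt]
  constructor
  · rintro (h | ⟨h1, h2⟩)
    · exact ⟨by linarith, fun h' => by linarith⟩
    · exact ⟨by linarith, fun _ => by linarith⟩
  · rintro ⟨h1, h2⟩
    rcases h1.lt_or_eq with h | h
    · left; linarith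
    · right
      refine ⟨by linarith, ?_⟩
      rcases (h2 h).lt_or_eq with h3 | h3
      · linarith
      · exact absurd ⟨h3, by linarith⟩ h0

theorem normalMatrix_neg (n : ℝ × ℝ) : normalMatrix B₁ B₂ (-n) = -normalMatrix B₁ B₂ n := by
  simp only [normalMatrix, Prod.fst_neg, Prod.snd_neg]; module

/-- The numerical flux with the roles of the two traces separated. -/
theorem numFlux_eq (n : ℝ × ℝ) (um up : Fin m → ℝ) :
    numFlux B₁ B₂ S lam n um up
      = ((1 / 2 : ℝ) • normalMatrix B₁ B₂ n + stabMatrix S lam n) *ᵥ up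
        + ((1 / 2 : ℝ) • normalMatrix B₁ B₂ n - stabMatrix S lam n) *ᵥ um := by
  simp only [numFlux, Matrix.add_mulVec, Matrix.sub_mulVec, Matrix.mulVec_smul, Matrix.mulVec_add,
    Matrix.mulVec_sub, Matrix.smul_mulVec]
  module

theorem outFlux_nbr (U : M.Broken m) (e : Side M.elem) (x : ℝ × ℝ) :
    outFlux M B₁ B₂ S lam U (M.nbr e) (x - M.shift e) = -outFlux M B₁ B₂ S lam U e x := by
  simp only [outFlux, M.normal_nbr, M.nbr_nbr, M.shift_nbr, sub_neg_eq_add, sub_add_cancel, neg_neg]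
  by_cases h : IsMinusNormal e.normal
  · have h' : ¬ IsMinusNormal (-e.normal) := fun h' => (isMinusNormal_neg e.len_normal).1 h' h
    have h2 : ¬ IsMinusNormal (M.nbr e).normal := by rwa [M.normal_nbr]
    rw [if_neg h2, if_pos h]
  · have h' := (isMinusNormal_neg e.len_normal).2 h
    have h2 : IsMinusNormal (M.nbr e).normal := by rwa [M.normal_nbr]
    rw [if_pos h2, if_neg h, neg_neg]

theorem outFlux_sub (U V : M.Broken m) (e : Side M.elem) (x : ℝ × ℝ) :
    outFlux M B₁ B₂ S lam (fun i x => U i x - V i x) e x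
      = outFlux M B₁ B₂ S lam U e x - outFlux M B₁ B₂ S lam V e x := by
  simp only [outFlux, numFlux_eq, Matrix.mulVec_sub]
  split_ifs <;> module

theorem continuous_outFlux {U : M.Broken m} (hU : ∀ i, Continuous (U i)) (e : Side M.elem) :
    Continuous (outFlux M B₁ B₂ S lam U e) := by
  have h1 := hU e.1
  have h2 : Continuous fun x => U (M.nbr e).1 (x - M.shift e) :=
    (hU (M.nbr e).1).comp (continuous_id.sub continuous_const)
  unfold outFlux
  split_ifs
  · simp only [numFlux_eq]
    exact (continuous_const.matrix_mulVec h2).add (continuous_const.matrix_mulVec h1)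
  · simp only [numFlux_eq]
    exact ((continuous_const.matrix_mulVec h1).add (continuous_const.matrix_mulVec h2)).neg

theorem mulVec_dotProduct_comm {B : Matrix (Fin m) (Fin m) ℝ} (hB : Bᵀ = B) (x y : Fin m → ℝ) :
    (B *ᵥ x) ⬝ᵥ y = (B *ᵥ y) ⬝ᵥ x := by
  rw [dotProduct_comm, Matrix.dotProduct_mulVec, ← Matrix.mulVec_transpose, hB]

theorem mulVec_dotProduct_self {B : Matrix (Fin m) (Fin m) ℝ} (hB : Bᵀ = -B) (x : Fin m → ℝ) :
    (B *ᵥ x) ⬝ᵥ x = 0 := by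
  have h : (B *ᵥ x) ⬝ᵥ x = -((B *ᵥ x) ⬝ᵥ x) := by
    nth_rewrite 1 [dotProduct_comm]
    rw [Matrix.dotProduct_mulVec, ← Matrix.mulVec_transpose, hB, Matrix.neg_mulVec, neg_dotProduct]
  linarith

/-- The energies that leave the two elements at an edge cancel. -/
theorem outFlux_energy (h₁ : B₁.IsSymm) (h₂ : B₂.IsSymm) (U : M.Broken m) (e : Side M.elem)
    (x : ℝ × ℝ) :
    outFlux M B₁ B₂ S lam U e x ⬝ᵥ (U e.1 x - U (M.nbr e).1 (x - M.shift e))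
      = (1 / 2) * ((normalMatrix B₁ B₂ e.normal *ᵥ U e.1 x) ⬝ᵥ U e.1 x)
        - (1 / 2) * ((normalMatrix B₁ B₂ e.normal *ᵥ U (M.nbr e).1 (x - M.shift e))
          ⬝ᵥ U (M.nbr e).1 (x - M.shift e)) := by
  set a := U e.1 x
  set b := U (M.nbr e).1 (x - M.shift e)
  have key : ∀ (n : ℝ × ℝ) (um up : Fin m → ℝ), numFlux B₁ B₂ S lam n um up ⬝ᵥ (um - up)
      = (1 / 2) * ((normalMatrix B₁ B₂ n *ᵥ um) ⬝ᵥ um)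
        - (1 / 2) * ((normalMatrix B₁ B₂ n *ᵥ up) ⬝ᵥ up) := by
    intro n um up
    have e1 := mulVec_dotProduct_self (stabMatrix_transpose (S := S) (lam := lam) (n := n))
        (up - um)
    have e2 := mulVec_dotProduct_comm (normalMatrix_transpose (n := n) h₁ h₂) um up
    rw [numFlux, add_dotProduct, ← neg_sub up um, dotProduct_neg (_ *ᵥ (up - um)), e1,
      Matrix.mulVec_smul, Matrix.mulVec_add, smul_dotProduct, add_dotProduct, dotProduct_neg,
      dotProduct_neg, dotProduct_sub, dotProduct_sub, e2, smul_eq_mul]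
    ring
  unfold outFlux
  split_ifs with h
  · exact key _ _ _
  · rw [neg_dotProduct, ← dotProduct_neg, neg_sub, key, normalMatrix_neg]
    simp only [Matrix.neg_mulVec, neg_dotProduct]
    ring

/-- The part of `schemeForm` without the time derivative. -/
def convForm (B₁ B₂ : Matrix (Fin m) (Fin m) ℝ) (S : ℝ × ℝ → Matrix (Fin m) (Fin m) ℝ)
    (lam : ℝ × ℝ → Fin m → ℝ) (U : M.Broken m) (i : Fin M.N) (v : ℝ × ℝ → Fin m → ℝ) : ℝ :=
  (∑ l : Fin (M.elem i).numSides,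
        Side.integral (elem := M.elem) ⟨i, l⟩
          (fun x => outFlux M B₁ B₂ S lam U ⟨i, l⟩ x ⬝ᵥ v x))
    - (∫ x in (M.elem i).carrier, (B₁ *ᵥ U i x) ⬝ᵥ fderiv ℝ v x (1, 0))
    - (∫ x in (M.elem i).carrier, (B₂ *ᵥ U i x) ⬝ᵥ fderiv ℝ v x (0, 1))

theorem schemeForm_eq (B₀ : ℝ × ℝ → Fin m → ℝ) (U W : M.Broken m) (i : Fin M.N)
    (v : ℝ × ℝ → Fin m → ℝ) :
    schemeForm M B₀ B₁ B₂ S lam U W i v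
      = (∫ x in (M.elem i).carrier, (B₀ x * W i x) ⬝ᵥ v x) + convForm M B₁ B₂ S lam U i v := by
  rw [schemeForm, convForm]; ring

/-- The DG discretization of the spatial operator is skew-symmetric: it conserves energy. -/
theorem sum_convForm_self (h₁ : B₁.IsSymm) (h₂ : B₂.IsSymm) {U : M.Broken m}
    (hU : ∀ i, ContDiff ℝ 1 (U i)) : ∑ i, convForm M B₁ B₂ S lam U i (U i) = 0 := by
  set q : Side M.elem → ℝ × ℝ → ℝ := fun e x => outFlux M B₁ B₂ S lam U e x ⬝ᵥ U e.1 x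
    - (1 / 2) * ((normalMatrix B₁ B₂ e.normal *ᵥ U e.1 x) ⬝ᵥ U e.1 x) with hq
  have hfc : ∀ e : Side M.elem, Continuous fun x => outFlux M B₁ B₂ S lam U e x ⬝ᵥ U e.1 x :=
    fun e => (continuous_outFlux M (fun i => (hU i).continuous) e).dotProduct (hU e.1).continuous
  -- for a symmetric matrix the integral over the element is half of a boundary term
  have hloc : ∀ i, convForm M B₁ B₂ S lam U i (U i)
      = ∑ l : Fin (M.elem i).numSides, Side.integral (elem := M.elem) ⟨i, l⟩ (q ⟨i, l⟩) := by
    intro i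
    have hint : ∀ {B : Matrix (Fin m) (Fin m) ℝ} (d : ℝ × ℝ), B.IsSymm →
        ∫ x in (M.elem i).carrier, (B *ᵥ U i x) ⬝ᵥ fderiv ℝ (U i) x d
        = (1 / 2) * ∑ l : Fin (M.elem i).numSides,
          (d.1 * (Side.normal (elem := M.elem) ⟨i, l⟩).1
            + d.2 * (Side.normal (elem := M.elem) ⟨i, l⟩).2)
          * Side.integral (elem := M.elem) ⟨i, l⟩ (fun x => (B *ᵥ U i x) ⬝ᵥ U i x) := by
      intro B d hB
      have h := setIntegral_mulVec_fderiv (elem := M.elem) i B (hU i) (hU i) d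
      have h' : ∀ x, (B *ᵥ fderiv ℝ (U i) x d) ⬝ᵥ U i x = (B *ᵥ U i x) ⬝ᵥ fderiv ℝ (U i) x d :=
        fun x => mulVec_dotProduct_comm hB.eq _ _
      simp only [h'] at h
      linarith
    rw [convForm, hint _ h₁, hint _ h₂, Finset.mul_sum, Finset.mul_sum, ← Finset.sum_sub_distrib,
      ← Finset.sum_sub_distrib]
    refine Finset.sum_congr rfl fun l _ => ?_
    have hB : ∀ (c : ℝ) (B : Matrix (Fin m) (Fin m) ℝ),
        Continuous fun x => c * ((B *ᵥ U i x) ⬝ᵥ U i x) := fun c B =>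
      continuous_const.mul (continuous_mulVec_dotProduct B (hU i).continuous (hU i).continuous)
    have e1 : (fun x => (1 / 2) *
        ((normalMatrix B₁ B₂ (Side.normal (elem := M.elem) ⟨i, l⟩) *ᵥ U i x)
        ⬝ᵥ U i x)) = fun x => (1 / 2) * (Side.normal (elem := M.elem) ⟨i, l⟩).1
          * ((B₁ *ᵥ U i x) ⬝ᵥ U i x) + (1 / 2) * (Side.normal (elem := M.elem) ⟨i, l⟩).2
          * ((B₂ *ᵥ U i x) ⬝ᵥ U i x) := by
      ext x
      simp only [normalMatrix, Matrix.add_mulVec, Matrix.smul_mulVec, add_dotProduct,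
        smul_dotProduct, smul_eq_mul]
      ring
    have e2 : Side.integral (elem := M.elem) ⟨i, l⟩ (q ⟨i, l⟩) = _ :=
      Side.integral_sub _ (hfc ⟨i, l⟩) (hB _ _)
    rw [e2, e1, Side.integral_add _ (hB _ _) (hB _ _),
      Side.integral_const_mul, Side.integral_const_mul]
    ring
  have hsum : ∑ i, convForm M B₁ B₂ S lam U i (U i) = ∑ e : Side M.elem, e.integral (q e) := by
    rw [Finset.sum_congr rfl fun i _ => hloc i, Fintype.sum_sigma]
  -- the contributions of the two sides of an edge cancel
  have hanti : ∀ e : Side M.elem, (M.nbr e).integral (q (M.nbr e)) = -e.integral (q e) := by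
    intro e
    rw [M.integral_nbr, ← neg_one_mul, ← Side.integral_const_mul]
    congr 1
    ext x
    have h := outFlux_energy (S := S) (lam := lam) M h₁ h₂ U e x
    simp only [hq]
    rw [outFlux_nbr, M.normal_nbr, normalMatrix_neg, neg_dotProduct, Matrix.neg_mulVec,
      neg_dotProduct]
    rw [dotProduct_sub] at h
    linarith
  have hinv : Function.Involutive M.nbr := M.nbr_nbr
  have h := Equiv.sum_comp hinv.toPerm fun e : Side M.elem => e.integral (q e)
  simp only [Function.Involutive.coe_toPerm, hanti, Finset.sum_neg_distrib] at h
  rw [hsum]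
  linarith

end Conservation

/-! ### Taylor polynomials in space of functions of space and time -/

section Taylor

open Filter Topology

/-- Continuous differentiability up to the boundary of a compact set `A`, which may be very
irregular, bounds the derivatives on all open subsets of `A` by the same constant: there the local
Taylor series of the definition are unique. -/
theorem exists_iteratedFDeriv_bound {E F : Type*} [NormedAddCommGroup E] [NormedSpace ℝ E]
    [NormedAddCommGroup F] [NormedSpace ℝ F] {A : Set E} (hA : IsCompact A) {s : ℕ} {f : E → F}
    (hf : ContDiffOn ℝ s f A) :
    ∃ C : ℝ, ∀ O : Set E, IsOpen O → O ⊆ A → ∀ y ∈ O, ∀ j ≤ s, ‖iteratedFDeriv ℝ j f y‖ ≤ C := by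
  have hloc : ∀ x ∈ A, ∃ t ∈ 𝓝[A] x, ∃ C : ℝ, ∀ O : Set E, IsOpen O → O ⊆ A → ∀ y ∈ O, y ∈ t →
      ∀ j ≤ s, ‖iteratedFDeriv ℝ j f y‖ ≤ C := by
    intro x hx
    obtain ⟨t, ht, p, hp⟩ := hf x hx s le_rfl
    rw [insert_eq_of_mem hx] at ht
    have hxt : x ∈ t := mem_of_mem_nhdsWithin hx ht
    obtain ⟨V, hV, hxV, hVt⟩ := mem_nhdsWithin.1 ht
    have hb : ∀ j : ℕ, ∃ t' ∈ 𝓝[A] x, j ≤ s → ∀ y ∈ t' ∩ (V ∩ A), ‖p y j‖ ≤ ‖p x j‖ + 1 := by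
      intro j
      by_cases hj : j ≤ s
      · have hc := (hp.cont j (by exact_mod_cast hj)) x hxt
        have h1 : ∀ᶠ y in 𝓝[t] x, ‖p y j‖ ≤ ‖p x j‖ + 1 := by
          filter_upwards [hc.norm.eventually (gt_mem_nhds (lt_add_one _))] with y hy using hy.le
        obtain ⟨W, hW, hxW, hWt⟩ := mem_nhdsWithin.1 h1
        exact ⟨W, mem_nhdsWithin_of_mem_nhds (hW.mem_nhds hxW), fun _ y hy =>
          hWt ⟨hy.1, hVt hy.2⟩⟩
      · exact ⟨univ, univ_mem, fun h => absurd h hj⟩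
    choose t' ht' hb using hb
    refine ⟨(⋂ j ∈ Finset.range (s + 1), t' j) ∩ (V ∩ A), ?_,
      ∑ j ∈ Finset.range (s + 1), (‖p x j‖ + 1), ?_⟩
    · refine inter_mem ((biInter_finset_mem _).2 fun j _ => ht' j) ?_
      exact inter_mem (mem_nhdsWithin_of_mem_nhds (hV.mem_nhds hxV)) self_mem_nhdsWithin
    · intro O hO hOA y hyO hyt j hj
      have hjr : j ∈ Finset.range (s + 1) := Finset.mem_range.2 (Nat.lt_succ_of_le hj)
      have hOV : IsOpen (O ∩ V) := hO.inter hV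
      have hy : y ∈ O ∩ V := ⟨hyO, hyt.2.1⟩
      have hp' : HasFTaylorSeriesUpToOn s f p (O ∩ V) := hp.mono fun z hz => hVt ⟨hz.2, hOA hz.1⟩
      have he := hp'.eq_iteratedFDerivWithin_of_uniqueDiffOn (m := j) (by exact_mod_cast hj)
        hOV.uniqueDiffOn hy
      rw [iteratedFDerivWithin_of_isOpen j hOV hy] at he
      rw [← he]
      refine (hb j hj y ⟨mem_iInter₂.1 hyt.1 j hjr, hyt.2⟩).trans ?_
      exact Finset.single_le_sum (f := fun j => ‖p x j‖ + 1) (fun _ _ => by positivity) hjr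
  choose! t ht C hC using hloc
  obtain ⟨T, hT, hcov⟩ := hA.elim_nhdsWithin_subcover t ht
  refine ⟨∑ x ∈ T, |C x|, fun O hO hOA y hy j hj => ?_⟩
  obtain ⟨x, hx, hyx⟩ := mem_iUnion₂.1 (hcov (hOA hy))
  exact (hC x (hT x hx) O hO hOA y hy hyx j hj).trans ((le_abs_self _).trans
    (Finset.single_le_sum (f := fun x => |C x|) (fun _ _ => abs_nonneg _) hx))

/-- Functions of time and space. -/
abbrev STFun := ℝ × (ℝ × ℝ) → ℝ

/-- The partial derivative in the direction `v`. -/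
def pd (v : ℝ × (ℝ × ℝ)) (f : STFun) : STFun := fun q => fderiv ℝ f q v

/-- The direction of time. -/
def et : ℝ × (ℝ × ℝ) := (1, (0, 0))

/-- The first direction of space. -/
def ex : ℝ × (ℝ × ℝ) := (0, (1, 0))

/-- The second direction of space. -/
def ey : ℝ × (ℝ × ℝ) := (0, (0, 1))

/-- All derivatives of `f` up to order `n` are continuous in `O` and bounded by `C`. -/
def DerivBound (n : ℕ) (C : ℝ) (f : STFun) (O : Set (ℝ × (ℝ × ℝ))) : Prop :=
  ContDiffOn ℝ n f O ∧ ∀ y ∈ O, ∀ j ≤ n, ‖iteratedFDeriv ℝ j f y‖ ≤ C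

variable {O : Set (ℝ × (ℝ × ℝ))} {f : STFun} {C : ℝ} {n : ℕ}

theorem DerivBound.mono {n' : ℕ} (h : DerivBound n C f O) (hn : n' ≤ n) : DerivBound n' C f O :=
  ⟨h.1.of_le (by exact_mod_cast hn), fun y hy j hj => h.2 y hy j (hj.trans hn)⟩

theorem DerivBound.abs_le (h : DerivBound n C f O) {y} (hy : y ∈ O) : |f y| ≤ C := by
  simpa using h.2 y hy 0 (Nat.zero_le _)

theorem DerivBound.pd (hO : IsOpen O) (h : DerivBound (n + 1) C f O) {v : ℝ × (ℝ × ℝ)}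
    (hv : ‖v‖ ≤ 1) : DerivBound n C (pd v f) O := by
  have hd : ContDiffOn ℝ n (fderiv ℝ f) O :=
    h.1.fderiv_of_isOpen hO (by exact_mod_cast le_rfl)
  refine ⟨hd.clm_apply contDiffOn_const, fun y hy j hj => ?_⟩
  have h1 := norm_iteratedFDeriv_clm_apply_const (c := v) (N := n)
    ((hd y hy).contDiffAt (hO.mem_nhds hy)) (n := j) (by exact_mod_cast hj)
  rw [norm_iteratedFDeriv_fderiv] at h1
  refine h1.trans ?_
  have h2 := h.2 y hy (j + 1) (by omega)
  exact (mul_le_mul hv h2 (norm_nonneg _) zero_le_one).trans (by simp)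

theorem norm_et_le : ‖et‖ ≤ 1 := by simp [et, Prod.norm_def]
theorem norm_ex_le : ‖ex‖ ≤ 1 := by simp [ex, Prod.norm_def]
theorem norm_ey_le : ‖ey‖ ≤ 1 := by simp [ey, Prod.norm_def]

theorem DerivBound.iterate_pd (hO : IsOpen O) {v : ℝ × (ℝ × ℝ)} (hv : ‖v‖ ≤ 1) (i : ℕ) :
    ∀ {f : STFun}, DerivBound (n + i) C f O → DerivBound n C ((EnergyDG.pd v)^[i] f) O := by
  induction i with
  | zero => intro f h; exact h
  | succ i ih => intro f h; exact ih (DerivBound.pd hO h hv)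

theorem pd_congr (hO : IsOpen O) {f g : STFun} (h : EqOn f g O) (v : ℝ × (ℝ × ℝ)) :
    EqOn (pd v f) (pd v g) O := fun q hq => by
  have : f =ᶠ[𝓝 q] g := by filter_upwards [hO.mem_nhds hq] with y hy using h hy
  simp only [pd, this.fderiv_eq]

theorem pd_iterate_congr (hO : IsOpen O) (v : ℝ × (ℝ × ℝ)) (j : ℕ) :
    ∀ {f g : STFun}, EqOn f g O → EqOn ((pd v)^[j] f) ((pd v)^[j] g) O := by
  induction j with
  | zero => intro f g h; exact h
  | succ j ih => intro f g h; exact ih (pd_congr hO h v)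

theorem pd_comm (hO : IsOpen O) (h : ContDiffOn ℝ 2 f O) (v w : ℝ × (ℝ × ℝ)) :
    EqOn (pd v (pd w f)) (pd w (pd v f)) O := fun q hq => by
  have hq' := (h q hq).contDiffAt (hO.mem_nhds hq)
  have hs := hq'.isSymmSndFDerivAt (by simp)
  have hd : DifferentiableAt ℝ (fderiv ℝ f) q :=
    (hq'.fderiv_right (m := 1) le_rfl).differentiableAt one_ne_zero
  have e : ∀ v w : ℝ × (ℝ × ℝ), pd v (pd w f) q = fderiv ℝ (fderiv ℝ f) q v w := fun v w => by
    change fderiv ℝ (fun y => fderiv ℝ f y w) q v = _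
    rw [fderiv_clm_apply hd (differentiableAt_const w)]
    simp
  rw [e, e, hs.eq]

theorem pd_iterate_comm (hO : IsOpen O) (v w : ℝ × (ℝ × ℝ)) (hw : ‖w‖ ≤ 1) (i : ℕ) :
    ∀ {f : STFun}, DerivBound (i + 1) C f O →
      EqOn (pd v ((pd w)^[i] f)) ((pd w)^[i] (pd v f)) O := by
  induction i with
  | zero => intro f _ q _; rfl
  | succ i ih =>
    intro f h q hq
    have h1 := ih (h.pd hO hw) hq
    have h2 : EqOn (pd v (pd w f)) (pd w (pd v f)) O :=
      pd_comm hO (h.1.of_le (by norm_cast; omega)) v w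
    rw [Function.iterate_succ_apply, Function.iterate_succ_apply, h1]
    exact pd_iterate_congr hO w i h2 hq

/-- The mixed derivative `∂_x^i ∂_y^j f` at the point `c` of space, as a function of time. -/
def coef (i j : ℕ) (f : STFun) (c : ℝ × ℝ) (t : ℝ) : ℝ := (pd ey)^[j] ((pd ex)^[i] f) (t, c)

theorem abs_coef_le (hO : IsOpen O) {i j : ℕ} (h : DerivBound (i + j) C f O) {c : ℝ × ℝ} {t : ℝ}
    (hc : (t, c) ∈ O) : |coef i j f c t| ≤ C := by
  have h1 : DerivBound j C ((pd ex)^[i] f) O :=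
    DerivBound.iterate_pd hO norm_ex_le i (h.mono (by omega))
  have h2 : DerivBound 0 C ((pd ey)^[j] ((pd ex)^[i] f)) O :=
    DerivBound.iterate_pd hO norm_ey_le j (h1.mono (by omega))
  exact h2.abs_le hc

theorem coef_pd_ey (hO : IsOpen O) {i j : ℕ} (h : DerivBound (i + j + 1) C f O) {c : ℝ × ℝ} {t : ℝ}
    (hc : (t, c) ∈ O) : coef i j (pd ey f) c t = coef i (j + 1) f c t := by
  have h1 : EqOn (pd ey ((pd ex)^[i] f)) ((pd ex)^[i] (pd ey f)) O :=
    pd_iterate_comm hO ey ex norm_ex_le i (h.mono (by omega))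
  rw [coef, coef, Function.iterate_succ_apply]
  exact (pd_iterate_congr hO ey j h1 hc).symm

theorem hasDerivAt_coef (hO : IsOpen O) {i j : ℕ} (h : DerivBound (i + j + 1) C f O) {c : ℝ × ℝ}
    {t : ℝ} (hc : (t, c) ∈ O) : HasDerivAt (coef i j f c) (coef i j (pd et f) c t) t := by
  have h1 : DerivBound (j + 1) C ((pd ex)^[i] f) O :=
    DerivBound.iterate_pd hO norm_ex_le i (h.mono (by omega))
  have h2 : DerivBound 1 C ((pd ey)^[j] ((pd ex)^[i] f)) O :=
    DerivBound.iterate_pd hO norm_ey_le j (h1.mono (by omega))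
  have hd : DifferentiableAt ℝ ((pd ey)^[j] ((pd ex)^[i] f)) (t, c) :=
    ((h2.1 _ hc).contDiffAt (hO.mem_nhds hc)).differentiableAt one_ne_zero
  have h4 : HasDerivAt (coef i j f c) (pd et ((pd ey)^[j] ((pd ex)^[i] f)) (t, c)) t :=
    hd.hasFDerivAt.comp_hasDerivAt t ((hasDerivAt_id t).prodMk (hasDerivAt_const t c))
  have h5 : EqOn (pd et ((pd ex)^[i] f)) ((pd ex)^[i] (pd et f)) O :=
    pd_iterate_comm hO et ex norm_ex_le i (h.mono (by omega))
  rw [pd_iterate_comm hO et ey norm_ey_le j h1 hc, pd_iterate_congr hO ey j h5 hc] at h4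
  exact h4

/-- The divided power `x ^ i / i!`. -/
def dpow (i : ℕ) (x : ℝ) : ℝ := x ^ i / i.factorial

theorem dpow_zero (x : ℝ) : dpow 0 x = 1 := by simp [dpow]

theorem hasDerivAt_dpow_succ (i : ℕ) (x : ℝ) : HasDerivAt (dpow (i + 1)) (dpow i x) x := by
  have h := (hasDerivAt_pow (i + 1) x).div_const ((i + 1).factorial : ℝ)
  have e : ((i + 1 : ℕ) : ℝ) * x ^ (i + 1 - 1) / ((i + 1).factorial : ℝ) = dpow i x := by
    rw [dpow, Nat.factorial_succ, Nat.add_sub_cancel]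
    push_cast
    field_simp
  rw [e] at h
  exact h

/-- The Taylor polynomial in space about `c`, of total degree less than `n`. -/
def taylor (n : ℕ) (c : ℝ × ℝ) (f : STFun) (t : ℝ) (x : ℝ × ℝ) : ℝ :=
  ∑ i ∈ Finset.range n, ∑ j ∈ Finset.range (n - i),
    coef i j f c t * (dpow i (x.1 - c.1) * dpow j (x.2 - c.2))

theorem continuous_dpow (i : ℕ) : Continuous (dpow i) := by unfold dpow; fun_prop

theorem continuous_taylor (n : ℕ) (c : ℝ × ℝ) (f : STFun) (t : ℝ) :
    Continuous (taylor n c f t) := by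
  have := continuous_dpow
  unfold taylor; fun_prop

theorem hasDerivAt_taylor_time (hO : IsOpen O) (h : DerivBound n C f O) {c : ℝ × ℝ}
    {t : ℝ} (hc : (t, c) ∈ O) (x : ℝ × ℝ) :
    HasDerivAt (fun τ => taylor n c f τ x) (taylor n c (pd et f) t x) t := by
  unfold taylor
  refine HasDerivAt.fun_sum fun i hi => HasDerivAt.fun_sum fun j hj => ?_
  have := Finset.mem_range.1 hi
  have := Finset.mem_range.1 hj
  exact (hasDerivAt_coef hO (h.mono (by omega)) hc).mul_const _

/-- Taylor expansion commutes with differentiation in space. -/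
theorem hasFDerivAt_taylor (hO : IsOpen O) (h : DerivBound n C f O) {c : ℝ × ℝ}
    {t : ℝ} (hc : (t, c) ∈ O) (x : ℝ × ℝ) :
    HasFDerivAt (taylor (n + 1) c f t) (taylor n c (pd ex f) t x • ContinuousLinearMap.fst ℝ ℝ ℝ
      + taylor n c (pd ey f) t x • ContinuousLinearMap.snd ℝ ℝ ℝ) x := by
  have e1 : ∀ i, HasFDerivAt (fun x : ℝ × ℝ => dpow (i + 1) (x.1 - c.1))
      (dpow i (x.1 - c.1) • ContinuousLinearMap.fst ℝ ℝ ℝ) x := fun i => by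
    have h1 : HasFDerivAt (fun x : ℝ × ℝ => x.1 - c.1) (ContinuousLinearMap.fst ℝ ℝ ℝ) x :=
      (ContinuousLinearMap.fst ℝ ℝ ℝ).hasFDerivAt.sub_const c.1
    exact (hasDerivAt_dpow_succ i (x.1 - c.1)).comp_hasFDerivAt x h1
  have e2 : ∀ j, HasFDerivAt (fun x : ℝ × ℝ => dpow (j + 1) (x.2 - c.2))
      (dpow j (x.2 - c.2) • ContinuousLinearMap.snd ℝ ℝ ℝ) x := fun j => by
    have h1 : HasFDerivAt (fun x : ℝ × ℝ => x.2 - c.2) (ContinuousLinearMap.snd ℝ ℝ ℝ) x :=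
      (ContinuousLinearMap.snd ℝ ℝ ℝ).hasFDerivAt.sub_const c.2
    exact (hasDerivAt_dpow_succ j (x.2 - c.2)).comp_hasFDerivAt x h1
  -- derivatives of the divided powers, with the convention that the index `-1` gives zero
  have f1 : ∀ i, HasFDerivAt (fun x : ℝ × ℝ => dpow i (x.1 - c.1))
      ((if i = 0 then 0 else dpow (i - 1) (x.1 - c.1)) • ContinuousLinearMap.fst ℝ ℝ ℝ) x := by
    rintro (_ | i)
    · simpa [dpow_zero] using hasFDerivAt_const (1 : ℝ) x
    · simpa using e1 i
  have f2 : ∀ i, HasFDerivAt (fun x : ℝ × ℝ => dpow i (x.2 - c.2))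
      ((if i = 0 then 0 else dpow (i - 1) (x.2 - c.2)) • ContinuousLinearMap.snd ℝ ℝ ℝ) x := by
    rintro (_ | i)
    · simpa [dpow_zero] using hasFDerivAt_const (1 : ℝ) x
    · simpa using e2 i
  have hsum := HasFDerivAt.fun_sum (u := Finset.range (n + 1)) fun i _ =>
    HasFDerivAt.fun_sum (u := Finset.range (n + 1 - i)) fun j _ =>
      ((f1 i).fun_mul (f2 j)).const_mul (coef i j f c t)
  have hx : taylor n c (pd ex f) t x = ∑ i ∈ Finset.range (n + 1), ∑ j ∈ Finset.range (n + 1 - i),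
      coef i j f c t * ((if i = 0 then 0 else dpow (i - 1) (x.1 - c.1)) * dpow j (x.2 - c.2)) := by
    rw [Finset.sum_range_succ']
    simp only [if_true, zero_mul, mul_zero, Finset.sum_const_zero, add_zero, Nat.add_eq_zero_iff,
      one_ne_zero, and_false, if_false, Nat.add_sub_cancel, Nat.add_sub_add_right]
    rfl
  have hy : taylor n c (pd ey f) t x = ∑ i ∈ Finset.range (n + 1), ∑ j ∈ Finset.range (n + 1 - i),
      coef i j f c t * (dpow i (x.1 - c.1) * (if j = 0 then 0 else dpow (j - 1) (x.2 - c.2))) := by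
    have hin : ∀ i ∈ Finset.range (n + 1), ∑ j ∈ Finset.range (n + 1 - i),
        coef i j f c t * (dpow i (x.1 - c.1) * (if j = 0 then 0 else dpow (j - 1) (x.2 - c.2)))
        = ∑ j ∈ Finset.range (n - i), coef i j (pd ey f) c t
          * (dpow i (x.1 - c.1) * dpow j (x.2 - c.2)) := by
      intro i hi
      have := Finset.mem_range.1 hi
      rw [show n + 1 - i = n - i + 1 by omega, Finset.sum_range_succ']
      simp only [if_true, mul_zero, add_zero, Nat.add_eq_zero_iff,
        one_ne_zero, and_false, if_false, Nat.add_sub_cancel]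
      refine Finset.sum_congr rfl fun j hj => ?_
      have := Finset.mem_range.1 hj
      rw [coef_pd_ey hO (h.mono (by omega)) hc]
    rw [Finset.sum_congr rfl hin, Finset.sum_range_succ, Nat.sub_self]
    simp [taylor]
  refine hsum.congr_fderiv ?_
  rw [hx, hy, Finset.sum_smul, Finset.sum_smul, ← Finset.sum_add_distrib]
  refine Finset.sum_congr rfl fun i _ => ?_
  rw [Finset.sum_smul, Finset.sum_smul, ← Finset.sum_add_distrib]
  refine Finset.sum_congr rfl fun j _ => ?_
  module

/-- The remainder of the Taylor polynomial. By the mean value inequality the remainder of order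
`n + 1` is at most the distance from `c` times the remainders of order `n` of the derivatives. -/
theorem abs_sub_taylor_le {I : Set ℝ} {A : Set (ℝ × ℝ)} (hI : IsOpen I) (hA : IsOpen A)
    (hconv : Convex ℝ A) {c : ℝ × ℝ} (hcA : c ∈ A) {r : ℝ} (hr0 : 0 ≤ r)
    (hr : ∀ x ∈ A, ‖x - c‖ ≤ r) (n : ℕ) :
    ∀ {f : STFun}, DerivBound n C f (I ×ˢ A) → ∀ t ∈ I, ∀ x ∈ A,
      |f (t, x) - taylor n c f t x| ≤ C * (2 * r) ^ n := by
  have hO : IsOpen (I ×ˢ A) := hI.prod hA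
  induction n with
  | zero =>
    intro f h t ht x hx
    simpa [taylor] using h.abs_le (y := (t, x)) ⟨ht, hx⟩
  | succ n ih =>
    intro f h t ht x hx
    have hn : DerivBound n C f (I ×ˢ A) := h.mono (by omega)
    have hC : 0 ≤ C := (abs_nonneg _).trans (h.abs_le (y := (t, x)) ⟨ht, hx⟩)
    have hder : ∀ y ∈ A, HasFDerivWithinAt (fun y => f (t, y) - taylor (n + 1) c f t y)
        ((pd ex f (t, y) - taylor n c (pd ex f) t y) • ContinuousLinearMap.fst ℝ ℝ ℝ
          + (pd ey f (t, y) - taylor n c (pd ey f) t y) • ContinuousLinearMap.snd ℝ ℝ ℝ) A y := by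
      intro y hy
      have hd : DifferentiableAt ℝ f (t, y) := ((h.1 (t, y) ⟨ht, hy⟩).contDiffAt
        (hO.mem_nhds ⟨ht, hy⟩)).differentiableAt (by norm_cast)
      have h1 := hd.hasFDerivAt.comp y ((hasFDerivAt_const t y).prodMk (hasFDerivAt_id y))
      have h2 := (h1.sub (hasFDerivAt_taylor hO hn (show (t, c) ∈ I ×ˢ A from ⟨ht, hcA⟩) y))
      have hL : (pd ex f (t, y) - taylor n c (pd ex f) t y) • ContinuousLinearMap.fst ℝ ℝ ℝ
          + (pd ey f (t, y) - taylor n c (pd ey f) t y) • ContinuousLinearMap.snd ℝ ℝ ℝ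
          = (fderiv ℝ f (t, y)).comp ((0 : ℝ × ℝ →L[ℝ] ℝ).prod (ContinuousLinearMap.id ℝ (ℝ × ℝ)))
            - (taylor n c (pd ex f) t y • ContinuousLinearMap.fst ℝ ℝ ℝ
              + taylor n c (pd ey f) t y • ContinuousLinearMap.snd ℝ ℝ ℝ) := by
        ext <;> simp [pd, ex, ey]
      rw [hL]
      exact h2.hasFDerivWithinAt
    have hbd : ∀ y ∈ A, ‖(pd ex f (t, y) - taylor n c (pd ex f) t y) • ContinuousLinearMap.fst ℝ ℝ ℝ
          + (pd ey f (t, y) - taylor n c (pd ey f) t y) • ContinuousLinearMap.snd ℝ ℝ ℝ‖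
        ≤ 2 * (C * (2 * r) ^ n) := by
      intro y hy
      refine (norm_add_le _ _).trans ?_
      rw [norm_smul, norm_smul, two_mul]
      refine add_le_add ?_ ?_
      · exact (mul_le_of_le_one_right (norm_nonneg _) (ContinuousLinearMap.norm_fst_le ℝ ℝ ℝ)).trans
          (ih (h.pd hO norm_ex_le) t ht y hy)
      · exact (mul_le_of_le_one_right (norm_nonneg _) (ContinuousLinearMap.norm_snd_le ℝ ℝ ℝ)).trans
          (ih (h.pd hO norm_ey_le) t ht y hy)
    have hmv := hconv.norm_image_sub_le_of_norm_hasFDerivWithin_le hder hbd hcA hx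
    have hc0 : f (t, c) - taylor (n + 1) c f t c = 0 := by
      have : taylor (n + 1) c f t c = f (t, c) := by
        have hz : ∀ i, dpow (i + 1) (0 : ℝ) = 0 := fun i => by simp [dpow]
        rw [taylor, Finset.sum_range_succ', Finset.sum_eq_zero, zero_add, Nat.sub_zero,
          Finset.sum_range_succ', Finset.sum_eq_zero, zero_add]
        · simp [coef, dpow_zero]
        · intro j _; simp [hz]
        · intro i _; simp [hz]
      rw [this, sub_self]
    rw [hc0, sub_zero, Real.norm_eq_abs] at hmv
    refine hmv.trans ?_
    calc 2 * (C * (2 * r) ^ n) * ‖x - c‖ ≤ 2 * (C * (2 * r) ^ n) * r := by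
          gcongr; exact hr x hx
      _ = C * (2 * r) ^ (n + 1) := by ring

end Taylor

/-! ### Stability: from consistency to convergence -/

section Stability

open Filter Topology

variable {m k : ℕ} {L₁ L₂ T : ℝ}

theorem PeriodicMesh.sum_jac_le (M : PeriodicMesh L₁ L₂) (h₁ : 0 < L₁) (h₂ : 0 < L₂) :
    ∑ i, (M.elem i).jac ≤ 4 * (L₁ * L₂) := by
  have hsub : ∀ i, (M.elem i).carrier ⊆ Icc 0 L₁ ×ˢ Icc 0 L₂ := fun i => by
    rw [← M.cover]; exact subset_iUnion (fun i => (M.elem i).carrier) i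
  have hint : ∀ i, volume.real (M.elem i).carrier = volume.real (interior (M.elem i).carrier) :=
    fun i => (measureReal_congr
      (interior_ae_eq_of_null_frontier (M.elem i).volume_frontier_carrier)).symm
  have hsum : ∑ i, volume.real (interior (M.elem i).carrier) ≤ L₁ * L₂ := by
    rw [← measureReal_iUnion_fintype M.disj (fun i => isOpen_interior.measurableSet)
      (fun i => ((measure_mono interior_subset).trans_lt
        (M.elem i).isCompact_carrier.measure_lt_top).ne)]
    have h : volume.real (Icc 0 L₁ ×ˢ Icc 0 L₂) = L₁ * L₂ := by
      rw [Measure.volume_eq_prod, measureReal_prod_prod, Real.volume_real_Icc_of_le h₁.le,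
        Real.volume_real_Icc_of_le h₂.le]
      ring
    rw [← h]
    exact measureReal_mono (iUnion_subset fun i => interior_subset.trans (hsub i))
      (isCompact_Icc.prod isCompact_Icc).measure_ne_top
  calc ∑ i, (M.elem i).jac ≤ ∑ i, 4 * volume.real (M.elem i).carrier :=
        Finset.sum_le_sum fun i _ => (M.elem i).jac_le_volume_carrier
    _ = 4 * ∑ i, volume.real (interior (M.elem i).carrier) := by
        rw [← Finset.mul_sum]; simp only [hint]
    _ ≤ _ := by gcongr

theorem continuousOn_setIntegral {K : Set (ℝ × ℝ)} (hK : IsCompact K) {F : ℝ → ℝ × ℝ → ℝ}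
    (hF : ContinuousOn (fun q : ℝ × (ℝ × ℝ) => F q.1 q.2) (Icc 0 T ×ˢ univ)) :
    ContinuousOn (fun t => ∫ x in K, F t x) (Icc 0 T) := by
  rw [continuousOn_iff_continuous_domRestrict]
  have hc : Continuous (Function.uncurry fun (t : Icc (0 : ℝ) T) (x : ℝ × ℝ) => F t x) :=
    hF.comp_continuous (f := fun q : Icc (0 : ℝ) T × (ℝ × ℝ) => ((q.1 : ℝ), q.2)) (by fun_prop)
      fun q => ⟨q.1.2, mem_univ _⟩
  exact continuous_parametric_integral_of_continuous (μ := volume) hc hK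

/-- The derivative of a curve in the local space lies in the span of the nodal basis. -/
theorem deriv_eq_sum_nodalBasis {K : Element} {g g' : ℝ → ℝ × ℝ → ℝ}
    (hg : ∀ t ∈ Ioo 0 T, g t ∈ K.localSpace k)
    (hd : ∀ t ∈ Ioo 0 T, ∀ x, HasDerivAt (fun τ => g τ x) (g' t x) t) {t : ℝ} (ht : t ∈ Ioo 0 T)
    (x : ℝ × ℝ) : g' t x = ∑ a, g' t (K.nodePt k a) * K.nodalBasis k a x := by
  refine (hd t ht x).unique ?_
  have h1 : HasDerivAt (fun τ => ∑ a, g τ (K.nodePt k a) * K.nodalBasis k a x)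
      (∑ a, g' t (K.nodePt k a) * K.nodalBasis k a x) t :=
    HasDerivAt.fun_sum fun a _ => (hd t ht _).mul_const _
  refine h1.congr_of_eventuallyEq ?_
  filter_upwards [Ioo_mem_nhds ht.1 ht.2] with τ hτ using Element.eq_sum_nodalBasis (hg τ hτ) x

theorem continuous_of_eq_sum_nodalBasis {K : Element} {f : ℝ × ℝ → ℝ}
    (hf : ∀ x, f x = ∑ a, f (K.nodePt k a) * K.nodalBasis k a x) : Continuous f := by
  rw [funext hf]
  exact continuous_finsetSum _ fun a _ =>
    continuous_const.mul (K.contDiff_nodalBasis k a (n := 0)).continuous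

theorem setIntegral_mul_eq_sum {K : Element} {f g : ℝ × ℝ → ℝ}
    (hf : ∀ x, f x = ∑ a, f (K.nodePt k a) * K.nodalBasis k a x)
    (hg : ∀ x, g x = ∑ a, g (K.nodePt k a) * K.nodalBasis k a x) :
    ∫ x in K.carrier, f x * g x = ∑ a, ∑ b, f (K.nodePt k a) * g (K.nodePt k b)
      * ∫ x in K.carrier, K.nodalBasis k a x * K.nodalBasis k b x := by
  have hc := fun a => (K.contDiff_nodalBasis k a (n := 0)).continuous
  have hi : ∀ a b, IntegrableOn (fun x => f (K.nodePt k a) * g (K.nodePt k b)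
      * (K.nodalBasis k a x * K.nodalBasis k b x)) K.carrier := fun a b =>
    K.integrableOn_carrier (continuous_const.mul ((hc a).mul (hc b))).continuousOn
  have he : (fun x => f x * g x) = fun x => ∑ a, ∑ b, f (K.nodePt k a) * g (K.nodePt k b)
      * (K.nodalBasis k a x * K.nodalBasis k b x) := by
    ext x
    rw [hf, hg, Finset.sum_mul_sum]
    exact Finset.sum_congr rfl fun a _ => Finset.sum_congr rfl fun b _ => by ring
  rw [he, integral_finsetSum _ fun a _ => integrable_finsetSum _ fun b _ => hi a b]
  refine Finset.sum_congr rfl fun a _ => ?_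
  rw [integral_finsetSum _ fun b _ => hi a b]
  exact Finset.sum_congr rfl fun b _ => integral_const_mul _ _

/-- Differentiation of the square of the `L²` norm along a curve in the local space. -/
theorem hasDerivAt_setIntegral_sq {K : Element} {g g' : ℝ → ℝ × ℝ → ℝ}
    (hg : ∀ t ∈ Ioo 0 T, g t ∈ K.localSpace k)
    (hd : ∀ t ∈ Ioo 0 T, ∀ x, HasDerivAt (fun τ => g τ x) (g' t x) t) {t : ℝ} (ht : t ∈ Ioo 0 T) :
    HasDerivAt (fun τ => ∫ x in K.carrier, g τ x ^ 2) (2 * ∫ x in K.carrier, g' t x * g t x) t := by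
  have hs := fun τ (hτ : τ ∈ Ioo 0 T) => Element.eq_sum_nodalBasis (hg τ hτ)
  have hs' := deriv_eq_sum_nodalBasis hg hd ht
  have h1 : HasDerivAt (fun τ => ∑ a, ∑ b, g τ (K.nodePt k a) * g τ (K.nodePt k b)
        * ∫ x in K.carrier, K.nodalBasis k a x * K.nodalBasis k b x)
      (∑ a, ∑ b,
        (g' t (K.nodePt k a) * g t (K.nodePt k b) + g t (K.nodePt k a) * g' t (K.nodePt k b))
        * ∫ x in K.carrier, K.nodalBasis k a x * K.nodalBasis k b x) t :=
    HasDerivAt.fun_sum fun a _ => HasDerivAt.fun_sum fun b _ =>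
      ((hd t ht _).fun_mul (hd t ht _)).mul_const _
  have h2 : 2 * ∫ x in K.carrier, g' t x * g t x
      = ∑ a, ∑ b,
        (g' t (K.nodePt k a) * g t (K.nodePt k b) + g t (K.nodePt k a) * g' t (K.nodePt k b))
        * ∫ x in K.carrier, K.nodalBasis k a x * K.nodalBasis k b x := by
    have e : ∫ x in K.carrier, g' t x * g t x = ∫ x in K.carrier, g t x * g' t x := by
      simp only [mul_comm]
    rw [two_mul]
    nth_rewrite 2 [e]
    rw [setIntegral_mul_eq_sum hs' (hs t ht), setIntegral_mul_eq_sum (hs t ht) hs',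
      ← Finset.sum_add_distrib]
    refine Finset.sum_congr rfl fun a _ => ?_
    rw [← Finset.sum_add_distrib]
    exact Finset.sum_congr rfl fun b _ => by ring
  rw [h2]
  refine h1.congr_of_eventuallyEq ?_
  filter_upwards [Ioo_mem_nhds ht.1 ht.2] with τ hτ
  simp only [sq]
  exact setIntegral_mul_eq_sum (hs τ hτ) (hs τ hτ)

variable {B₁ B₂ : Matrix (Fin m) (Fin m) ℝ}
  {S : ℝ × ℝ → Matrix (Fin m) (Fin m) ℝ} {lam : ℝ × ℝ → Fin m → ℝ}

theorem convForm_sub (M : PeriodicMesh L₁ L₂) {U V : M.Broken m} (hU : ∀ i, Continuous (U i))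
    (hV : ∀ i, Continuous (V i)) (i : Fin M.N) {v : ℝ × ℝ → Fin m → ℝ} (hv : ContDiff ℝ 1 v) :
    convForm M B₁ B₂ S lam (fun i x => U i x - V i x) i v
      = convForm M B₁ B₂ S lam U i v - convForm M B₁ B₂ S lam V i v := by
  have hv1 : ∀ d, Continuous fun x => fderiv ℝ v x d := fun d =>
    (hv.continuous_fderiv one_ne_zero).clm_apply continuous_const
  have hint : ∀ (B : Matrix (Fin m) (Fin m) ℝ) (d : ℝ × ℝ),
      ∫ x in (M.elem i).carrier, (B *ᵥ (U i x - V i x)) ⬝ᵥ fderiv ℝ v x d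
        = (∫ x in (M.elem i).carrier, (B *ᵥ U i x) ⬝ᵥ fderiv ℝ v x d)
          - ∫ x in (M.elem i).carrier, (B *ᵥ V i x) ⬝ᵥ fderiv ℝ v x d := fun B d => by
    rw [← integral_sub]
    · simp only [Matrix.mulVec_sub, sub_dotProduct]
    · exact (M.elem i).integrableOn_carrier
        (continuous_mulVec_dotProduct B (hU i) (hv1 d)).continuousOn
    · exact (M.elem i).integrableOn_carrier
        (continuous_mulVec_dotProduct B (hV i) (hv1 d)).continuousOn
  have hside : ∀ e : Side M.elem,
      e.integral (fun x => outFlux M B₁ B₂ S lam (fun i x => U i x - V i x) e x ⬝ᵥ v x)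
        = e.integral (fun x => outFlux M B₁ B₂ S lam U e x ⬝ᵥ v x)
          - e.integral (fun x => outFlux M B₁ B₂ S lam V e x ⬝ᵥ v x) := fun e => by
    rw [← Side.integral_sub e ((continuous_outFlux M hU e).dotProduct hv.continuous)
      ((continuous_outFlux M hV e).dotProduct hv.continuous)]
    simp only [outFlux_sub, sub_dotProduct]
  rw [convForm, convForm, convForm, hint, hint, Finset.sum_congr rfl fun l _ => hside ⟨i, l⟩,
    Finset.sum_sub_distrib]
  ring

/-- On an element the weight `B₀` may be replaced by its constant value in the interior. -/
theorem setIntegral_weight {K : Element} {B₀ : ℝ × ℝ → Fin m → ℝ} {b : Fin m → ℝ}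
    (hb : ∀ x ∈ interior K.carrier, B₀ x = b) (w v : ℝ × ℝ → Fin m → ℝ) :
    ∫ x in K.carrier, (B₀ x * w x) ⬝ᵥ v x = ∫ x in K.carrier, (b * w x) ⬝ᵥ v x := by
  refine integral_congr_ae ?_
  filter_upwards [K.ae_restrict_mem_interior] with x hx
  rw [hb x hx]

theorem setIntegral_weight_eq_sum {K : Element} {B₀ : ℝ × ℝ → Fin m → ℝ} {b : Fin m → ℝ}
    (hb : ∀ x ∈ interior K.carrier, B₀ x = b) {w v : ℝ × ℝ → Fin m → ℝ}
    (hw : ∀ j, Continuous fun x => w x j) (hv : ∀ j, Continuous fun x => v x j) :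
    ∫ x in K.carrier, (B₀ x * w x) ⬝ᵥ v x = ∑ j, b j * ∫ x in K.carrier, w x j * v x j := by
  rw [setIntegral_weight hb]
  simp only [dotProduct, Pi.mul_apply, mul_assoc]
  rw [integral_finsetSum]
  · exact Finset.sum_congr rfl fun j _ => integral_const_mul _ _
  · exact fun j _ => K.integrableOn_carrier
      (continuous_const.mul ((hw j).mul (hv j))).continuousOn

theorem continuous_inSpace {M : PeriodicMesh L₁ L₂} {U : M.Broken m} (hU : M.InSpace k U)
    (i : Fin M.N) : Continuous (U i) :=
  continuous_pi fun j => Element.continuous_of_mem_localSpace (hU i j)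

theorem contDiff_inSpace {M : PeriodicMesh L₁ L₂} {U : M.Broken m} (hU : M.InSpace k U)
    (i : Fin M.N) : ContDiff ℝ 1 (U i) :=
  contDiff_pi.2 fun j => Element.contDiff_of_mem_localSpace (hU i j)

/-- The square of the `L²` norm of a broken function. -/
def sqNorm (M : PeriodicMesh L₁ L₂) (U : M.Broken m) : ℝ :=
  ∑ i, ∫ x in (M.elem i).carrier, ∑ j, U i x j ^ 2

theorem sqNorm_nonneg (M : PeriodicMesh L₁ L₂) (U : M.Broken m) : 0 ≤ sqNorm M U :=
  Finset.sum_nonneg fun _ _ => integral_nonneg fun _ => Finset.sum_nonneg fun _ _ => sq_nonneg _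

theorem sq_l2Error (M : PeriodicMesh L₁ L₂) (f : ℝ × ℝ → Fin m → ℝ) (U : M.Broken m) :
    M.l2Error f U ^ 2 = sqNorm M fun i x => f x - U i x :=
  Real.sq_sqrt (sqNorm_nonneg M fun i x => f x - U i x)

theorem l2Error_nonneg (M : PeriodicMesh L₁ L₂) (f : ℝ × ℝ → Fin m → ℝ) (U : M.Broken m) :
    0 ≤ M.l2Error f U := Real.sqrt_nonneg _

theorem integrableOn_sum_sq {K : Element} {U : ℝ × ℝ → Fin m → ℝ} (hU : ContinuousOn U K.carrier) :
    IntegrableOn (fun x => ∑ j, U x j ^ 2) K.carrier :=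
  K.integrableOn_carrier (continuousOn_finsetSum _ fun j _ => (continuousOn_pi.1 hU j).pow 2)

theorem sqNorm_add_le (M : PeriodicMesh L₁ L₂) {U V W : M.Broken m} (hU : ∀ i, Continuous (U i))
    (hV : ∀ i, Continuous (V i)) (h : ∀ i x, W i x = U i x + V i x) :
    sqNorm M W ≤ 2 * sqNorm M U + 2 * sqNorm M V := by
  rw [sqNorm, sqNorm, sqNorm, Finset.mul_sum, Finset.mul_sum, ← Finset.sum_add_distrib]
  refine Finset.sum_le_sum fun i _ => ?_
  have iU := integrableOn_sum_sq (hU i).continuousOn (K := M.elem i)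
  have iV := integrableOn_sum_sq (hV i).continuousOn (K := M.elem i)
  rw [← integral_const_mul, ← integral_const_mul, ← integral_add (iU.const_mul 2) (iV.const_mul 2)]
  refine setIntegral_mono ?_ ((iU.const_mul 2).add (iV.const_mul 2)) fun x => ?_
  · simp only [h]
    exact integrableOn_sum_sq ((hU i).add (hV i)).continuousOn
  · simp only [h, Pi.add_apply, Finset.mul_sum, ← Finset.sum_add_distrib]
    exact Finset.sum_le_sum fun j _ => by nlinarith [sq_nonneg (U i x j - V i x j)]

theorem sqNorm_le_of_abs_le (M : PeriodicMesh L₁ L₂) (h₁ : 0 < L₁) (h₂ : 0 < L₂) {U : M.Broken m}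
    {a : ℝ} (hU : ∀ i, Continuous (U i)) (h : ∀ i, ∀ x ∈ (M.elem i).carrier, ∀ j, |U i x j| ≤ a) :
    sqNorm M U ≤ 4 * (L₁ * L₂) * (m * a ^ 2) := by
  calc sqNorm M U ≤ ∑ i, (M.elem i).jac * (m * a ^ 2) := Finset.sum_le_sum fun i _ => ?_
    _ ≤ _ := by rw [← Finset.sum_mul]; gcongr; exact M.sum_jac_le h₁ h₂
  have h3 : ∫ x in (M.elem i).carrier, ∑ j, U i x j ^ 2
      ≤ ∫ _ in (M.elem i).carrier, (m * a ^ 2 : ℝ) := by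
    refine setIntegral_mono_on (integrableOn_sum_sq (hU i).continuousOn)
      ((M.elem i).integrableOn_carrier continuousOn_const) (M.elem i).measurableSet_carrier
      fun x hx => ?_
    refine (Finset.sum_le_card_nsmul _ _ (a ^ 2) fun j _ => ?_).trans (by simp)
    rw [← sq_abs]
    exact pow_le_pow_left₀ (abs_nonneg _) (h i x hx j) 2
  rw [setIntegral_const, smul_eq_mul] at h3
  exact h3.trans (by gcongr; exact (M.elem i).volume_carrier_le)

/-- A curve `V` in the discrete space, with time derivative `V'`, which approximates `u` pointwise
up to `ρ` and satisfies the scheme up to `ρ`. The residual is measured locally, against a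
bound for the test function. -/
structure IsConsistent (M : PeriodicMesh L₁ L₂) (k : ℕ) (B₀ : ℝ × ℝ → Fin m → ℝ)
    (B₁ B₂ : Matrix (Fin m) (Fin m) ℝ)
    (S : ℝ × ℝ → Matrix (Fin m) (Fin m) ℝ) (lam : ℝ × ℝ → Fin m → ℝ) (T ρ : ℝ)
    (u : ℝ → ℝ × ℝ → Fin m → ℝ) (V V' : ℝ → M.Broken m) : Prop where
  mem : ∀ t ∈ Ioo 0 T, M.InSpace k (V t)
  deriv : ∀ t ∈ Ioo 0 T, ∀ i x j, HasDerivAt (fun τ => V τ i x j) (V' t i x j) t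
  close : ∀ t ∈ Ioo 0 T, ∀ i, ∀ x ∈ (M.elem i).carrier, ∀ j, |u t x j - V t i x j| ≤ ρ
  resid : ∀ t ∈ Ioo 0 T, ∀ i, ∀ v : ℝ × ℝ → Fin m → ℝ,
    (∀ j, (fun x => v x j) ∈ (M.elem i).localSpace k) → ∀ b : ℝ, 0 ≤ b →
    (∀ x ∈ (M.elem i).carrier, ∀ j, |v x j| ≤ b) →
    |schemeForm M B₀ B₁ B₂ S lam (V t) (V' t) i v| ≤ ρ * (M.elem i).jac * b

/-- A differential inequality for the energy implies exponential bounds. -/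
theorem le_exp_mul_of_deriv_le {y y' : ℝ → ℝ} {G : ℝ}
    (hy : ∀ t ∈ Ioo 0 T, HasDerivAt y (y' t) t) (hle : ∀ t ∈ Ioo 0 T, y' t ≤ y t + G)
    (hpos : ∀ t ∈ Ioo 0 T, 0 ≤ y t + G) {ε t : ℝ} (hε : 0 < ε) (hεt : ε ≤ t) (ht : t < T) :
    y t + G ≤ Real.exp T * (y ε + G) := by
  have hz : ∀ t ∈ Ioo 0 T, HasDerivAt (fun t => (y t + G) * Real.exp (-t))
      (y' t * Real.exp (-t) + (y t + G) * (Real.exp (-t) * (-1))) t := fun t ht =>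
    ((hy t ht).add_const G).fun_mul (hasDerivAt_neg t).exp
  have hanti : AntitoneOn (fun t => (y t + G) * Real.exp (-t)) (Ioo 0 T) := by
    refine antitoneOn_of_deriv_nonpos (convex_Ioo 0 T)
      (fun t ht => (hz t ht).continuousAt.continuousWithinAt) ?_ ?_
    · rw [interior_Ioo]
      exact fun t ht => (hz t ht).differentiableAt.differentiableWithinAt
    · rw [interior_Ioo]
      intro t ht
      rw [(hz t ht).deriv]
      nlinarith [hle t ht, Real.exp_pos (-t)]
  have h := hanti ⟨hε, hεt.trans_lt ht⟩ ⟨hε.trans_le hεt, ht⟩ hεt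
  simp only at h
  have hp := hpos ε ⟨hε, hεt.trans_lt ht⟩
  calc y t + G = (y t + G) * Real.exp (-t) * Real.exp t := by
        rw [mul_assoc, ← Real.exp_add]; simp
    _ ≤ (y ε + G) * Real.exp (-ε) * Real.exp t := by gcongr
    _ = Real.exp (t - ε) * (y ε + G) := by rw [mul_assoc, ← Real.exp_add]; ring_nf
    _ ≤ Real.exp T * (y ε + G) := by gcongr; linarith

end Stability

/-! ### The energy estimate -/

section Stability

open Filter Topology

variable {m k : ℕ} {L₁ L₂ T : ℝ} {B₁ B₂ : Matrix (Fin m) (Fin m) ℝ}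
  {S : ℝ × ℝ → Matrix (Fin m) (Fin m) ℝ} {lam : ℝ × ℝ → Fin m → ℝ}
  {M : PeriodicMesh L₁ L₂} {B₀ : ℝ × ℝ → Fin m → ℝ} {ρ : ℝ} {u : ℝ → ℝ × ℝ → Fin m → ℝ}
  {U V V' : ℝ → M.Broken m} {b : Fin M.N → Fin m → ℝ}

theorem IsDGSolution.hasDerivAt (hU : IsDGSolution M k B₀ B₁ B₂ S lam T U) {t : ℝ}
    (ht : t ∈ Ioo 0 T) (i : Fin M.N) (x : ℝ × ℝ) (j : Fin m) :
    HasDerivAt (fun τ => U τ i x j) (derivWithin (fun τ => U τ i x j) (Icc 0 T) t) t :=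
  ((hU.diff t (Ioo_subset_Ioc_self ht) i x j).hasDerivWithinAt).hasDerivAt
    (Icc_mem_nhds ht.1 ht.2)

/-- The energy identity for the difference of a consistent curve and the solution of the method:
the skew-symmetry of `convForm` leaves only the residual. -/
theorem hasDerivAt_energy (h₁ : B₁.IsSymm) (h₂ : B₂.IsSymm)
    (hb : ∀ i, ∀ x ∈ interior (M.elem i).carrier, B₀ x = b i)
    (hU : IsDGSolution M k B₀ B₁ B₂ S lam T U)
    (hV : IsConsistent M k B₀ B₁ B₂ S lam T ρ u V V') {t : ℝ} (ht : t ∈ Ioo 0 T) :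
    HasDerivAt (fun τ => ∑ i, ∑ j, b i j * ∫ x in (M.elem i).carrier, (V τ i x j - U τ i x j) ^ 2)
      (2 * ∑ i, schemeForm M B₀ B₁ B₂ S lam (V t) (V' t) i (fun x => V t i x - U t i x)) t := by
  set W : M.Broken m := fun i x j => derivWithin (fun τ => U τ i x j) (Icc 0 T) t with hW
  have hUs : ∀ τ ∈ Ioo 0 T, M.InSpace k (U τ) := fun τ hτ => hU.mem τ (Ioo_subset_Icc_self hτ)
  have hUd : ∀ τ ∈ Ioo 0 T, ∀ i x j, HasDerivAt (fun τ => U τ i x j)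
      (derivWithin (fun τ => U τ i x j) (Icc 0 T) τ) τ := fun τ hτ i x j => hU.hasDerivAt hτ i x j
  have hcW : ∀ i j, Continuous fun x => W i x j := fun i j =>
    continuous_of_eq_sum_nodalBasis (k := k) (deriv_eq_sum_nodalBasis (k := k)
      (g := fun τ x => U τ i x j) (g' := fun τ x => derivWithin (fun τ => U τ i x j) (Icc 0 T) τ)
      (fun τ hτ => hUs τ hτ i j) (fun τ hτ x => hUd τ hτ i x j) ht)
  have hcV' : ∀ i j, Continuous fun x => V' t i x j := fun i j =>
    continuous_of_eq_sum_nodalBasis (k := k) (deriv_eq_sum_nodalBasis (k := k)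
      (g := fun τ x => V τ i x j) (g' := fun τ x => V' τ i x j)
      (fun τ hτ => hV.mem τ hτ i j) (fun τ hτ x => hV.deriv τ hτ i x j) ht)
  have hcU := fun i => continuous_inSpace (hUs t ht) i
  have hcV := fun i => continuous_inSpace (hV.mem t ht) i
  have hθ : M.InSpace k fun i x => V t i x - U t i x := fun i j =>
    sub_mem (hV.mem t ht i j) (hUs t ht i j)
  have hcθ : ∀ i j, Continuous fun x => V t i x j - U t i x j := fun i j =>
    Element.continuous_of_mem_localSpace (hθ i j)
  have hd : HasDerivAt
      (fun τ => ∑ i, ∑ j, b i j * ∫ x in (M.elem i).carrier, (V τ i x j - U τ i x j) ^ 2)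
      (∑ i, ∑ j, b i j * (2 * ∫ x in (M.elem i).carrier,
        (V' t i x j - W i x j) * (V t i x j - U t i x j))) t :=
    HasDerivAt.fun_sum fun i _ => HasDerivAt.fun_sum fun j _ =>
      (hasDerivAt_setIntegral_sq (k := k) (g := fun τ x => V τ i x j - U τ i x j)
        (g' := fun τ x => V' τ i x j - derivWithin (fun τ => U τ i x j) (Icc 0 T) τ)
        (fun τ hτ => sub_mem (hV.mem τ hτ i j) (hUs τ hτ i j))
        (fun τ hτ x => (hV.deriv τ hτ i x j).sub (hUd τ hτ i x j)) ht).const_mul (b i j)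
  convert hd using 1
  -- the scheme, tested with the difference, and the conservation of energy
  have hscheme : ∀ i, schemeForm M B₀ B₁ B₂ S lam (V t) (V' t) i (fun x => V t i x - U t i x)
      = (∑ j, b i j * ∫ x in (M.elem i).carrier,
          (V' t i x j - W i x j) * (V t i x j - U t i x j))
        + convForm M B₁ B₂ S lam (fun i x => V t i x - U t i x) i (fun x => V t i x - U t i x) := by
    intro i
    have h0 := hU.scheme t (Ioo_subset_Ioc_self ht) i (fun x => V t i x - U t i x) (hθ i)
    have hw := setIntegral_weight_eq_sum (hb i) (w := W i) (v := fun x => V t i x - U t i x)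
      (hcW i) (hcθ i)
    have hw' := setIntegral_weight_eq_sum (hb i) (w := V' t i)
      (v := fun x => V t i x - U t i x) (hcV' i) (hcθ i)
    rw [schemeForm_eq] at h0
    rw [schemeForm_eq, hw', convForm_sub M hcV hcU i (contDiff_inSpace hθ i)]
    have h0' := hw.symm.trans (eq_neg_of_add_eq_zero_left h0)
    have h3 : ∀ j, ∫ x in (M.elem i).carrier, (V' t i x j - W i x j) * (V t i x j - U t i x j)
        = (∫ x in (M.elem i).carrier, V' t i x j * (V t i x j - U t i x j))
          - ∫ x in (M.elem i).carrier, W i x j * (V t i x j - U t i x j) := fun j => by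
      rw [← integral_sub]
      · simp only [sub_mul]
      · exact (M.elem i).integrableOn_carrier ((hcV' i j).mul (hcθ i j)).continuousOn
      · exact (M.elem i).integrableOn_carrier ((hcW i j).mul (hcθ i j)).continuousOn
    simp only [Pi.sub_apply] at h0' ⊢
    simp only [h3, mul_sub (b i _), Finset.sum_sub_distrib]
    linarith
  rw [Finset.sum_congr rfl fun i _ => hscheme i, Finset.sum_add_distrib,
    sum_convForm_self M h₁ h₂ (fun i => contDiff_inSpace hθ i), add_zero, Finset.mul_sum]
  refine Finset.sum_congr rfl fun i _ => ?_
  rw [Finset.mul_sum]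
  exact Finset.sum_congr rfl fun j _ => by ring

/-- The residual is absorbed by the energy, by the inverse inequality. -/
theorem two_mul_sum_schemeForm_le {C β : ℝ} (hC : 0 < C)
    (hinv : ∀ (K : Element), ∀ f ∈ K.localSpace k, ∀ x ∈ K.carrier,
      f x ^ 2 * K.jac ≤ C * ∫ y in K.carrier, f y ^ 2) (hβ : 0 < β) (hbβ : ∀ i j, β ≤ b i j)
    (hL₁ : 0 < L₁) (hL₂ : 0 < L₂)
    (hV : IsConsistent M k B₀ B₁ B₂ S lam T ρ u V V') {t : ℝ} (ht : t ∈ Ioo 0 T)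
    {θ : M.Broken m} (hθ : M.InSpace k θ) :
    2 * ∑ i, schemeForm M B₀ B₁ B₂ S lam (V t) (V' t) i (θ i)
      ≤ (∑ i, ∑ j, b i j * ∫ x in (M.elem i).carrier, θ i x j ^ 2)
        + C / β * (4 * (L₁ * L₂)) * ρ ^ 2 := by
  have hloc : ∀ i, 2 * schemeForm M B₀ B₁ B₂ S lam (V t) (V' t) i (θ i)
      ≤ (∑ j, b i j * ∫ x in (M.elem i).carrier, θ i x j ^ 2)
        + C / β * ρ ^ 2 * (M.elem i).jac := by
    intro i
    set J := (M.elem i).jac with hJ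
    have hJ0 : 0 < J := (M.elem i).jac_pos
    set E := ∑ j, ∫ x in (M.elem i).carrier, θ i x j ^ 2 with hE
    have hE0 : 0 ≤ E := Finset.sum_nonneg fun _ _ => integral_nonneg fun _ => sq_nonneg _
    set B := Real.sqrt (C * E / J) with hB
    have hB2 : B ^ 2 = C * E / J := Real.sq_sqrt (by positivity)
    have hbd : ∀ x ∈ (M.elem i).carrier, ∀ j, |θ i x j| ≤ B := fun x hx j => by
      refine Real.abs_le_sqrt ?_
      rw [le_div_iff₀ hJ0]
      refine (hinv _ _ (hθ i j) x hx).trans ?_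
      gcongr
      exact Finset.single_le_sum (f := fun j => ∫ x in (M.elem i).carrier, θ i x j ^ 2)
        (fun _ _ => integral_nonneg fun _ => sq_nonneg _) (Finset.mem_univ j)
    have hr := (le_abs_self _).trans (hV.resid t ht i (θ i) (hθ i) B (Real.sqrt_nonneg _) hbd)
    have hEb : β * E ≤ ∑ j, b i j * ∫ x in (M.elem i).carrier, θ i x j ^ 2 := by
      rw [hE, Finset.mul_sum]
      exact Finset.sum_le_sum fun j _ => mul_le_mul_of_nonneg_right (hbβ i j)
        (integral_nonneg fun _ => sq_nonneg _)
    have hJB : J * B ^ 2 = C * E := by rw [hB2]; field_simp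
    -- Young's inequality with weight `β / C`
    have hy : 2 * (ρ * J * B) ≤ C / β * ρ ^ 2 * J + β / C * (J * B ^ 2) := by
      have h0 : 0 ≤ J * (C / β) * (ρ - β / C * B) ^ 2 := by positivity
      have h1 : J * (C / β) * (ρ - β / C * B) ^ 2
          = C / β * ρ ^ 2 * J + β / C * (J * B ^ 2) - 2 * (ρ * J * B) := by
        field_simp
        ring
      linarith
    rw [hJB, show β / C * (C * E) = β * E by field_simp] at hy
    linarith
  calc 2 * ∑ i, schemeForm M B₀ B₁ B₂ S lam (V t) (V' t) i (θ i)
      = ∑ i, 2 * schemeForm M B₀ B₁ B₂ S lam (V t) (V' t) i (θ i) := Finset.mul_sum _ _ _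
    _ ≤ ∑ i, ((∑ j, b i j * ∫ x in (M.elem i).carrier, θ i x j ^ 2)
        + C / β * ρ ^ 2 * (M.elem i).jac) := Finset.sum_le_sum fun i _ => hloc i
    _ = (∑ i, ∑ j, b i j * ∫ x in (M.elem i).carrier, θ i x j ^ 2)
        + C / β * ρ ^ 2 * ∑ i, (M.elem i).jac := by rw [Finset.sum_add_distrib, Finset.mul_sum]
    _ ≤ (∑ i, ∑ j, b i j * ∫ x in (M.elem i).carrier, θ i x j ^ 2)
        + C / β * ρ ^ 2 * (4 * (L₁ * L₂)) := by
        have := M.sum_jac_le hL₁ hL₂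
        gcongr
    _ = _ := by ring

theorem continuousOn_uncurry_of_isDGSolution (hU : IsDGSolution M k B₀ B₁ B₂ S lam T U)
    (i : Fin M.N) (j : Fin m) :
    ContinuousOn (fun q : ℝ × (ℝ × ℝ) => U q.1 i q.2 j) (Icc 0 T ×ˢ univ) := by
  have h : ContinuousOn (fun q : ℝ × (ℝ × ℝ) => ∑ a, U q.1 i ((M.elem i).nodePt k a) j
      * (M.elem i).nodalBasis k a q.2) (Icc 0 T ×ˢ univ) :=
    continuousOn_finsetSum _ fun a _ =>
      ((hU.cont i _ j).comp continuousOn_fst fun q hq => hq.1).mul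
        ((((M.elem i).contDiff_nodalBasis k a (n := 0)).continuous.comp
          continuous_snd).continuousOn)
  exact h.congr fun q hq => Element.eq_sum_nodalBasis (hU.mem q.1 hq.1 i j) q.2

theorem continuousOn_sqNorm {F : ℝ → M.Broken m}
    (hF : ∀ i j, ContinuousOn (fun q : ℝ × (ℝ × ℝ) => F q.1 i q.2 j) (Icc 0 T ×ˢ univ)) :
    ContinuousOn (fun t => sqNorm M (F t)) (Icc 0 T) :=
  continuousOn_finsetSum _ fun i _ => continuousOn_setIntegral (M.elem i).isCompact_carrier
    (F := fun t x => ∑ j, F t i x j ^ 2)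
    (continuousOn_finsetSum _ fun j _ => (hF i j).pow 2)

theorem sqNorm_sum_comm {F : M.Broken m} (hF : ∀ i, Continuous (F i)) :
    sqNorm M F = ∑ i, ∑ j, ∫ x in (M.elem i).carrier, F i x j ^ 2 := by
  refine Finset.sum_congr rfl fun i _ => integral_finsetSum _ fun j _ => ?_
  exact (M.elem i).integrableOn_carrier (((continuous_pi_iff.1 (hF i)) j).pow 2).continuousOn

/-- An `L²` projection is a best approximation. -/
theorem sqNorm_projection_le {f : ℝ × ℝ → Fin m → ℝ} (hf : Continuous f) {P W : M.Broken m}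
    (hP : M.IsL2Projection k f P) (hW : M.InSpace k W) :
    sqNorm M (fun i x => f x - P i x) ≤ sqNorm M (fun i x => f x - W i x) := by
  refine Finset.sum_le_sum fun i _ => ?_
  have hPc := continuous_inSpace hP.1 i
  have hWc := continuous_inSpace hW i
  have h0 := hP.2 i (fun x => W i x - P i x) fun j => sub_mem (hW i j) (hP.1 i j)
  have i1 : IntegrableOn (fun x => (f x - P i x) ⬝ᵥ (W i x - P i x)) (M.elem i).carrier :=
    (M.elem i).integrableOn_carrier ((hf.sub hPc).dotProduct (hWc.sub hPc)).continuousOn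
  have i2 : IntegrableOn (fun x => ∑ j, (f x - W i x) j ^ 2) (M.elem i).carrier :=
    integrableOn_sum_sq (hf.sub hWc).continuousOn
  have h1 : ∫ x in (M.elem i).carrier, ∑ j, (f x - P i x) j ^ 2
      ≤ ∫ x in (M.elem i).carrier,
        ((∑ j, (f x - W i x) j ^ 2) + 2 * ((f x - P i x) ⬝ᵥ (W i x - P i x))) := by
    refine setIntegral_mono (integrableOn_sum_sq (hf.sub hPc).continuousOn)
      (i2.add (i1.const_mul 2)) fun x => ?_
    simp only [dotProduct, Finset.mul_sum, ← Finset.sum_add_distrib]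
    refine Finset.sum_le_sum fun j _ => ?_
    simp only [Pi.sub_apply]
    nlinarith [sq_nonneg (W i x j - P i x j)]
  rw [integral_add i2 (i1.const_mul 2), integral_const_mul, h0, mul_zero, add_zero] at h1
  exact h1

end Stability

section Convergence

open Filter Topology

/-- Consistency of order `ρ` implies convergence of order `ρ`. The consistent curve `V` is given on
the open time interval only, so the bounds are extended to `[0, T]` by the continuity of the
error. -/
theorem exists_l2Error_le (m k : ℕ) {L₁ L₂ T β₁ β₂ : ℝ} (hL₁ : 0 < L₁) (hL₂ : 0 < L₂) (hT : 0 < T)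
    (hβ : 0 < β₁) :
    ∃ C : ℝ, 0 ≤ C ∧ ∀ (M : PeriodicMesh L₁ L₂) (B₀ : ℝ × ℝ → Fin m → ℝ)
      (B₁ B₂ : Matrix (Fin m) (Fin m) ℝ) (S : ℝ × ℝ → Matrix (Fin m) (Fin m) ℝ)
      (lam : ℝ × ℝ → Fin m → ℝ) (b : Fin M.N → Fin m → ℝ) (ρ : ℝ) (u : ℝ → ℝ × ℝ → Fin m → ℝ)
      (U V V' : ℝ → M.Broken m), B₁.IsSymm → B₂.IsSymm →
      (∀ i, ∀ x ∈ interior (M.elem i).carrier, B₀ x = b i) → (∀ i j, β₁ ≤ b i j) →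
      (∀ i j, b i j ≤ β₂) → 0 ≤ ρ →
      ContinuousOn (fun q : ℝ × (ℝ × ℝ) => u q.1 q.2) (Icc 0 T ×ˢ univ) →
      IsDGSolution M k B₀ B₁ B₂ S lam T U → IsConsistent M k B₀ B₁ B₂ S lam T ρ u V V' →
      (∀ t ∈ Icc 0 T, M.l2Error (u t) (U t) ≤ C * (M.l2Error (u 0) (U 0) + ρ)) ∧
      (M.IsL2Projection k (u 0) (U 0) → ∀ t ∈ Icc 0 T, M.l2Error (u t) (U t) ≤ C * ρ) := by
  obtain ⟨C₀', hC₀', hinv'⟩ := exists_sq_le_integral_localSpace k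
  set C₀ := C₀' + 1 with hC₀def
  have hC₀ : 0 < C₀ := by linarith
  have hinv : ∀ (K : Element), ∀ f ∈ K.localSpace k, ∀ x ∈ K.carrier,
      f x ^ 2 * K.jac ≤ C₀ * ∫ y in K.carrier, f y ^ 2 := fun K f hf x hx =>
    (hinv' K f hf x hx).trans (mul_le_mul_of_nonneg_right (by linarith)
      (integral_nonneg fun _ => sq_nonneg _))
  set J := 4 * (L₁ * L₂) with hJ
  have hJ0 : 0 < J := by positivity
  set G₀ := C₀ / β₁ * J with hG₀
  have hG₀' : 0 < G₀ := by positivity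
  set P := J * m with hP
  have hP0 : 0 ≤ P := by positivity
  set β₃ := max β₂ 0 with hβ₃
  have hβ₃' : 0 ≤ β₃ := le_max_right _ _
  -- constant of the estimate `‖u(t) - U(t)‖² ≤ C₁ (‖u(0) - U(0)‖² + ρ²)`
  set C₁ := 1 + 2 * P + 2 / β₁ * Real.exp T * (2 * β₃ + 2 * β₃ * P + G₀) with hC₁
  have hC₁0 : 1 ≤ C₁ := by
    rw [hC₁, add_assoc]; exact le_add_of_nonneg_right (by positivity)
  refine ⟨Real.sqrt (C₁ * (2 * P + 1)), Real.sqrt_nonneg _, ?_⟩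
  intro M B₀ B₁ B₂ S lam b ρ u U V V' h₁ h₂ hb hb₁ hb₂ hρ hu hU hV
  set e : ℝ → ℝ := fun t => sqNorm M fun i x => u t x - U t i x with he
  have hut : ∀ t ∈ Icc 0 T, Continuous (u t) := fun t ht =>
    hu.comp_continuous (f := fun x => (t, x)) (by fun_prop) fun x => ⟨ht, mem_univ _⟩
  have hec : ContinuousOn e (Icc 0 T) := continuousOn_sqNorm fun i j =>
    (continuousOn_pi.1 hu j).sub (continuousOn_uncurry_of_isDGSolution hU i j)
  have hVc : ∀ t ∈ Ioo 0 T, ∀ i, Continuous (V t i) := fun t ht i =>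
    continuous_inSpace (hV.mem t ht) i
  have hUc : ∀ t ∈ Ioo 0 T, ∀ i, Continuous (U t i) := fun t ht i =>
    continuous_inSpace (hU.mem t (Ioo_subset_Icc_self ht)) i
  have hclose : ∀ t ∈ Ioo 0 T, sqNorm M (fun i x => u t x - V t i x) ≤ P * ρ ^ 2 := fun t ht => by
    refine (sqNorm_le_of_abs_le M hL₁ hL₂
      (fun i => (hut t (Ioo_subset_Icc_self ht)).sub (hVc t ht i))
      fun i x hx j => hV.close t ht i x hx j).trans (le_of_eq (by rw [hP, hJ]; ring))
  -- the weighted energy, equivalent to the square of the `L²` norm of `V - U`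
  set y : ℝ → ℝ := fun t =>
    ∑ i, ∑ j, b i j * ∫ x in (M.elem i).carrier, (V t i x j - U t i x j) ^ 2 with hy
  have hyl : ∀ t ∈ Ioo 0 T, β₁ * sqNorm M (fun i x => V t i x - U t i x) ≤ y t := fun t ht => by
    rw [sqNorm_sum_comm (F := fun i x => V t i x - U t i x)
      fun i => (hVc t ht i).sub (hUc t ht i), Finset.mul_sum]
    refine Finset.sum_le_sum fun i _ => ?_
    rw [Finset.mul_sum]
    exact Finset.sum_le_sum fun j _ => mul_le_mul_of_nonneg_right (hb₁ i j)
      (integral_nonneg fun _ => sq_nonneg _)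
  have hyu : ∀ t ∈ Ioo 0 T, y t ≤ β₃ * sqNorm M (fun i x => V t i x - U t i x) := fun t ht => by
    rw [sqNorm_sum_comm (F := fun i x => V t i x - U t i x)
      fun i => (hVc t ht i).sub (hUc t ht i), Finset.mul_sum]
    refine Finset.sum_le_sum fun i _ => ?_
    rw [Finset.mul_sum]
    exact Finset.sum_le_sum fun j _ => mul_le_mul_of_nonneg_right
      ((hb₂ i j).trans (le_max_left _ _)) (integral_nonneg fun _ => sq_nonneg _)
  have hy0 : ∀ t ∈ Ioo 0 T, 0 ≤ y t := fun t ht =>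
    (mul_nonneg hβ.le (sqNorm_nonneg _ _)).trans (hyl t ht)
  -- the estimate between two times in the open interval
  have hmid : ∀ ε t : ℝ, 0 < ε → ε ≤ t → t < T → e t ≤ C₁ * (e ε + ρ ^ 2) := by
    intro ε t hε hεt ht
    have hεm : ε ∈ Ioo 0 T := ⟨hε, hεt.trans_lt ht⟩
    have htm : t ∈ Ioo 0 T := ⟨hε.trans_le hεt, ht⟩
    have hg := le_exp_mul_of_deriv_le (y := y) (G := G₀ * ρ ^ 2)
      (fun t ht => hasDerivAt_energy h₁ h₂ hb hU hV ht)
      (fun t ht => two_mul_sum_schemeForm_le hC₀ hinv hβ hb₁ hL₁ hL₂ hV ht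
        fun i j => sub_mem (hV.mem t ht i j) (hU.mem t (Ioo_subset_Icc_self ht) i j))
      (fun t ht => add_nonneg (hy0 t ht) (by positivity)) hε hεt ht
    have e1 : e t ≤ 2 * (P * ρ ^ 2) + 2 * (y t / β₁) := by
      refine (sqNorm_add_le M (U := fun i x => u t x - V t i x) (V := fun i x => V t i x - U t i x)
        (fun i => (hut t (Ioo_subset_Icc_self htm)).sub (hVc t htm i))
        (fun i => (hVc t htm i).sub (hUc t htm i)) fun i x => by abel).trans ?_
      have e3 : sqNorm M (fun i x => V t i x - U t i x) ≤ y t / β₁ := by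
        rw [le_div_iff₀ hβ, mul_comm]; exact hyl t htm
      have e4 := hclose t htm
      linarith
    have e2 : y ε ≤ β₃ * (2 * (P * ρ ^ 2) + 2 * e ε) := by
      refine (hyu ε hεm).trans (mul_le_mul_of_nonneg_left ?_ hβ₃')
      refine (sqNorm_add_le M (U := fun i x => V ε i x - u ε x) (V := fun i x => u ε x - U ε i x)
        (fun i => (hVc ε hεm i).sub (hut ε (Ioo_subset_Icc_self hεm)))
        (fun i => (hut ε (Ioo_subset_Icc_self hεm)).sub (hUc ε hεm i)) fun i x => by abel).trans ?_
      have e4 : sqNorm M (fun i x => V ε i x - u ε x) = sqNorm M (fun i x => u ε x - V ε i x) := by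
        simp only [sqNorm, Pi.sub_apply]
        exact Finset.sum_congr rfl fun i _ => by
          congr 1; ext x; exact Finset.sum_congr rfl fun j _ => by ring
      rw [e4]
      have e5 := hclose ε hεm
      linarith
    have e3 : y t ≤ Real.exp T * (β₃ * (2 * (P * ρ ^ 2) + 2 * e ε) + G₀ * ρ ^ 2) := by
      have h0 : 0 ≤ G₀ * ρ ^ 2 := by positivity
      have h3 : Real.exp T * (y ε + G₀ * ρ ^ 2)
          ≤ Real.exp T * (β₃ * (2 * (P * ρ ^ 2) + 2 * e ε) + G₀ * ρ ^ 2) := by gcongr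
      linarith
    have he0 : 0 ≤ e ε := sqNorm_nonneg _ _
    have e6 : y t / β₁ ≤ Real.exp T * (β₃ * (2 * (P * ρ ^ 2) + 2 * e ε) + G₀ * ρ ^ 2) / β₁ := by
      gcongr
    have e7 : C₁ * (e ε + ρ ^ 2) = 2 * (P * ρ ^ 2)
        + 2 * (Real.exp T * (β₃ * (2 * (P * ρ ^ 2) + 2 * e ε) + G₀ * ρ ^ 2) / β₁)
        + (e ε + ρ ^ 2 + 2 * P * e ε
          + 2 / β₁ * Real.exp T * (2 * β₃ * ρ ^ 2 + 2 * β₃ * P * e ε + G₀ * e ε)) := by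
      rw [hC₁]; field_simp; ring
    have e8 : 0 ≤ e ε + ρ ^ 2 + 2 * P * e ε
          + 2 / β₁ * Real.exp T * (2 * β₃ * ρ ^ 2 + 2 * β₃ * P * e ε + G₀ * e ε) := by positivity
    linarith
  have h0m : (0 : ℝ) ∈ Icc 0 T := ⟨le_rfl, hT.le⟩
  have hlim0 : ∀ {f : ℝ → ℝ}, ContinuousOn f (Icc 0 T) → Tendsto f (𝓝[>] 0) (𝓝 (f 0)) :=
    fun hf => (hf 0 h0m).mono_left (nhdsWithin_le_iff.2 (Icc_mem_nhdsGT hT))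
  -- extension to the initial and the final time
  have hopen : ∀ t ∈ Ioo 0 T, e t ≤ C₁ * (e 0 + ρ ^ 2) := fun t ht => by
    refine ge_of_tendsto (((hlim0 hec).add_const (ρ ^ 2)).const_mul C₁) ?_
    filter_upwards [Ioo_mem_nhdsGT ht.1] with ε hε using hmid ε t hε.1 hε.2.le ht.2
  have hclosed : ∀ t ∈ Icc 0 T, e t ≤ C₁ * (e 0 + ρ ^ 2) := fun t ht => by
    rcases ht.1.eq_or_lt with h | h
    · rw [← h]
      have : 0 ≤ e 0 := sqNorm_nonneg _ _
      nlinarith [sq_nonneg ρ]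
    · rcases ht.2.eq_or_lt with h' | h'
      · subst h'
        have hl : Tendsto e (𝓝[<] t) (𝓝 (e t)) :=
          (hec t ht).mono_left (nhdsWithin_le_iff.2 (Icc_mem_nhdsLT hT))
        refine le_of_tendsto hl ?_
        filter_upwards [Ioo_mem_nhdsLT hT] with s hs using hopen s hs
      · exact hopen t ⟨h, h'⟩
  have hsq : ∀ t, M.l2Error (u t) (U t) ^ 2 = e t := fun t => sq_l2Error M _ _
  have hmain : ∀ t ∈ Icc 0 T, ∀ r : ℝ, 0 ≤ r → e 0 + ρ ^ 2 ≤ (2 * P + 1) * r ^ 2 →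
      M.l2Error (u t) (U t) ≤ Real.sqrt (C₁ * (2 * P + 1)) * r := fun t ht r hr h => by
    refine (sq_le_sq₀ (l2Error_nonneg _ _ _) (by positivity)).1 ?_
    rw [hsq, mul_pow, Real.sq_sqrt (by positivity), mul_assoc]
    exact (hclosed t ht).trans (by gcongr)
  refine ⟨fun t ht => ?_, fun hproj t ht => ?_⟩
  · have hn := l2Error_nonneg M (u 0) (U 0)
    refine hmain t ht _ (add_nonneg hn hρ) ?_
    rw [← hsq]
    nlinarith [mul_nonneg hn hρ, mul_nonneg hP0 (sq_nonneg (M.l2Error (u 0) (U 0) + ρ))]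
  · refine hmain t ht ρ hρ ?_
    have hD : ContinuousOn (fun t => sqNorm M fun (_ : Fin M.N) x => u 0 x - u t x) (Icc 0 T) := by
      refine continuousOn_sqNorm fun i j => ?_
      refine ContinuousOn.sub ?_ (continuousOn_pi.1 hu j)
      exact (((continuous_apply j).comp (hut 0 h0m)).comp continuous_snd).continuousOn
    have hz : (sqNorm M fun (_ : Fin M.N) x => u 0 x - u 0 x) = 0 := by simp [sqNorm]
    have hl := ((hlim0 hD).const_mul 2).add_const (2 * (P * ρ ^ 2))
    simp only [hz, mul_zero, zero_add] at hl
    -- the projection is at least as close to `u 0` as `V ε`, which is close to `u ε`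
    have : e 0 ≤ 2 * (P * ρ ^ 2) := by
      refine ge_of_tendsto hl ?_
      filter_upwards [Ioo_mem_nhdsGT hT] with ε hε
      have h3 := sqNorm_projection_le (hut 0 h0m) hproj (hV.mem ε hε)
      have h4 := sqNorm_add_le M (U := fun _ x => u 0 x - u ε x) (V := fun i x => u ε x - V ε i x)
        (W := fun i x => u 0 x - V ε i x)
        (fun i => (hut 0 h0m).sub (hut ε (Ioo_subset_Icc_self hε)))
        (fun i => (hut ε (Ioo_subset_Icc_self hε)).sub (hVc ε hε i)) fun i x => by abel
      have h5 := hclose ε hε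
      linarith
    linarith

end Convergence

/-! ### Consistency of Taylor polynomials on general meshes -/

section Consistency

open Filter Topology

variable {m k : ℕ} {L₁ L₂ T : ℝ} {B₁ B₂ : Matrix (Fin m) (Fin m) ℝ}
  {S : ℝ × ℝ → Matrix (Fin m) (Fin m) ℝ} {lam : ℝ × ℝ → Fin m → ℝ}

theorem abs_mulVec_le {X : Matrix (Fin m) (Fin m) ℝ} {y : Fin m → ℝ} {κ δ : ℝ} (hκ : 0 ≤ κ)
    (hX : ∀ a b, |X a b| ≤ κ) (hy : ∀ a, |y a| ≤ δ) (a : Fin m) : |(X *ᵥ y) a| ≤ m * (κ * δ) := by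
  rw [Matrix.mulVec, dotProduct]
  refine (Finset.abs_sum_le_sum_abs _ _).trans ?_
  refine (Finset.sum_le_card_nsmul _ _ (κ * δ) fun c _ => ?_).trans (by simp)
  rw [abs_mul]
  exact mul_le_mul (hX _ _) (hy _) (abs_nonneg _) hκ

theorem abs_dotProduct_le {x y : Fin m → ℝ} {α β : ℝ} (hα : 0 ≤ α) (hx : ∀ a, |x a| ≤ α)
    (hy : ∀ a, |y a| ≤ β) : |x ⬝ᵥ y| ≤ m * (α * β) := by
  rw [dotProduct]
  refine (Finset.abs_sum_le_sum_abs _ _).trans ?_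
  refine (Finset.sum_le_card_nsmul _ _ (α * β) fun c _ => ?_).trans (by simp)
  rw [abs_mul]
  exact mul_le_mul (hx _) (hy _) (abs_nonneg _) hα

namespace Element

theorem abs_le_on_carrier (K : Element) {F : ℝ × ℝ → ℝ} (hF : Continuous F) {A : ℝ}
    (h : ∀ x ∈ interior K.carrier, |F x| ≤ A) : ∀ x ∈ K.carrier, |F x| ≤ A := fun x hx => by
  rw [← K.closure_interior_carrier] at hx
  exact closure_minimal (s := interior K.carrier) (t := {x | |F x| ≤ A}) h
    (isClosed_le hF.abs continuous_const) hx

theorem abs_setIntegral_dotProduct_le (K : Element) {F v : ℝ × ℝ → Fin m → ℝ} {α β : ℝ}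
    (hα : 0 ≤ α) (hβ : 0 ≤ β) (hF : ∀ x ∈ K.carrier, ∀ a, |F x a| ≤ α)
    (hv : ∀ x ∈ K.carrier, ∀ a, |v x a| ≤ β) :
    |∫ x in K.carrier, F x ⬝ᵥ v x| ≤ m * (α * β) * K.jac := by
  have h := norm_setIntegral_le_of_norm_le_const (μ := volume) (s := K.carrier)
    (f := fun x => F x ⬝ᵥ v x) (C := m * (α * β)) K.isCompact_carrier.measure_lt_top
    fun x hx => abs_dotProduct_le hα (hF x hx) (hv x hx)
  refine h.trans ?_
  have := K.volume_carrier_le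
  gcongr

theorem numSides_le (K : Element) : K.numSides ≤ 4 := by
  unfold numSides; split_ifs <;> norm_num

end Element

variable (M : PeriodicMesh L₁ L₂)

/-- The numerical flux differs from the flux of the inner trace by a matrix times the jump. -/
theorem abs_outFlux_sub_le {κ δ : ℝ}
    (hκ : ∀ n, len n = 1 → ∀ a b, |normalMatrix B₁ B₂ n a b| ≤ κ ∧ |stabMatrix S lam n a b| ≤ κ)
    (U : M.Broken m) (e : Side M.elem) (x : ℝ × ℝ)
    (hδ : ∀ a, |U (M.nbr e).1 (x - M.shift e) a - U e.1 x a| ≤ δ) (a : Fin m) :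
    |(outFlux M B₁ B₂ S lam U e x - normalMatrix B₁ B₂ e.normal *ᵥ U e.1 x) a|
      ≤ m * (2 * κ * δ) := by
  have hκ0 : 0 ≤ κ := (abs_nonneg _).trans (hκ e.normal e.len_normal a a).1
  have key : ∀ Y : Matrix (Fin m) (Fin m) ℝ, (∀ a b, |Y a b| ≤ κ) →
      outFlux M B₁ B₂ S lam U e x - normalMatrix B₁ B₂ e.normal *ᵥ U e.1 x
        = ((1 / 2 : ℝ) • normalMatrix B₁ B₂ e.normal + Y)
          *ᵥ (U (M.nbr e).1 (x - M.shift e) - U e.1 x) →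
      |(outFlux M B₁ B₂ S lam U e x - normalMatrix B₁ B₂ e.normal *ᵥ U e.1 x) a|
        ≤ m * (2 * κ * δ) := by
    intro Y hY h
    rw [h]
    refine abs_mulVec_le (by positivity) (fun a b => ?_) hδ a
    rw [Matrix.add_apply, Matrix.smul_apply, smul_eq_mul]
    refine (abs_add_le _ _).trans ?_
    rw [abs_mul, abs_of_pos (by norm_num : (0 : ℝ) < 1 / 2)]
    linarith [(hκ e.normal e.len_normal a b).1, hY a b]
  by_cases h : IsMinusNormal e.normal
  · refine key (stabMatrix S lam e.normal) (fun a b => (hκ _ e.len_normal a b).2) ?_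
    rw [outFlux, if_pos h, numFlux_eq]
    simp only [Matrix.add_mulVec, Matrix.sub_mulVec, Matrix.mulVec_sub, Matrix.smul_mulVec]
    module
  · refine key (stabMatrix S lam (-e.normal))
      (fun a b => (hκ _ (by rw [len_neg, e.len_normal]) a b).2) ?_
    rw [outFlux, if_neg h, numFlux_eq, normalMatrix_neg]
    simp only [Matrix.add_mulVec, Matrix.sub_mulVec, Matrix.mulVec_sub, Matrix.smul_mulVec,
      Matrix.neg_mulVec, smul_neg]
    module

/-- The strong form of the discrete spatial operator: integration by parts replaces the flux by its
difference from the flux of the inner trace, which vanishes where there is no jump. -/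
theorem convForm_eq_strong {V : M.Broken m} (hV : ∀ i, ContDiff ℝ 1 (V i)) (i : Fin M.N)
    {v : ℝ × ℝ → Fin m → ℝ} (hv : ContDiff ℝ 1 v) :
    convForm M B₁ B₂ S lam V i v
      = (∫ x in (M.elem i).carrier,
          (B₁ *ᵥ fderiv ℝ (V i) x (1, 0) + B₂ *ᵥ fderiv ℝ (V i) x (0, 1)) ⬝ᵥ v x)
        + ∑ l : Fin (M.elem i).numSides, Side.integral (elem := M.elem) ⟨i, l⟩ (fun x =>
          (outFlux M B₁ B₂ S lam V ⟨i, l⟩ x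
            - normalMatrix B₁ B₂ (Side.normal (elem := M.elem) ⟨i, l⟩) *ᵥ V i x) ⬝ᵥ v x) := by
  have hd : ∀ d : ℝ × ℝ, Continuous fun x => fderiv ℝ (V i) x d := fun d =>
    ((hV i).continuous_fderiv one_ne_zero).clm_apply continuous_const
  have hi : ∀ (B : Matrix (Fin m) (Fin m) ℝ) (d : ℝ × ℝ),
      IntegrableOn (fun x => (B *ᵥ fderiv ℝ (V i) x d) ⬝ᵥ v x) (M.elem i).carrier := fun B d =>
    (M.elem i).integrableOn_carrier
      (continuous_mulVec_dotProduct B (hd d) hv.continuous).continuousOn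
  have hB : ∀ (c : ℝ) (B : Matrix (Fin m) (Fin m) ℝ),
      Continuous fun x => c * ((B *ᵥ V i x) ⬝ᵥ v x) := fun c B =>
    continuous_const.mul (continuous_mulVec_dotProduct B (hV i).continuous hv.continuous)
  have hside : ∀ l : Fin (M.elem i).numSides, Side.integral (elem := M.elem) ⟨i, l⟩ (fun x =>
          (outFlux M B₁ B₂ S lam V ⟨i, l⟩ x
            - normalMatrix B₁ B₂ (Side.normal (elem := M.elem) ⟨i, l⟩) *ᵥ V i x) ⬝ᵥ v x)
      = Side.integral (elem := M.elem) ⟨i, l⟩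
          (fun x => outFlux M B₁ B₂ S lam V ⟨i, l⟩ x ⬝ᵥ v x)
        - ((Side.normal (elem := M.elem) ⟨i, l⟩).1
          * Side.integral (elem := M.elem) ⟨i, l⟩ (fun x => (B₁ *ᵥ V i x) ⬝ᵥ v x)
        + (Side.normal (elem := M.elem) ⟨i, l⟩).2
          * Side.integral (elem := M.elem) ⟨i, l⟩ (fun x => (B₂ *ᵥ V i x) ⬝ᵥ v x)) := by
    intro l
    have hg : Continuous fun x =>
        (Side.normal (elem := M.elem) ⟨i, l⟩).1 * ((B₁ *ᵥ V i x) ⬝ᵥ v x)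
        + (Side.normal (elem := M.elem) ⟨i, l⟩).2 * ((B₂ *ᵥ V i x) ⬝ᵥ v x) :=
      (hB _ _).add (hB _ _)
    rw [← Side.integral_const_mul, ← Side.integral_const_mul,
      ← Side.integral_add _ (hB _ _) (hB _ _),
      ← Side.integral_sub _ ((continuous_outFlux M (fun i => (hV i).continuous) _).dotProduct
        hv.continuous) hg]
    congr 1
    ext x
    simp only [normalMatrix, Matrix.add_mulVec, Matrix.smul_mulVec, sub_dotProduct, add_dotProduct,
      smul_dotProduct, smul_eq_mul]
  rw [convForm, setIntegral_mulVec_fderiv i B₁ (hV i) hv, setIntegral_mulVec_fderiv i B₂ (hV i) hv]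
  simp only [hside, Finset.sum_sub_distrib, Finset.sum_add_distrib, add_dotProduct]
  rw [integral_add (hi _ _) (hi _ _)]
  simp only [one_mul, zero_mul, add_zero, zero_add]
  ring

/-- The properties of the exact solution `u` on the mesh that enter the estimates of the
consistency error; `b i` is the value of the weight on the element `i`. -/
structure IsRegular (n : ℕ) (T R : ℝ) (b : Fin M.N → Fin m → ℝ) (B₁ B₂ : Matrix (Fin m) (Fin m) ℝ)
    (u : ℝ → ℝ × ℝ → Fin m → ℝ) : Prop where
  cont : ∀ t ∈ Ioo 0 T, Continuous (u t)
  periodic : ∀ t ∈ Ioo 0 T, ∀ (e : Side M.elem) x, u t (x - M.shift e) = u t x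
  bound : ∀ i a, DerivBound n R (fun q => u q.1 q.2 a) (Ioo 0 T ×ˢ interior (M.elem i).carrier)
  pde : ∀ t ∈ Ioo 0 T, ∀ i, ∀ x ∈ interior (M.elem i).carrier, ∀ a,
    b i a * pd et (fun q => u q.1 q.2 a) (t, x)
      + ∑ c, B₁ a c * pd ex (fun q => u q.1 q.2 c) (t, x)
      + ∑ c, B₂ a c * pd ey (fun q => u q.1 q.2 c) (t, x) = 0

/-- The geometry of a shape-regular mesh: the area of an element and the diameters of its
neighbours are comparable to its own diameter. -/
structure IsLocallyUniform (γ H : ℝ) : Prop where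
  diam_le : ∀ i, (M.elem i).diam ≤ H
  sq_diam_le : ∀ i, (M.elem i).diam ^ 2 ≤ γ * (M.elem i).jac
  diam_nbr_le : ∀ e : Side M.elem, (M.elem (M.nbr e).1).diam ≤ γ * (M.elem e.1).diam

variable {M} {n : ℕ} {R β κ γ H : ℝ} {b : Fin M.N → Fin m → ℝ} {u : ℝ → ℝ × ℝ → Fin m → ℝ}
  {c : Fin M.N → ℝ × ℝ}

theorem isOpen_timeSlab {K : Element} : IsOpen (Ioo 0 T ×ˢ interior K.carrier) :=
  isOpen_Ioo.prod isOpen_interior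

theorem Element.abs_sub_taylor_le_interior (K : Element) {p : ℝ × ℝ} (hp : p ∈ interior K.carrier)
    {f : STFun} {r : ℕ} (hf : DerivBound r R f (Ioo 0 T ×ˢ interior K.carrier)) {t : ℝ}
    (ht : t ∈ Ioo 0 T) {x : ℝ × ℝ} (hx : x ∈ interior K.carrier) :
    |f (t, x) - taylor r p f t x| ≤ R * (4 * K.diam) ^ r := by
  have h := abs_sub_taylor_le isOpen_Ioo isOpen_interior K.convex_carrier.interior hp
    (r := 2 * K.diam) (by linarith [K.diam_pos])
    (fun y hy => K.norm_sub_le_diam (interior_subset hy) (interior_subset hp)) r hf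
    t ht x hx
  exact h.trans (le_of_eq (by ring))

theorem IsRegular.abs_sub_taylor_le (hu : IsRegular M n T R b B₁ B₂ u)
    (hc : ∀ i, c i ∈ interior (M.elem i).carrier) {r : ℕ} (hr : r ≤ n) {t : ℝ}
    (ht : t ∈ Ioo 0 T) (i : Fin M.N) {x : ℝ × ℝ} (hx : x ∈ (M.elem i).carrier) (a : Fin m) :
    |u t x a - taylor r (c i) (fun q => u q.1 q.2 a) t x| ≤ R * (4 * (M.elem i).diam) ^ r :=
  (M.elem i).abs_le_on_carrier (F := fun x => u t x a
      - taylor r (c i) (fun q => u q.1 q.2 a) t x)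
    (((continuous_pi_iff.1 (hu.cont t ht)) a).sub (continuous_taylor _ _ _ _))
    (fun _ hx => (M.elem i).abs_sub_taylor_le_interior (hc i) ((hu.bound i a).mono hr) ht hx) x hx

/-- The jumps of the Taylor polynomials are small, since `u` is continuous across the edges. -/
theorem IsRegular.abs_jump_taylor_le (hu : IsRegular M n T R b B₁ B₂ u)
    (hM : IsLocallyUniform M γ H) (hR : 0 ≤ R)
    (hc : ∀ i, c i ∈ interior (M.elem i).carrier) {r : ℕ} (hr : r ≤ n) {t : ℝ}
    (ht : t ∈ Ioo 0 T) (e : Side M.elem) {s : ℝ} (hs : s ∈ Icc (0 : ℝ) 1) (a : Fin m) :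
    |taylor r (c (M.nbr e).1) (fun q => u q.1 q.2 a) t (e.pt s - M.shift e)
        - taylor r (c e.1) (fun q => u q.1 q.2 a) t (e.pt s)|
      ≤ R * 4 ^ r * (1 + γ ^ r) * (M.elem e.1).diam ^ r := by
  have h1 := hu.abs_sub_taylor_le hc hr ht e.1 (e.pt_mem_carrier hs) a
  have h2 := hu.abs_sub_taylor_le hc hr ht (M.nbr e).1 (M.pt_sub_shift_mem e hs) a
  rw [hu.periodic t ht] at h2
  have h3 : R * (4 * (M.elem (M.nbr e).1).diam) ^ r
      ≤ R * (4 * (γ * (M.elem e.1).diam)) ^ r := by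
    have := (M.elem (M.nbr e).1).diam_pos.le
    have := hM.diam_nbr_le e
    gcongr
  have h4 : R * 4 ^ r * (1 + γ ^ r) * (M.elem e.1).diam ^ r = R * (4 * (M.elem e.1).diam) ^ r
      + R * (4 * (γ * (M.elem e.1).diam)) ^ r := by
    rw [mul_pow, mul_pow, mul_pow]; ring
  rw [h4]
  rw [abs_le] at h1 h2 ⊢
  constructor <;> linarith [h1.1, h1.2, h2.1, h2.2]

theorem taylor_mem_localSpace (K : Element) {r : ℕ} (hr : r ≤ k + 1) (c : ℝ × ℝ) (f : STFun)
    (t : ℝ) : taylor r c f t ∈ K.localSpace k := by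
  have h : taylor r c f t = ∑ i ∈ Finset.range r, ∑ j ∈ Finset.range (r - i),
      (coef i j f c t / i.factorial / j.factorial) •
        fun x : ℝ × ℝ => (x.1 - c.1) ^ i * (x.2 - c.2) ^ j := by
    ext x
    simp only [taylor, dpow, Finset.sum_apply, Pi.smul_apply, smul_eq_mul]
    refine Finset.sum_congr rfl fun i _ => Finset.sum_congr rfl fun j _ => ?_
    field_simp
  rw [h]
  refine Submodule.sum_mem _ fun i hi => Submodule.sum_mem _ fun j hj => Submodule.smul_mem _ _ ?_
  have := Finset.mem_range.1 hi
  have := Finset.mem_range.1 hj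
  exact K.monomial_mem_localSpace (by omega) c

theorem contDiff_taylor (r : ℕ) (c : ℝ × ℝ) (f : STFun) (t : ℝ) :
    ContDiff ℝ 1 (taylor r c f t) := by
  unfold taylor dpow
  fun_prop

/-- The constant in the estimate of the residual of the Taylor polynomials. -/
def taylorConst (m n : ℕ) (R β κ γ H : ℝ) : ℝ :=
  m * ((β * (4 * H) + m * (2 * κ)) * (R * 4 ^ n))
    + 4 * (m * (m * (2 * κ * (R * 4 ^ (n + 1) * (1 + γ ^ (n + 1)))))) * γ

/-- The residual of the Taylor polynomials of degree `n` is of order `n`: the differential equation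
is satisfied up to order `n`, and the jumps, of order `n + 1`, lose one order because the boundary
of an element is compared with its area. The test function need not lie in the discrete space. -/
theorem IsRegular.abs_schemeForm_taylor_le (hu : IsRegular M (n + 2) T R b B₁ B₂ u)
    (hM : IsLocallyUniform M γ H) (hR : 0 ≤ R) (hγ : 0 ≤ γ) {B₀ : ℝ × ℝ → Fin m → ℝ}
    (hb : ∀ i, ∀ x ∈ interior (M.elem i).carrier, B₀ x = b i) (hb0 : ∀ i a, |b i a| ≤ β)
    (hκ0 : 0 ≤ κ) (hβ0 : 0 ≤ β) (hκ₁ : ∀ a d, |B₁ a d| ≤ κ) (hκ₂ : ∀ a d, |B₂ a d| ≤ κ)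
    (hκ : ∀ n, len n = 1 → ∀ a b, |normalMatrix B₁ B₂ n a b| ≤ κ ∧ |stabMatrix S lam n a b| ≤ κ)
    (hc : ∀ i, c i ∈ interior (M.elem i).carrier) {t : ℝ} (ht : t ∈ Ioo 0 T) (i : Fin M.N)
    {v : ℝ × ℝ → Fin m → ℝ} (hv : ContDiff ℝ 1 v) {w : ℝ} (hw : 0 ≤ w)
    (hvw : ∀ x ∈ (M.elem i).carrier, ∀ a, |v x a| ≤ w) :
    |schemeForm M B₀ B₁ B₂ S lam
        (fun i x a => taylor (n + 1) (c i) (fun q => u q.1 q.2 a) t x)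
        (fun i x a => taylor (n + 1) (c i) (pd et fun q => u q.1 q.2 a) t x) i v|
      ≤ taylorConst m n R β κ γ H * (M.elem i).diam ^ n * (M.elem i).jac * w := by
  set K := M.elem i with hK
  set V : M.Broken m := fun i x a => taylor (n + 1) (c i) (fun q => u q.1 q.2 a) t x with hVdef
  set W : M.Broken m := fun i x a => taylor (n + 1) (c i) (pd et fun q => u q.1 q.2 a) t x
    with hWdef
  have hd0 := K.diam_pos.le
  have hdH : K.diam ≤ H := hM.diam_le i
  have hH : 0 ≤ H := hd0.trans hdH
  have hV1 : ∀ i, ContDiff ℝ 1 (V i) := fun i => contDiff_pi.2 fun a => contDiff_taylor _ _ _ _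
  have hW1 : Continuous (W i) := continuous_pi fun a => continuous_taylor _ _ _ _
  have htc : (t, c i) ∈ Ioo 0 T ×ˢ interior K.carrier := ⟨ht, hc i⟩
  have hO : IsOpen (Ioo 0 T ×ˢ interior K.carrier) := isOpen_timeSlab
  -- the derivatives of the Taylor polynomials
  have hfd : ∀ x (d : ℝ × ℝ) a, fderiv ℝ (V i) x d a
      = taylor n (c i) (pd ex fun q => u q.1 q.2 a) t x * d.1
        + taylor n (c i) (pd ey fun q => u q.1 q.2 a) t x * d.2 := by
    intro x d a
    have h := fun a => hasFDerivAt_taylor (n := n) hO ((hu.bound i a).mono (by omega)) htc x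
    rw [(hasFDerivAt_pi.2 h).fderiv]
    simp
  -- the residual in the interior
  set G : ℝ × ℝ → Fin m → ℝ := fun x =>
    b i * W i x + (B₁ *ᵥ fderiv ℝ (V i) x (1, 0) + B₂ *ᵥ fderiv ℝ (V i) x (0, 1)) with hG
  have hDc : ∀ d : ℝ × ℝ, Continuous fun x => fderiv ℝ (V i) x d := fun d =>
    ((hV1 i).continuous_fderiv one_ne_zero).clm_apply continuous_const
  have hGc : Continuous G :=
    (continuous_const.mul hW1).add ((continuous_const.matrix_mulVec (hDc _)).add
      (continuous_const.matrix_mulVec (hDc _)))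
  have hGb : ∀ x ∈ K.carrier, ∀ a, |G x a|
      ≤ (β * (4 * H) + m * (2 * κ)) * (R * 4 ^ n) * K.diam ^ n := by
    intro x hx a
    refine K.abs_le_on_carrier (F := fun x => G x a) ((continuous_pi_iff.1 hGc) a)
      (fun x hx => ?_) x hx
    have hpde := hu.pde t ht i x hx a
    have e0 : |pd et (fun q => u q.1 q.2 a) (t, x)
        - taylor (n + 1) (c i) (pd et fun q => u q.1 q.2 a) t x| ≤ R * (4 * K.diam) ^ (n + 1) :=
      (M.elem i).abs_sub_taylor_le_interior (hc i) ((hu.bound i a).pd hO norm_et_le) ht hx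
    have e1 : ∀ d, |pd ex (fun q => u q.1 q.2 d) (t, x)
        - taylor n (c i) (pd ex fun q => u q.1 q.2 d) t x| ≤ R * (4 * K.diam) ^ n := fun d =>
      (M.elem i).abs_sub_taylor_le_interior (hc i)
        (((hu.bound i d).mono (by omega : n + 1 ≤ n + 2)).pd hO norm_ex_le) ht hx
    have e2 : ∀ d, |pd ey (fun q => u q.1 q.2 d) (t, x)
        - taylor n (c i) (pd ey fun q => u q.1 q.2 d) t x| ≤ R * (4 * K.diam) ^ n := fun d =>
      (M.elem i).abs_sub_taylor_le_interior (hc i)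
        (((hu.bound i d).mono (by omega : n + 1 ≤ n + 2)).pd hO norm_ey_le) ht hx
    have f1 := abs_mulVec_le hκ0 hκ₁ e1 a
    have f2 := abs_mulVec_le hκ0 hκ₂ e2 a
    have f0 : |b i a * (pd et (fun q => u q.1 q.2 a) (t, x)
        - taylor (n + 1) (c i) (pd et fun q => u q.1 q.2 a) t x)|
        ≤ β * (R * (4 * K.diam) ^ (n + 1)) := by
      rw [abs_mul]; exact mul_le_mul (hb0 i a) e0 (abs_nonneg _) hβ0
    have hGe : G x a = -(b i a * (pd et (fun q => u q.1 q.2 a) (t, x)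
          - taylor (n + 1) (c i) (pd et fun q => u q.1 q.2 a) t x))
        - (B₁ *ᵥ fun d => pd ex (fun q => u q.1 q.2 d) (t, x)
          - taylor n (c i) (pd ex fun q => u q.1 q.2 d) t x) a
        - (B₂ *ᵥ fun d => pd ey (fun q => u q.1 q.2 d) (t, x)
          - taylor n (c i) (pd ey fun q => u q.1 q.2 d) t x) a := by
      simp only [hG, hWdef, Pi.add_apply, Pi.mul_apply, Matrix.mulVec, dotProduct, hfd, mul_sub,
        Finset.sum_sub_distrib, mul_one, mul_zero, add_zero, zero_add]
      linarith
    have f3 : β * (R * (4 * K.diam) ^ (n + 1)) ≤ β * (4 * H) * (R * 4 ^ n) * K.diam ^ n := by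
      have : β * (R * (4 * K.diam) ^ (n + 1)) = β * (4 * K.diam) * (R * 4 ^ n) * K.diam ^ n := by
        rw [mul_pow]; ring
      rw [this]; gcongr
    have f4 : (m : ℝ) * (κ * (R * (4 * K.diam) ^ n)) = m * κ * (R * 4 ^ n) * K.diam ^ n := by
      rw [mul_pow]; ring
    rw [f4] at f1 f2
    rw [hGe]
    rw [abs_le] at f0 f1 f2 ⊢
    constructor <;> linarith [f0.1, f0.2, f1.1, f1.2, f2.1, f2.2]
  have hsch : schemeForm M B₀ B₁ B₂ S lam V W i v = (∫ x in K.carrier, G x ⬝ᵥ v x)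
      + ∑ l : Fin (M.elem i).numSides, Side.integral (elem := M.elem) ⟨i, l⟩ (fun x =>
          (outFlux M B₁ B₂ S lam V ⟨i, l⟩ x
            - normalMatrix B₁ B₂ (Side.normal (elem := M.elem) ⟨i, l⟩) *ᵥ V i x) ⬝ᵥ v x) := by
    rw [schemeForm_eq, setIntegral_weight (hb i), convForm_eq_strong M hV1 i hv, ← add_assoc]
    congr 1
    rw [← integral_add]
    · simp only [hG, add_dotProduct]
      rfl
    · exact K.integrableOn_carrier
        ((continuous_const.mul hW1).dotProduct hv.continuous).continuousOn
    · exact K.integrableOn_carrier (((continuous_const.matrix_mulVec (hDc _)).add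
        (continuous_const.matrix_mulVec (hDc _))).dotProduct hv.continuous).continuousOn
  have hint := K.abs_setIntegral_dotProduct_le (F := G) (v := v) (by positivity) hw hGb hvw
  -- the contribution of the jumps across the edges
  set J := R * 4 ^ (n + 1) * (1 + γ ^ (n + 1)) with hJ
  have hJ0 : 0 ≤ J := by positivity
  have hside : ∀ l : Fin (M.elem i).numSides, |Side.integral (elem := M.elem) ⟨i, l⟩ (fun x =>
          (outFlux M B₁ B₂ S lam V ⟨i, l⟩ x
            - normalMatrix B₁ B₂ (Side.normal (elem := M.elem) ⟨i, l⟩) *ᵥ V i x) ⬝ᵥ v x)|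
      ≤ K.diam * (m * (m * (2 * κ * (J * K.diam ^ (n + 1))) * w)) := by
    intro l
    refine (Side.abs_integral_le _ fun s hs => ?_).trans (mul_le_mul_of_nonneg_right
      ((M.elem i).len_edge_le_diam l.2) (by positivity))
    refine abs_dotProduct_le (by positivity) (fun a => ?_)
      (hvw _ (Side.pt_mem_carrier (elem := M.elem) ⟨i, l⟩ hs))
    exact abs_outFlux_sub_le M hκ V ⟨i, l⟩ _
      (fun a => hu.abs_jump_taylor_le hM hR hc (by omega) ht ⟨i, l⟩ hs a) a
  have hsum : |∑ l : Fin (M.elem i).numSides, Side.integral (elem := M.elem) ⟨i, l⟩ (fun x =>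
          (outFlux M B₁ B₂ S lam V ⟨i, l⟩ x
            - normalMatrix B₁ B₂ (Side.normal (elem := M.elem) ⟨i, l⟩) *ᵥ V i x) ⬝ᵥ v x)|
      ≤ 4 * (K.diam * (m * (m * (2 * κ * (J * K.diam ^ (n + 1))) * w))) := by
    refine (Finset.abs_sum_le_sum_abs _ _).trans
      ((Finset.sum_le_card_nsmul _ _ _ fun l _ => hside l).trans ?_)
    rw [nsmul_eq_mul, Finset.card_univ, Fintype.card_fin]
    have h4 : ((M.elem i).numSides : ℝ) ≤ 4 := by exact_mod_cast (M.elem i).numSides_le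
    exact mul_le_mul_of_nonneg_right h4 (by positivity)
  rw [hsch]
  refine (abs_add_le _ _).trans ((add_le_add hint hsum).trans ?_)
  have hsq : K.diam ^ 2 ≤ γ * K.jac := hM.sq_diam_le i
  calc _ = m * ((β * (4 * H) + m * (2 * κ)) * (R * 4 ^ n)) * K.diam ^ n * K.jac * w
        + 4 * (m * (m * (2 * κ * J))) * K.diam ^ n * w * K.diam ^ 2 := by ring
    _ ≤ m * ((β * (4 * H) + m * (2 * κ)) * (R * 4 ^ n)) * K.diam ^ n * K.jac * w
        + 4 * (m * (m * (2 * κ * J))) * K.diam ^ n * w * (γ * K.jac) := by gcongr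
    _ = _ := by rw [taylorConst]; ring

end Consistency

/-! ### Rectangles with sides parallel to the axes -/

/-- The coordinates of the plane: the first one for `true`, the second one for `false`. -/
def coord (d : Bool) (x : ℝ × ℝ) : ℝ := if d then x.1 else x.2

/-- The unit vectors in the directions of the axes. -/
def unitVec (d : Bool) : ℝ × ℝ := if d then (1, 0) else (0, 1)

theorem coord_sub (d : Bool) (x y : ℝ × ℝ) : coord d (x - y) = coord d x - coord d y := by
  cases d <;> simp [coord]

theorem abs_coord_le_len (d : Bool) (x : ℝ × ℝ) : |coord d x| ≤ len x := by
  cases d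
  · simpa [coord] using abs_snd_le_len x
  · simpa [coord] using abs_fst_le_len x

theorem len_unitVec (d : Bool) : len (unitVec d) = 1 := by cases d <;> simp [unitVec, len]

theorem unitVec_eq_of_eq_or_neg {d d' : Bool}
    (h : unitVec d = unitVec d' ∨ unitVec d = -unitVec d') :
    d = d' := by
  cases d <;> cases d' <;> simp [unitVec] at h ⊢

theorem unitVec_ne_neg (d : Bool) : unitVec d ≠ -unitVec d := by
  cases d <;> simp only [unitVec, ne_eq, Prod.ext_iff, Prod.fst_neg, Prod.snd_neg] <;> norm_num

namespace Element

/-- A rectangle with sides parallel to the axes. -/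
def IsAxisParallel (K : Element) : Prop := K.isRect = true ∧ (K.v.1 = 0 ∨ K.v.2 = 0)

/-- The least value of a coordinate on an axis-parallel rectangle. -/
def lo (K : Element) (d : Bool) : ℝ := coord d K.a + min (coord d K.v) 0 + min (coord d K.w) 0

/-- The width of an axis-parallel rectangle in the direction of a coordinate. -/
def wd (K : Element) (d : Bool) : ℝ := |coord d K.v| + |coord d K.w|

theorem IsAxisParallel.cases {K : Element} (h : K.IsAxisParallel) :
    (K.v.2 = 0 ∧ K.w.1 = 0 ∧ ((0 < K.v.1 ∧ 0 < K.w.2) ∨ (K.v.1 < 0 ∧ K.w.2 < 0))) ∨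
      (K.v.1 = 0 ∧ K.w.2 = 0 ∧ ((0 < K.v.2 ∧ K.w.1 < 0) ∨ (K.v.2 < 0 ∧ 0 < K.w.1))) := by
  have ho := K.ortho h.1
  have hd := K.det_pos
  rcases h.2 with h1 | h1
  · right
    rw [h1] at ho hd
    have hv : K.v.2 ≠ 0 := fun h0 => by simp [h0] at hd
    have hw : K.w.2 = 0 := by simpa [hv] using ho
    refine ⟨h1, hw, ?_⟩
    rcases lt_or_gt_of_ne hv with h2 | h2
    · exact Or.inr ⟨h2, by nlinarith⟩
    · exact Or.inl ⟨h2, by nlinarith⟩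
  · left
    rw [h1] at ho hd
    have hv : K.v.1 ≠ 0 := fun h0 => by simp [h0] at hd
    have hw : K.w.1 = 0 := by simpa [hv] using ho
    refine ⟨h1, hw, ?_⟩
    rcases lt_or_gt_of_ne hv with h2 | h2
    · exact Or.inr ⟨h2, by nlinarith⟩
    · exact Or.inl ⟨h2, by nlinarith⟩

theorem IsAxisParallel.wd_pos {K : Element} (h : K.IsAxisParallel) (d : Bool) : 0 < K.wd d := by
  rcases h.cases with ⟨h1, h2, (⟨h3, h4⟩ | ⟨h3, h4⟩)⟩ | ⟨h1, h2, (⟨h3, h4⟩ | ⟨h3, h4⟩)⟩ <;>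
    cases d <;> simp [wd, coord, h1, h2, h3.ne, h4.ne, h3.ne', h4.ne']

theorem wd_le_diam (K : Element) (d : Bool) : K.wd d ≤ 2 * K.diam := by
  rw [wd, two_mul]
  exact add_le_add ((abs_coord_le_len _ _).trans K.len_v_le_diam)
    ((abs_coord_le_len _ _).trans K.len_w_le_diam)

theorem IsAxisParallel.carrier_eq {K : Element} (h : K.IsAxisParallel) :
    K.carrier = Icc (K.lo true) (K.lo true + K.wd true)
      ×ˢ Icc (K.lo false) (K.lo false + K.wd false) := by
  have hr : K.refCell = Icc 0 1 ×ˢ Icc 0 1 := by simp [refCell, h.1]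
  -- the interval swept by one side
  have key : ∀ a v x : ℝ, v ≠ 0 →
      ((∃ p : ℝ, (0 ≤ p ∧ p ≤ 1) ∧ a + p * v = x) ↔ a + min v 0 ≤ x ∧ x ≤ a + min v 0 + |v|) := by
    intro a v x hv
    constructor
    · rintro ⟨p, ⟨h0, h1⟩, rfl⟩
      rcases lt_or_gt_of_ne hv with h2 | h2
      · rw [min_eq_left h2.le, abs_of_neg h2]; constructor <;> nlinarith
      · rw [min_eq_right h2.le, abs_of_pos h2]; constructor <;> nlinarith
    · rintro ⟨h0, h1⟩
      refine ⟨(x - a) / v, ?_, by field_simp; ring⟩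
      rcases lt_or_gt_of_ne hv with h2 | h2
      · rw [min_eq_left h2.le] at h0 h1
        rw [abs_of_neg h2] at h1
        exact ⟨div_nonneg_of_nonpos (by linarith) h2.le, (div_le_one_of_neg h2).2 (by linarith)⟩
      · rw [min_eq_right h2.le] at h0 h1
        rw [abs_of_pos h2] at h1
        exact ⟨div_nonneg (by linarith) h2.le, (div_le_one h2).2 (by linarith)⟩
  ext x
  simp only [carrier, mem_image, hr, mem_prod, mem_Icc, Prod.exists, map, Prod.ext_iff,
    Prod.fst_add,
    Prod.snd_add, Prod.smul_fst, Prod.smul_snd, smul_eq_mul, lo, wd, coord, if_true]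
  have hne : (K.v.2 = 0 ∧ K.w.1 = 0 ∧ K.v.1 ≠ 0 ∧ K.w.2 ≠ 0) ∨
      (K.v.1 = 0 ∧ K.w.2 = 0 ∧ K.v.2 ≠ 0 ∧ K.w.1 ≠ 0) := by
    rcases h.cases with ⟨h1, h2, (⟨h3, h4⟩ | ⟨h3, h4⟩)⟩ | ⟨h1, h2, (⟨h3, h4⟩ | ⟨h3, h4⟩)⟩
    · exact Or.inl ⟨h1, h2, h3.ne', h4.ne'⟩
    · exact Or.inl ⟨h1, h2, h3.ne, h4.ne⟩
    · exact Or.inr ⟨h1, h2, h3.ne', h4.ne⟩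
    · exact Or.inr ⟨h1, h2, h3.ne, h4.ne'⟩
  rcases hne with ⟨h1, h2, h3, h4⟩ | ⟨h1, h2, h3, h4⟩
  · have k1 := key K.a.1 K.v.1 x.1 h3
    have k2 := key K.a.2 K.w.2 x.2 h4
    simp only [h1, h2, mul_zero, add_zero, min_self, abs_zero, zero_add, Bool.false_eq_true,
      if_false]
    rw [← k1, ← k2]
    constructor
    · rintro ⟨p, q, ⟨hp, hq⟩, e1, e2⟩
      exact ⟨⟨p, hp, e1⟩, ⟨q, hq, e2⟩⟩
    · rintro ⟨⟨p, hp, e1⟩, ⟨q, hq, e2⟩⟩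
      exact ⟨p, q, ⟨hp, hq⟩, e1, e2⟩
  · have k1 := key K.a.1 K.w.1 x.1 h4
    have k2 := key K.a.2 K.v.2 x.2 h3
    simp only [h1, h2, mul_zero, add_zero, min_self, abs_zero, zero_add, Bool.false_eq_true,
      if_false]
    rw [← k1, ← k2]
    constructor
    · rintro ⟨p, q, ⟨hp, hq⟩, e1, e2⟩
      exact ⟨⟨q, hq, e1⟩, ⟨p, hp, e2⟩⟩
    · rintro ⟨⟨q, hq, e1⟩, ⟨p, hp, e2⟩⟩
      exact ⟨p, q, ⟨hp, hq⟩, e1, e2⟩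

theorem IsAxisParallel.coord_mem {K : Element} (h : K.IsAxisParallel) {x : ℝ × ℝ}
    (hx : x ∈ K.carrier) (d : Bool) : coord d x ∈ Icc (K.lo d) (K.lo d + K.wd d) := by
  rw [h.carrier_eq] at hx
  cases d
  · exact hx.2
  · exact hx.1

end Element

namespace Side

variable {N : ℕ} {elem : Fin N → Element}

theorem normal_eq_of_vertical (e : Side elem) (h : (e.finish - e.start).1 = 0) :
    (0 < (e.finish - e.start).2 → e.normal = (1, 0)) ∧
      ((e.finish - e.start).2 < 0 → e.normal = (-1, 0)) := by
  have hl : len (e.finish - e.start) = |(e.finish - e.start).2| := by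
    rw [len, h, zero_pow two_ne_zero, zero_add, Real.sqrt_sq_eq_abs]
  constructor <;> intro h2 <;> rw [normal, hl, h]
  · rw [abs_of_pos h2]
    simp only [Prod.smul_mk, smul_eq_mul, neg_zero, mul_zero]
    rw [inv_mul_cancel₀ h2.ne']
  · rw [abs_of_neg h2]
    simp only [Prod.smul_mk, smul_eq_mul, neg_zero, mul_zero, inv_neg, neg_mul]
    rw [inv_mul_cancel₀ h2.ne]

theorem normal_eq_of_horizontal (e : Side elem) (h : (e.finish - e.start).2 = 0) :
    (0 < (e.finish - e.start).1 → e.normal = (0, -1)) ∧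
      ((e.finish - e.start).1 < 0 → e.normal = (0, 1)) := by
  have hl : len (e.finish - e.start) = |(e.finish - e.start).1| := by
    rw [len, h, zero_pow two_ne_zero, add_zero, Real.sqrt_sq_eq_abs]
  constructor <;> intro h2 <;> rw [normal, hl, h]
  · rw [abs_of_pos h2]
    simp only [Prod.smul_mk, smul_eq_mul, mul_zero, mul_neg]
    rw [inv_mul_cancel₀ h2.ne']
  · rw [abs_of_neg h2]
    simp only [Prod.smul_mk, smul_eq_mul, mul_zero, mul_neg, inv_neg, neg_mul, neg_neg]
    rw [inv_mul_cancel₀ h2.ne]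

/-- A side orthogonal to the direction `d` on which the coordinate of this direction is greatest
(outward normal `unitVec d`) or least (outward normal `-unitVec d`). The other coordinate is an
affine parameter on the side. -/
structure IsOrtho (e : Side elem) (d : Bool) : Prop where
  normal : (e.normal = unitVec d ∧ ∀ s, coord d (e.pt s) = (elem e.1).lo d + (elem e.1).wd d) ∨
    (e.normal = -unitVec d ∧ ∀ s, coord d (e.pt s) = (elem e.1).lo d)
  param : (∀ s, coord (!d) (e.pt s) = (elem e.1).lo (!d) + (elem e.1).wd (!d) * s) ∨
    (∀ s, coord (!d) (e.pt s) = (elem e.1).lo (!d) + (elem e.1).wd (!d) * (1 - s))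

/-- An element side from one corner of an axis-parallel rectangle counterclockwise to the next. -/
theorem isOrtho_of_corners (e : Side elem) (h : (elem e.1).IsAxisParallel) {x y w z : ℝ}
    (hx : (elem e.1).lo true = x) (hy : (elem e.1).lo false = y) (hw : (elem e.1).wd true = w)
    (hz : (elem e.1).wd false = z)
    (hc : (e.start = (x + w, y) ∧ e.finish = (x + w, y + z)) ∨
      (e.start = (x, y + z) ∧ e.finish = (x, y)) ∨
      (e.start = (x + w, y + z) ∧ e.finish = (x, y + z)) ∨
      (e.start = (x, y) ∧ e.finish = (x + w, y))) : ∃ d, e.IsOrtho d := by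
  have hw0 : 0 < w := hw ▸ h.wd_pos true
  have hz0 : 0 < z := hz ▸ h.wd_pos false
  rcases hc with ⟨h1, h2⟩ | ⟨h1, h2⟩ | ⟨h1, h2⟩ | ⟨h1, h2⟩
  · have hn := (e.normal_eq_of_vertical (by simp [h1, h2])).1 (by simp [h1, h2, hz0])
    refine ⟨true, Or.inl ⟨by simpa [unitVec] using hn, fun s => ?_⟩, Or.inl fun s => ?_⟩
    · simp [pt, h1, h2, coord, hx, hw]
    · simp [pt, h1, h2, coord, hy, hz, mul_comm]
  · have hn := (e.normal_eq_of_vertical (by simp [h1, h2])).2 (by simp [h1, h2, hz0])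
    refine ⟨true, Or.inr ⟨by simpa [unitVec] using hn, fun s => ?_⟩, Or.inr fun s => ?_⟩
    · simp [pt, h1, h2, coord, hx]
    · simp only [pt, h1, h2, coord, hy, hz, Bool.not_true, Bool.false_eq_true, if_false,
        Prod.snd_add, Prod.smul_snd, Prod.snd_sub, smul_eq_mul]
      ring
  · have hn := (e.normal_eq_of_horizontal (by simp [h1, h2])).2 (by simp [h1, h2, hw0])
    refine ⟨false, Or.inl ⟨by simpa [unitVec] using hn, fun s => ?_⟩, Or.inr fun s => ?_⟩
    · simp [pt, h1, h2, coord, hy, hz]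
    · simp only [pt, h1, h2, coord, hx, hw, Bool.not_false, if_true,
        Prod.fst_add, Prod.smul_fst, Prod.fst_sub, smul_eq_mul]
      ring
  · have hn := (e.normal_eq_of_horizontal (by simp [h1, h2])).1 (by simp [h1, h2, hw0])
    refine ⟨false, Or.inr ⟨by simpa [unitVec] using hn, fun s => ?_⟩, Or.inl fun s => ?_⟩
    · simp [pt, h1, h2, coord, hy]
    · simp [pt, h1, h2, coord, hx, hw, mul_comm]

theorem exists_isOrtho (e : Side elem) (h : (elem e.1).IsAxisParallel) : ∃ d, e.IsOrtho d := by
  obtain ⟨i, l, hl⟩ := e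
  simp only at h
  have hl4 : l < 4 := by simpa [Element.numSides, h.1] using hl
  have key := isOrtho_of_corners (elem := elem) ⟨i, l, hl⟩ h rfl rfl rfl rfl
  have hs : Side.start (elem := elem) ⟨i, l, hl⟩ = (elem i).vert l := rfl
  have hf : Side.finish (elem := elem) ⟨i, l, hl⟩ = (elem i).vert (l + 1) := rfl
  rw [hs, hf] at key
  simp only [Element.lo, Element.wd, coord, if_true, Bool.false_eq_true, if_false] at key
  rcases h.cases with ⟨h1, h2, (⟨h3, h4⟩ | ⟨h3, h4⟩)⟩ | ⟨h1, h2, (⟨h3, h4⟩ | ⟨h3, h4⟩)⟩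
  · refine key ?_
    rw [h1, h2, min_self, abs_zero, min_eq_right h3.le, min_eq_right h4.le, abs_of_pos h3,
      abs_of_pos h4]
    interval_cases l <;> simp [Element.vert, h.1, h1, h2, Prod.ext_iff, h3.ne', h4.ne']
  · refine key ?_
    rw [h1, h2, min_self, abs_zero, min_eq_left h3.le, min_eq_left h4.le, abs_of_neg h3,
      abs_of_neg h4]
    interval_cases l <;> simp [Element.vert, h.1, h1, h2, Prod.ext_iff, h3.ne, h4.ne]
  · refine key ?_
    rw [h1, h2, min_self, abs_zero, min_eq_right h3.le, min_eq_left h4.le, abs_of_pos h3,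
      abs_of_neg h4]
    interval_cases l <;> simp [Element.vert, h.1, h1, h2, Prod.ext_iff, h3.ne', h4.ne]
  · refine key ?_
    rw [h1, h2, min_self, abs_zero, min_eq_left h3.le, min_eq_right h4.le, abs_of_neg h3,
      abs_of_pos h4]
    interval_cases l <;> simp [Element.vert, h.1, h1, h2, Prod.ext_iff, h3.ne, h4.ne']

end Side

namespace PeriodicMesh

variable {L₁ L₂ : ℝ} {M : PeriodicMesh L₁ L₂} {e : Side M.elem} {d : Bool}

theorem isOrtho_nbr (hM : ∀ i, (M.elem i).IsAxisParallel) (h : e.IsOrtho d) :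
    (M.nbr e).IsOrtho d := by
  obtain ⟨d', h'⟩ := (M.nbr e).exists_isOrtho (hM _)
  have : d' = d := by
    refine unitVec_eq_of_eq_or_neg ?_
    rcases h.normal with ⟨h1, -⟩ | ⟨h1, -⟩ <;> rcases h'.normal with ⟨h2, -⟩ | ⟨h2, -⟩ <;>
      rw [M.normal_nbr, h1] at h2
    · exact Or.inr h2.symm
    · exact Or.inl (neg_injective h2).symm
    · exact Or.inl (by rw [← h2, neg_neg])
    · exact Or.inr (neg_injective h2).symm
  rwa [this] at h'

/-- Neighbouring elements have the same extent along their common edge. -/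
theorem wd_nbr_eq (hM : ∀ i, (M.elem i).IsAxisParallel) (h : e.IsOrtho d) :
    (M.elem (M.nbr e).1).wd (!d) = (M.elem e.1).wd (!d) ∧
      (M.elem (M.nbr e).1).lo (!d) = (M.elem e.1).lo (!d) - coord (!d) (M.shift e) := by
  have h' := isOrtho_nbr hM h
  have p0 := congrArg (coord (!d)) (M.pt_sub_shift e 0)
  have p1 := congrArg (coord (!d)) (M.pt_sub_shift e 1)
  rw [coord_sub] at p0 p1
  have w := (hM e.1).wd_pos (!d)
  have w' := (hM (M.nbr e).1).wd_pos (!d)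
  rcases h.param with h1 | h1 <;> rcases h'.param with h2 | h2 <;> rw [h1, h2] at p0 p1 <;>
    constructor <;> linarith

theorem coord_sub_shift (hM : ∀ i, (M.elem i).IsAxisParallel) (h : e.IsOrtho d) (s : ℝ) :
    (e.normal = unitVec d → coord d (e.pt s - M.shift e) = (M.elem (M.nbr e).1).lo d) ∧
      (e.normal = -unitVec d → coord d (e.pt s - M.shift e)
        = (M.elem (M.nbr e).1).lo d + (M.elem (M.nbr e).1).wd d) := by
  have h' := isOrtho_nbr hM h
  rw [M.pt_sub_shift]
  constructor <;> intro h0 <;> rcases h'.normal with ⟨h1, h2⟩ | ⟨h1, h2⟩ <;>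
    rw [M.normal_nbr, h0] at h1
  · exact absurd h1.symm (unitVec_ne_neg d)
  · exact h2 _
  · exact h2 _
  · rw [neg_neg] at h1
    exact absurd h1 (unitVec_ne_neg d)

end PeriodicMesh

/-! ### Local spaces and orthogonality on axis-parallel rectangles -/

section AxisParallel

variable {k : ℕ}

/-- Affine substitutions that act on the two coordinates separately preserve `Q^k`. -/
theorem comp_mem_polyQ {f : ℝ × ℝ → ℝ} (hf : f ∈ polyQ k) {g : ℝ × ℝ → ℝ × ℝ}
    {p q : Polynomial ℝ} (hp : p.natDegree ≤ 1) (hq : q.natDegree ≤ 1)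
    (hg : (∀ x, g x = (p.eval x.1, q.eval x.2)) ∨ (∀ x, g x = (p.eval x.2, q.eval x.1))) :
    (fun x => f (g x)) ∈ polyQ k := by
  have h : f ∈ (polyQ k).comap (LinearMap.funLeft ℝ ℝ g) := by
    refine Submodule.span_le.2 ?_ hf
    rintro _ ⟨i, j, hi, hj, rfl⟩
    rw [SetLike.mem_coe, Submodule.mem_comap]
    have hpi : (p ^ i).natDegree ≤ k :=
      Polynomial.natDegree_pow_le.trans (by nlinarith)
    have hqj : (q ^ j).natDegree ≤ k :=
      Polynomial.natDegree_pow_le.trans (by nlinarith)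
    rcases hg with hg | hg
    · convert eval_mul_eval_mem_polyQ hpi hqj using 1
      ext x; simp [LinearMap.funLeft_apply, hg]
    · convert eval_mul_eval_mem_polyQ hqj hpi using 1
      ext x; simp [LinearMap.funLeft_apply, hg, mul_comm]
  exact h

theorem natDegree_affine_le (α β : ℝ) :
    (Polynomial.C α + Polynomial.C β * Polynomial.X : Polynomial ℝ).natDegree ≤ 1 := by
  compute_degree

theorem Element.IsAxisParallel.mem_localSpace_iff {K : Element} (h : K.IsAxisParallel)
    {f : ℝ × ℝ → ℝ} : f ∈ K.localSpace k ↔ f ∈ polyQ k := by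
  have h0 : f ∈ K.localSpace k ↔ (fun p => f (K.map p)) ∈ polyQ k := by
    unfold Element.localSpace
    rw [if_pos h.1, Submodule.mem_comap]
    rfl
  have hz : (K.v.2 = 0 ∧ K.w.1 = 0) ∨ (K.v.1 = 0 ∧ K.w.2 = 0) := by
    rcases h.cases with ⟨h1, h2, -⟩ | ⟨h1, h2, -⟩
    · exact Or.inl ⟨h1, h2⟩
    · exact Or.inr ⟨h1, h2⟩
  have hmap : ∀ f ∈ polyQ k, (fun p => f (K.map p)) ∈ polyQ k := fun f hf => by
    rcases hz with ⟨h1, h2⟩ | ⟨h1, h2⟩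
    · refine comp_mem_polyQ hf (natDegree_affine_le K.a.1 K.v.1) (natDegree_affine_le K.a.2 K.w.2)
        (Or.inl fun x => ?_)
      ext <;> simp [Element.map, h1, h2] <;> ring
    · refine comp_mem_polyQ hf (natDegree_affine_le K.a.1 K.w.1) (natDegree_affine_le K.a.2 K.v.2)
        (Or.inr fun x => ?_)
      ext <;> simp [Element.map, h1, h2] <;> ring
  have hinv : ∀ f ∈ polyQ k, (fun p => f (K.inv p)) ∈ polyQ k := fun f hf => by
    rcases hz with ⟨h1, h2⟩ | ⟨h1, h2⟩
    · refine comp_mem_polyQ hf (natDegree_affine_le (-(K.w.2 * K.a.1) / K.jac) (K.w.2 / K.jac))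
        (natDegree_affine_le (-(K.v.1 * K.a.2) / K.jac) (K.v.1 / K.jac)) (Or.inl fun x => ?_)
      ext <;> simp [Element.inv, h1, h2] <;> ring
    · refine comp_mem_polyQ hf (natDegree_affine_le (K.w.1 * K.a.2 / K.jac) (-K.w.1 / K.jac))
        (natDegree_affine_le (K.v.2 * K.a.1 / K.jac) (-K.v.2 / K.jac)) (Or.inr fun x => ?_)
      ext <;> simp [Element.inv, h1, h2] <;> ring
  rw [h0]
  refine ⟨fun hf => ?_, hmap f⟩
  have := hinv _ hf
  simpa [Element.map_inv] using this

theorem integral_mul_eval_eq_zero {R : ℝ → ℝ} (hR : Continuous R)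
    (ho : ∀ i < k, ∫ x in (0 : ℝ)..1, R x * x ^ i = 0) {p : Polynomial ℝ} (hp : p.natDegree < k) :
    ∫ x in (0 : ℝ)..1, R x * p.eval x = 0 := by
  have h : ∀ x, R x * p.eval x = ∑ i ∈ Finset.range k, p.coeff i * (R x * x ^ i) := fun x => by
    rw [Polynomial.eval_eq_sum_range' hp, Finset.mul_sum]
    exact Finset.sum_congr rfl fun i _ => by ring
  simp only [h]
  rw [intervalIntegral.integral_finsetSum fun i _ =>
    (by fun_prop : Continuous fun x => p.coeff i * (R x * x ^ i)).intervalIntegrable _ _]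
  refine Finset.sum_eq_zero fun i hi => ?_
  rw [intervalIntegral.integral_const_mul, ho i (Finset.mem_range.1 hi), mul_zero]

/-- The orthogonality of `R` on the unit interval, transplanted to an interval. -/
theorem setIntegral_Icc_mul_deriv_pow {R : ℝ → ℝ} (hR : Continuous R)
    (ho : ∀ i < k, ∫ x in (0 : ℝ)..1, R x * x ^ i = 0) {a w : ℝ} (hw : 0 < w) {i : ℕ} (hi : i ≤ k) :
    ∫ x in Icc a (a + w), R ((x - a) / w) * (i * x ^ (i - 1)) = 0 := by
  rcases Nat.eq_zero_or_pos i with rfl | hi0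
  · simp
  have h1 := intervalIntegral.integral_comp_mul_add (a := 0) (b := 1)
    (fun x => R ((x - a) / w) * (i * x ^ (i - 1))) hw.ne' a
  have h2 : ∀ x : ℝ, R ((w * x + a - a) / w) * (i * (w * x + a) ^ (i - 1))
      = i * (R x * ((Polynomial.C a + Polynomial.C w * Polynomial.X) ^ (i - 1)).eval x) := by
    intro x
    rw [add_sub_cancel_right, mul_div_cancel_left₀ _ hw.ne']
    simp only [Polynomial.eval_pow, Polynomial.eval_add, Polynomial.eval_mul, Polynomial.eval_C,
      Polynomial.eval_X]
    rw [add_comm a]; ring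
  simp only [h2] at h1
  have hdeg : ((Polynomial.C a + Polynomial.C w * Polynomial.X) ^ (i - 1)
      : Polynomial ℝ).natDegree < k := by
    refine (Polynomial.natDegree_pow_le).trans_lt ?_
    have := natDegree_affine_le a w
    calc _ ≤ (i - 1) * 1 := Nat.mul_le_mul_left _ this
      _ < k := by omega
  rw [intervalIntegral.integral_const_mul, integral_mul_eval_eq_zero hR ho hdeg, mul_zero,
    eq_comm, smul_eq_mul, mul_eq_zero, or_iff_right (inv_ne_zero hw.ne'), mul_zero, zero_add,
    mul_one, add_comm w] at h1
  rw [integral_Icc_eq_integral_Ioc, ← intervalIntegral.integral_of_le (by linarith), h1]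

/-- A function of the coordinate `d` that is orthogonal to polynomials of degree less than `k` is
orthogonal to the derivatives of functions in `Q^k` in the direction `d`. -/
theorem Element.IsAxisParallel.setIntegral_mul_fderiv_eq_zero {K : Element}
    (h : K.IsAxisParallel) (d : Bool) {R : ℝ → ℝ} (hR : Continuous R)
    (ho : ∀ i < k, ∫ x in (0 : ℝ)..1, R x * x ^ i = 0) {f : ℝ × ℝ → ℝ} (hf : f ∈ polyQ k) :
    ∫ x in K.carrier, R ((coord d x - K.lo d) / K.wd d) * fderiv ℝ f x (unitVec d) = 0 := by
  have hc : Continuous fun x => R ((coord d x - K.lo d) / K.wd d) := by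
    cases d <;> simp only [coord, if_true, Bool.false_eq_true, if_false] <;> fun_prop
  have hi : ∀ g : ℝ × ℝ → ℝ, ContDiff ℝ 1 g →
      IntegrableOn (fun x => R ((coord d x - K.lo d) / K.wd d) * fderiv ℝ g x (unitVec d))
        K.carrier := fun g hg => K.integrableOn_carrier
    (hc.mul ((hg.continuous_fderiv one_ne_zero).clm_apply continuous_const)).continuousOn
  suffices H : ContDiff ℝ 1 f ∧
      ∫ x in K.carrier, R ((coord d x - K.lo d) / K.wd d) * fderiv ℝ f x (unitVec d) = 0 from H.2
  refine Submodule.span_induction (p := fun f _ => ContDiff ℝ 1 f ∧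
      ∫ x in K.carrier, R ((coord d x - K.lo d) / K.wd d) * fderiv ℝ f x (unitVec d) = 0)
    ?_ ?_ ?_ ?_ hf
  · rintro _ ⟨i, j, hik, hjk, rfl⟩
    refine ⟨by fun_prop, ?_⟩
    have hfd : ∀ x : ℝ × ℝ, fderiv ℝ (fun p : ℝ × ℝ => p.1 ^ i * p.2 ^ j) x
        = (i * x.1 ^ (i - 1) * x.2 ^ j) • ContinuousLinearMap.fst ℝ ℝ ℝ
          + (x.1 ^ i * (j * x.2 ^ (j - 1))) • ContinuousLinearMap.snd ℝ ℝ ℝ := fun x => by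
      have h1 := (hasDerivAt_pow i x.1).comp_hasFDerivAt x
        (ContinuousLinearMap.fst ℝ ℝ ℝ).hasFDerivAt
      have h2 := (hasDerivAt_pow j x.2).comp_hasFDerivAt x
        (ContinuousLinearMap.snd ℝ ℝ ℝ).hasFDerivAt
      refine (h1.mul h2).fderiv.trans ?_
      simp only [Function.comp]
      ext <;> simp <;> ring
    rw [h.carrier_eq, Measure.volume_eq_prod]
    cases d
    · simp only [hfd, coord, unitVec, Bool.false_eq_true, if_false]
      have e : ∀ x : ℝ × ℝ, R ((x.2 - K.lo false) / K.wd false)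
          * (((i * x.1 ^ (i - 1) * x.2 ^ j) • ContinuousLinearMap.fst ℝ ℝ ℝ
          + (x.1 ^ i * (j * x.2 ^ (j - 1))) • ContinuousLinearMap.snd ℝ ℝ ℝ) (0, 1))
          = x.1 ^ i * (R ((x.2 - K.lo false) / K.wd false) * (j * x.2 ^ (j - 1))) := fun x => by
        simp; ring
      simp only [e]
      rw [setIntegral_prod_mul (fun x : ℝ => x ^ i)
        (fun y : ℝ => R ((y - K.lo false) / K.wd false) * (j * y ^ (j - 1))),
        setIntegral_Icc_mul_deriv_pow hR ho (h.wd_pos false) hjk, mul_zero]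
    · simp only [hfd, coord, unitVec, if_true]
      have e : ∀ x : ℝ × ℝ, R ((x.1 - K.lo true) / K.wd true)
          * (((i * x.1 ^ (i - 1) * x.2 ^ j) • ContinuousLinearMap.fst ℝ ℝ ℝ
          + (x.1 ^ i * (j * x.2 ^ (j - 1))) • ContinuousLinearMap.snd ℝ ℝ ℝ) (1, 0))
          = (R ((x.1 - K.lo true) / K.wd true) * (i * x.1 ^ (i - 1))) * x.2 ^ j := fun x => by
        simp; ring
      simp only [e]
      rw [setIntegral_prod_mul
        (fun x : ℝ => R ((x - K.lo true) / K.wd true) * (i * x ^ (i - 1))) (fun y : ℝ => y ^ j),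
        setIntegral_Icc_mul_deriv_pow hR ho (h.wd_pos true) hik, zero_mul]
  · refine ⟨contDiff_const, ?_⟩
    have : ∀ x, fderiv ℝ (0 : ℝ × ℝ → ℝ) x = 0 := fun x => by
      rw [show (0 : ℝ × ℝ → ℝ) = fun _ => 0 from rfl]; exact congrFun (fderiv_fun_const 0) x
    simp [this]
  · rintro f g - - ⟨hf1, hf2⟩ ⟨hg1, hg2⟩
    refine ⟨hf1.add hg1, ?_⟩
    have e : ∀ x, fderiv ℝ (f + g) x = fderiv ℝ f x + fderiv ℝ g x := fun x =>
      fderiv_add (hf1.differentiable one_ne_zero x) (hg1.differentiable one_ne_zero x)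
    simp only [e, _root_.add_apply, mul_add]
    rw [integral_add (hi f hf1) (hi g hg1), hf2, hg2, add_zero]
  · rintro r f - ⟨hf1, hf2⟩
    refine ⟨contDiff_const.smul hf1, ?_⟩
    have e : ∀ x, fderiv ℝ (r • f) x = r • fderiv ℝ f x := fun x =>
      fderiv_const_smul (hf1.differentiable one_ne_zero x) r
    simp only [e, _root_.smul_apply, smul_eq_mul, mul_left_comm _ r]
    rw [integral_const_mul, hf2, mul_zero]

end AxisParallel

/-! ### The correction of the Taylor polynomial by Radau polynomials -/

section Correction

variable {m k : ℕ} {L₁ L₂ : ℝ} {B₁ B₂ : Matrix (Fin m) (Fin m) ℝ}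
  {S : ℝ × ℝ → Matrix (Fin m) (Fin m) ℝ} {lam : ℝ × ℝ → Fin m → ℝ}

/-- Monic polynomials of degree `k + 1` on the unit interval, orthogonal to polynomials of degree
less than `k`, one of which vanishes at the left and one at the right end point, and for each
coordinate direction a splitting of the identity into matrices that are annihilated by the two
matrices of the alternating flux. -/
structure RadauSplitting (k : ℕ) (B₁ B₂ : Matrix (Fin m) (Fin m) ℝ)
    (S : ℝ × ℝ → Matrix (Fin m) (Fin m) ℝ) (lam : ℝ × ℝ → Fin m → ℝ) where
  left : Polynomial ℝ
  right : Polynomial ℝ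
  left_monic : left.Monic
  right_monic : right.Monic
  natDegree_left : left.natDegree = k + 1
  natDegree_right : right.natDegree = k + 1
  eval_left : left.eval 0 = 0
  eval_right : right.eval 1 = 0
  left_ortho : ∀ i < k, ∫ x in (0 : ℝ)..1, left.eval x * x ^ i = 0
  right_ortho : ∀ i < k, ∫ x in (0 : ℝ)..1, right.eval x * x ^ i = 0
  P : Bool → Matrix (Fin m) (Fin m) ℝ
  Q : Bool → Matrix (Fin m) (Fin m) ℝ
  add : ∀ d, P d + Q d = 1
  plus : ∀ d,
    ((1 / 2 : ℝ) • normalMatrix B₁ B₂ (unitVec d) + stabMatrix S lam (unitVec d)) * Q d = 0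
  minus : ∀ d,
    ((1 / 2 : ℝ) • normalMatrix B₁ B₂ (unitVec d) - stabMatrix S lam (unitVec d)) * P d = 0

theorem nonempty_radauSplitting (k : ℕ) (hd : IsPairedDecomposition B₁ B₂ S lam) :
    Nonempty (RadauSplitting k B₁ B₂ S lam) := by
  obtain ⟨R, hR1, hR2, hR3, hR4⟩ := exists_radau_left k
  obtain ⟨R', hR1', hR2', hR3', hR4'⟩ := exists_radau_right k
  choose P Q h1 h2 h3 using fun d => exists_alternating_splitting hd (len_unitVec d)
  exact ⟨⟨R, R', hR1, hR1', hR2, hR2', hR3, hR3', hR4, hR4', P, Q, h1, h2, h3⟩⟩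

namespace RadauSplitting

variable (ρ : RadauSplitting k B₁ B₂ S lam)

/-- The interpolation error, in the direction `d` on the rectangle `K`, of `ζ` times a power of
degree `k + 1` of the coordinate: a combination of scaled Radau polynomials, whose coefficients are
chosen such that it does not contribute to the numerical flux. -/
def corr (K : Element) (d : Bool) (ζ : Fin m → ℝ) (x : ℝ × ℝ) : Fin m → ℝ :=
  (K.wd d ^ (k + 1) * ρ.left.eval ((coord d x - K.lo d) / K.wd d)) • (ρ.P d *ᵥ ζ)
    + (K.wd d ^ (k + 1) * ρ.right.eval ((coord d x - K.lo d) / K.wd d)) • (ρ.Q d *ᵥ ζ)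

/-- Subtracting a scaled monic polynomial of degree `k + 1` removes the leading term. -/
theorem natDegree_pow_sub_le {R : Polynomial ℝ} (hR : R.Monic) (hd : R.natDegree = k + 1) {w : ℝ}
    (hw : w ≠ 0) (a c : ℝ) : ∃ p : Polynomial ℝ, p.natDegree ≤ k ∧
      ∀ y, p.eval y = (y - c) ^ (k + 1) - w ^ (k + 1) * R.eval ((y - a) / w) := by
  set q := (R.scaleRoots w).comp (Polynomial.X - Polynomial.C a) with hq
  have hs : (R.scaleRoots w).Monic := (Polynomial.monic_scaleRoots_iff w).2 hR
  have hqm : q.Monic := hs.comp_X_sub_C a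
  have hqd : q.natDegree = k + 1 := by
    rw [hq, Polynomial.natDegree_comp, Polynomial.natDegree_X_sub_C, mul_one,
      Polynomial.natDegree_scaleRoots, hd]
  have hpm := (Polynomial.monic_X_sub_C c).pow (k + 1)
  have hpd : ((Polynomial.X - Polynomial.C c) ^ (k + 1)).natDegree = k + 1 := by simp
  refine ⟨(Polynomial.X - Polynomial.C c) ^ (k + 1) - q, ?_, fun y => ?_⟩
  · have hlt := Polynomial.degree_sub_lt_left (p := (Polynomial.X - Polynomial.C c) ^ (k + 1))
      (q := q)
      (by rw [Polynomial.degree_eq_natDegree hpm.ne_zero,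
        Polynomial.degree_eq_natDegree hqm.ne_zero,
        hpd, hqd]) hpm.ne_zero (by rw [hpm.leadingCoeff, hqm.leadingCoeff])
    rw [Polynomial.degree_eq_natDegree hpm.ne_zero, hpd] at hlt
    by_cases h0 : (Polynomial.X - Polynomial.C c) ^ (k + 1) - q = 0
    · simp [h0]
    · have := (Polynomial.natDegree_lt_iff_degree_lt h0).2 hlt
      omega
  · have h1 := Polynomial.scaleRoots_eval₂_mul (f := RingHom.id ℝ) (p := R) (r := (y - a) / w)
      (s := w)
    simp only [RingHom.id_apply, Polynomial.eval₂_id, hd] at h1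
    rw [mul_div_cancel₀ _ hw] at h1
    simp [hq, h1]

/-- The correction has the leading term of `ζ (x_d - c) ^ (k + 1)`. -/
theorem pow_sub_corr_mem {K : Element} (hK : K.IsAxisParallel) (d : Bool) (c : ℝ)
    (ζ : Fin m → ℝ) (a : Fin m) :
    (fun x => (coord d x - c) ^ (k + 1) * ζ a - ρ.corr K d ζ x a) ∈ polyQ k := by
  obtain ⟨p, hp, hpe⟩ := natDegree_pow_sub_le ρ.left_monic ρ.natDegree_left (hK.wd_pos d).ne'
    (K.lo d) c
  obtain ⟨q, hq, hqe⟩ := natDegree_pow_sub_le ρ.right_monic ρ.natDegree_right (hK.wd_pos d).ne'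
    (K.lo d) c
  have hmem : ∀ p : Polynomial ℝ, p.natDegree ≤ k → (fun x => p.eval (coord d x)) ∈ polyQ k :=
    fun p hp => by
      cases d
      · exact eval_snd_mem_polyQ hp
      · exact eval_fst_mem_polyQ hp
  have hζ : ζ a = (ρ.P d *ᵥ ζ) a + (ρ.Q d *ᵥ ζ) a := by
    rw [← Pi.add_apply, ← Matrix.add_mulVec, ρ.add, Matrix.one_mulVec]
  have : (fun x => (coord d x - c) ^ (k + 1) * ζ a - ρ.corr K d ζ x a)
      = (ρ.P d *ᵥ ζ) a • (fun x => p.eval (coord d x))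
        + (ρ.Q d *ᵥ ζ) a • (fun x => q.eval (coord d x)) := by
    ext x
    simp only [corr, Pi.add_apply, Pi.smul_apply, smul_eq_mul, hpe, hqe]
    rw [hζ]; ring
  rw [this]
  exact add_mem (Submodule.smul_mem _ _ (hmem p hp)) (Submodule.smul_mem _ _ (hmem q hq))

theorem contDiff_corr (K : Element) (d : Bool) (ζ : Fin m → ℝ) : ContDiff ℝ 1 (ρ.corr K d ζ) := by
  have h : ContDiff ℝ 1 (coord d) := by
    cases d
    · exact contDiff_snd
    · exact contDiff_fst
  have h2 : ContDiff ℝ 1 fun x => (coord d x - K.lo d) / K.wd d :=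
    (h.sub contDiff_const).div_const _
  have h3 : ∀ p : Polynomial ℝ, ContDiff ℝ 1 fun x => p.eval ((coord d x - K.lo d) / K.wd d) :=
    fun p => by
      have h4 := (Polynomial.contDiff_aeval (𝕜 := ℝ) p 1).comp h2
      simpa [Function.comp_def] using h4
  exact ((contDiff_const.mul (h3 _)).smul contDiff_const).add
    ((contDiff_const.mul (h3 _)).smul contDiff_const)

/-- The correction is constant in the other direction. -/
theorem fderiv_corr_eq_zero (K : Element) (d : Bool) (ζ : Fin m → ℝ) (x : ℝ × ℝ) :
    fderiv ℝ (ρ.corr K d ζ) x (unitVec (!d)) = 0 := by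
  have h1 := ((ρ.contDiff_corr K d ζ).differentiable
    one_ne_zero x).hasFDerivAt.comp_hasDerivAt_of_eq
    (0 : ℝ) (((hasDerivAt_id (0 : ℝ)).smul_const (unitVec (!d))).const_add x) (by simp)
  rw [one_smul] at h1
  have h2 : (ρ.corr K d ζ) ∘ (fun s : ℝ => x + id s • unitVec (!d)) = fun _ => ρ.corr K d ζ x := by
    ext s : 1
    have : coord d (x + s • unitVec (!d)) = coord d x := by
      cases d <;> simp [coord, unitVec]
    simp only [Function.comp, id, corr, this]
  rw [h2] at h1
  exact h1.unique (hasDerivAt_const _ _)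

theorem corr_sub (K : Element) (d : Bool) (ζ ζ' : Fin m → ℝ) (x : ℝ × ℝ) :
    ρ.corr K d (ζ - ζ') x = ρ.corr K d ζ x - ρ.corr K d ζ' x := by
  simp only [corr, Matrix.mulVec_sub]
  module

theorem hasDerivAt_corr (K : Element) (d : Bool) {ζ : ℝ → Fin m → ℝ} {ζ' : Fin m → ℝ} {t : ℝ}
    (h : ∀ a, HasDerivAt (fun τ => ζ τ a) (ζ' a) t) (x : ℝ × ℝ) (a : Fin m) :
    HasDerivAt (fun τ => ρ.corr K d (ζ τ) x a) (ρ.corr K d ζ' x a) t := by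
  have hX : ∀ X : Matrix (Fin m) (Fin m) ℝ, HasDerivAt (fun τ => (X *ᵥ ζ τ) a) ((X *ᵥ ζ') a) t :=
    fun X => HasDerivAt.fun_sum (u := Finset.univ) fun b _ => (h b).const_mul (X a b)
  exact ((hX _).const_mul _).fun_add ((hX _).const_mul _)

theorem abs_corr_le {K : Element} (hK : K.IsAxisParallel) {d : Bool} {κ ω z : ℝ}
    (hκ0 : 0 ≤ κ) (hκ : ∀ a b, |ρ.P d a b| ≤ κ ∧ |ρ.Q d a b| ≤ κ)
    (hω : ∀ τ ∈ Icc (0 : ℝ) 1, |ρ.left.eval τ| ≤ ω ∧ |ρ.right.eval τ| ≤ ω) {ζ : Fin m → ℝ}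
    (hz : ∀ a, K.wd d ^ (k + 1) * |ζ a| ≤ z) {x : ℝ × ℝ}
    (hx : coord d x ∈ Icc (K.lo d) (K.lo d + K.wd d)) (a : Fin m) :
    |ρ.corr K d ζ x a| ≤ 2 * (ω * (m * (κ * z))) := by
  have hw := hK.wd_pos d
  have hτ : (coord d x - K.lo d) / K.wd d ∈ Icc (0 : ℝ) 1 :=
    ⟨div_nonneg (by linarith [hx.1]) hw.le, (div_le_one hw).2 (by linarith [hx.2])⟩
  obtain ⟨h1, h2⟩ := hω _ hτ
  have hω0 : 0 ≤ ω := (abs_nonneg _).trans h1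
  have hz' : ∀ a, |(K.wd d ^ (k + 1) • ζ) a| ≤ z := fun a => by
    rw [Pi.smul_apply, smul_eq_mul, abs_mul, abs_of_pos (by positivity)]
    exact hz a
  have hP := abs_mulVec_le hκ0 (fun a b => (hκ a b).1) hz' a
  have hQ := abs_mulVec_le hκ0 (fun a b => (hκ a b).2) hz' a
  have e : ρ.corr K d ζ x a
      = ρ.left.eval ((coord d x - K.lo d) / K.wd d) * (ρ.P d *ᵥ (K.wd d ^ (k + 1) • ζ)) a
        + ρ.right.eval ((coord d x - K.lo d) / K.wd d) * (ρ.Q d *ᵥ (K.wd d ^ (k + 1) • ζ)) a := by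
    simp only [corr, Matrix.mulVec_smul, Pi.add_apply, Pi.smul_apply, smul_eq_mul]
    ring
  rw [e, two_mul]
  refine (abs_add_le _ _).trans (add_le_add ?_ ?_) <;> rw [abs_mul]
  · exact mul_le_mul h1 hP (abs_nonneg _) hω0
  · exact mul_le_mul h2 hQ (abs_nonneg _) hω0

/-- At the lower end only the part `Q` of the correction is left. -/
theorem plus_mulVec_corr (K : Element) (d : Bool) (ζ : Fin m → ℝ) {x : ℝ × ℝ}
    (hx : coord d x = K.lo d) :
    ((1 / 2 : ℝ) • normalMatrix B₁ B₂ (unitVec d) + stabMatrix S lam (unitVec d))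
      *ᵥ ρ.corr K d ζ x = 0 := by
  rw [corr, hx, sub_self, zero_div, ρ.eval_left, mul_zero, zero_smul, zero_add, Matrix.mulVec_smul,
    Matrix.mulVec_mulVec, ρ.plus, Matrix.zero_mulVec, smul_zero]

/-- At the upper end only the part `P` of the correction is left. -/
theorem minus_mulVec_corr {K : Element} (hK : K.IsAxisParallel) (d : Bool) (ζ : Fin m → ℝ)
    {x : ℝ × ℝ} (hx : coord d x = K.lo d + K.wd d) :
    ((1 / 2 : ℝ) • normalMatrix B₁ B₂ (unitVec d) - stabMatrix S lam (unitVec d))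
      *ᵥ ρ.corr K d ζ x = 0 := by
  rw [corr, hx, add_sub_cancel_left, div_self (hK.wd_pos d).ne', ρ.eval_right, mul_zero, zero_smul,
    add_zero, Matrix.mulVec_smul, Matrix.mulVec_mulVec, ρ.minus, Matrix.zero_mulVec, smul_zero]

/-- On the edges orthogonal to its direction the correction does not contribute to the numerical
flux. -/
theorem outFlux_corr_eq_zero {M : PeriodicMesh L₁ L₂} (hM : ∀ i, (M.elem i).IsAxisParallel)
    {d : Bool} (ζ : Fin M.N → Fin m → ℝ) {e : Side M.elem} (he : e.IsOrtho d) (s : ℝ) :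
    outFlux M B₁ B₂ S lam (fun i => ρ.corr (M.elem i) d (ζ i)) e (e.pt s) = 0 := by
  have hu : IsMinusNormal (unitVec d) := by cases d <;> simp [IsMinusNormal, unitVec]
  have hs := M.coord_sub_shift hM he s
  rcases he.normal with ⟨h1, h2⟩ | ⟨h1, h2⟩
  · rw [outFlux, h1, if_pos hu, numFlux_eq, ρ.plus_mulVec_corr _ _ _ (hs.1 h1),
      ρ.minus_mulVec_corr (hM _) _ _ (h2 s), add_zero]
  · have hn : ¬ IsMinusNormal (-unitVec d) := fun h =>
      (isMinusNormal_neg (len_unitVec d)).1 h hu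
    rw [outFlux, h1, if_neg hn, neg_neg, numFlux_eq, ρ.plus_mulVec_corr _ _ _ (h2 s),
      ρ.minus_mulVec_corr (hM _) _ _ (hs.2 h1), add_zero, neg_zero]

/-- The correction is orthogonal to derivatives of test functions in its own direction. -/
theorem setIntegral_corr_fderiv_eq_zero {K : Element} (hK : K.IsAxisParallel) (d : Bool)
    (ζ : Fin m → ℝ) (B : Matrix (Fin m) (Fin m) ℝ) {v : ℝ × ℝ → Fin m → ℝ}
    (hv : ∀ a, (fun x => v x a) ∈ K.localSpace k) :
    ∫ x in K.carrier, (B *ᵥ ρ.corr K d ζ x) ⬝ᵥ fderiv ℝ v x (unitVec d) = 0 := by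
  have hvd : ContDiff ℝ 1 v := contDiff_pi.2 fun a => Element.contDiff_of_mem_localSpace (hv a)
  have hfd : ∀ x a, fderiv ℝ v x (unitVec d) a = fderiv ℝ (fun x => v x a) x (unitVec d) :=
    fun x a => by
      rw [fderiv_pi fun a => (contDiff_pi.1 hvd a).differentiable one_ne_zero x]; rfl
  have h1 := fun a => hK.setIntegral_mul_fderiv_eq_zero d ρ.left.continuous ρ.left_ortho
    (hK.mem_localSpace_iff.1 (hv a))
  have h2 := fun a => hK.setIntegral_mul_fderiv_eq_zero d ρ.right.continuous ρ.right_ortho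
    (hK.mem_localSpace_iff.1 (hv a))
  have hc : ∀ p : Polynomial ℝ, Continuous fun x => p.eval ((coord d x - K.lo d) / K.wd d) :=
    fun p => p.continuous.comp (by
      cases d <;> simp only [coord, if_true, Bool.false_eq_true, if_false] <;> fun_prop)
  have hi : ∀ (p : Polynomial ℝ) (a : Fin m) (r : ℝ), IntegrableOn
      (fun x => r * (p.eval ((coord d x - K.lo d) / K.wd d)
        * fderiv ℝ (fun x => v x a) x (unitVec d))) K.carrier := fun p a r =>
    K.integrableOn_carrier (continuous_const.mul ((hc p).mul
      (((contDiff_pi.1 hvd a).continuous_fderiv one_ne_zero).clm_apply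
        continuous_const))).continuousOn
  have e : ∀ x, (B *ᵥ ρ.corr K d ζ x) ⬝ᵥ fderiv ℝ v x (unitVec d)
      = ∑ a, (K.wd d ^ (k + 1) * (B *ᵥ ρ.P d *ᵥ ζ) a
            * (ρ.left.eval ((coord d x - K.lo d) / K.wd d)
              * fderiv ℝ (fun x => v x a) x (unitVec d))
          + K.wd d ^ (k + 1) * (B *ᵥ ρ.Q d *ᵥ ζ) a
            * (ρ.right.eval ((coord d x - K.lo d) / K.wd d)
              * fderiv ℝ (fun x => v x a) x (unitVec d))) := fun x => by
    rw [corr, Matrix.mulVec_add, Matrix.mulVec_smul, Matrix.mulVec_smul, dotProduct]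
    refine Finset.sum_congr rfl fun a _ => ?_
    rw [hfd]
    simp only [Pi.add_apply, Pi.smul_apply, smul_eq_mul]
    ring
  have hadd : ∀ a, IntegrableOn (fun x => K.wd d ^ (k + 1) * (B *ᵥ ρ.P d *ᵥ ζ) a
            * (ρ.left.eval ((coord d x - K.lo d) / K.wd d)
              * fderiv ℝ (fun x => v x a) x (unitVec d))
          + K.wd d ^ (k + 1) * (B *ᵥ ρ.Q d *ᵥ ζ) a
            * (ρ.right.eval ((coord d x - K.lo d) / K.wd d)
              * fderiv ℝ (fun x => v x a) x (unitVec d))) K.carrier :=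
    fun a => (hi _ a _).add (hi _ a _)
  simp only [e]
  rw [integral_finsetSum _ fun a _ => hadd a]
  refine Finset.sum_eq_zero fun a _ => ?_
  rw [integral_add (hi _ a _) (hi _ a _), integral_const_mul, integral_const_mul, h1, h2]
  simp

/-- The spatial operator on the corrections, tested in the space: only the jumps across the edges
parallel to the direction of the correction remain. -/
theorem convForm_corr_eq {M : PeriodicMesh L₁ L₂} (hM : ∀ i, (M.elem i).IsAxisParallel)
    (d : Bool) (ζ : Fin M.N → Fin m → ℝ) (i : Fin M.N) {v : ℝ × ℝ → Fin m → ℝ}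
    (hv : ∀ a, (fun x => v x a) ∈ (M.elem i).localSpace k) :
    convForm M B₁ B₂ S lam (fun i => ρ.corr (M.elem i) d (ζ i)) i v
      = ∑ l : Fin (M.elem i).numSides, Side.integral (elem := M.elem) ⟨i, l⟩ (fun x =>
          (outFlux M B₁ B₂ S lam (fun i => ρ.corr (M.elem i) d (ζ i)) ⟨i, l⟩ x
            - coord (!d) (Side.normal (elem := M.elem) ⟨i, l⟩) •
              (normalMatrix B₁ B₂ (unitVec (!d)) *ᵥ ρ.corr (M.elem i) d (ζ i) x)) ⬝ᵥ v x) := by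
  set W : M.Broken m := fun i => ρ.corr (M.elem i) d (ζ i) with hW
  have hvd : ContDiff ℝ 1 v := contDiff_pi.2 fun a => Element.contDiff_of_mem_localSpace (hv a)
  have hWd : ∀ i, ContDiff ℝ 1 (W i) := fun i => ρ.contDiff_corr _ _ _
  set B := normalMatrix B₁ B₂ (unitVec (!d)) with hB
  have h1 : convForm M B₁ B₂ S lam W i v = (∑ l : Fin (M.elem i).numSides,
        Side.integral (elem := M.elem) ⟨i, l⟩
          (fun x => outFlux M B₁ B₂ S lam W ⟨i, l⟩ x ⬝ᵥ v x))
      - (∫ x in (M.elem i).carrier, (normalMatrix B₁ B₂ (unitVec d) *ᵥ W i x)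
          ⬝ᵥ fderiv ℝ v x (unitVec d))
      - (∫ x in (M.elem i).carrier, (B *ᵥ W i x) ⬝ᵥ fderiv ℝ v x (unitVec (!d))) := by
    rw [convForm, hB]
    cases d
    · simp only [normalMatrix, unitVec, Bool.not_false, if_true, Bool.false_eq_true, if_false,
        one_smul, zero_smul, add_zero, zero_add]
      ring
    · simp only [normalMatrix, unitVec, Bool.not_true, if_true, Bool.false_eq_true, if_false,
        one_smul, zero_smul, add_zero, zero_add]
  have h2 : ∫ x in (M.elem i).carrier, (normalMatrix B₁ B₂ (unitVec d) *ᵥ W i x)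
      ⬝ᵥ fderiv ℝ v x (unitVec d) = 0 := ρ.setIntegral_corr_fderiv_eq_zero (hM i) d _ _ hv
  have h3 := setIntegral_mulVec_fderiv (elem := M.elem) i B (hWd i) hvd (unitVec (!d))
  have h4 : ∀ x, fderiv ℝ (W i) x (unitVec (!d)) = 0 := ρ.fderiv_corr_eq_zero _ _ _
  simp only [h4, Matrix.mulVec_zero, zero_dotProduct, integral_zero, sub_zero] at h3
  rw [h1, h2, h3, sub_zero, ← Finset.sum_sub_distrib]
  refine Finset.sum_congr rfl fun l _ => ?_
  have h5 : ∀ n : ℝ × ℝ, (unitVec (!d)).1 * n.1 + (unitVec (!d)).2 * n.2 = coord (!d) n :=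
    fun n => by cases d <;> simp [unitVec, coord]
  have hg : Continuous fun x => coord (!d) (Side.normal (elem := M.elem) ⟨i, l⟩)
      * ((B *ᵥ W i x) ⬝ᵥ v x) :=
    continuous_const.mul (continuous_mulVec_dotProduct B (hWd i).continuous hvd.continuous)
  rw [h5, ← Side.integral_const_mul, ← Side.integral_sub _
    ((continuous_outFlux M (fun i => (hWd i).continuous) _).dotProduct hvd.continuous) hg]
  simp only [sub_dotProduct, smul_dotProduct, smul_eq_mul]
  rfl

/-- On the edges parallel to the direction of the corrections the two corrections are given by the
same Radau polynomials, so that their jump is the correction formed with the jump of the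
coefficients `ζ`. -/
theorem abs_convForm_corr_le {M : PeriodicMesh L₁ L₂} (hM : ∀ i, (M.elem i).IsAxisParallel)
    {κ κ' ω z w : ℝ} {d : Bool} (hκ0 : 0 ≤ κ)
    (hκ : ∀ n, len n = 1 → ∀ a b, |normalMatrix B₁ B₂ n a b| ≤ κ ∧ |stabMatrix S lam n a b| ≤ κ)
    (hκ'0 : 0 ≤ κ') (hκ' : ∀ a b, |ρ.P d a b| ≤ κ' ∧ |ρ.Q d a b| ≤ κ')
    (hω : ∀ τ ∈ Icc (0 : ℝ) 1, |ρ.left.eval τ| ≤ ω ∧ |ρ.right.eval τ| ≤ ω)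
    (ζ : Fin M.N → Fin m → ℝ) (i : Fin M.N)
    (hz0 : 0 ≤ z) (hz : ∀ l : Fin (M.elem i).numSides, Side.IsOrtho (elem := M.elem) ⟨i, l⟩ (!d) →
      ∀ a, (M.elem i).wd d ^ (k + 1) * |ζ (M.nbr ⟨i, l⟩).1 a - ζ i a| ≤ z)
    {v : ℝ × ℝ → Fin m → ℝ} (hv : ∀ a, (fun x => v x a) ∈ (M.elem i).localSpace k) (hw : 0 ≤ w)
    (hvw : ∀ x ∈ (M.elem i).carrier, ∀ a, |v x a| ≤ w) :
    |convForm M B₁ B₂ S lam (fun i => ρ.corr (M.elem i) d (ζ i)) i v|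
      ≤ 4 * ((M.elem i).diam * (m * (m * (2 * κ * (2 * (ω * (m * (κ' * z))))) * w))) := by
  have hω0 : 0 ≤ ω := (abs_nonneg _).trans (hω 0 ⟨le_rfl, zero_le_one⟩).1
  have hd0 := (M.elem i).diam_pos.le
  rw [ρ.convForm_corr_eq hM d ζ i hv]
  have hside : ∀ l : Fin (M.elem i).numSides, |Side.integral (elem := M.elem) ⟨i, l⟩ (fun x =>
          (outFlux M B₁ B₂ S lam (fun i => ρ.corr (M.elem i) d (ζ i)) ⟨i, l⟩ x
            - coord (!d) (Side.normal (elem := M.elem) ⟨i, l⟩) •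
              (normalMatrix B₁ B₂ (unitVec (!d)) *ᵥ ρ.corr (M.elem i) d (ζ i) x)) ⬝ᵥ v x)|
      ≤ (M.elem i).diam * (m * (m * (2 * κ * (2 * (ω * (m * (κ' * z))))) * w)) := by
    intro l
    refine (Side.abs_integral_le _ fun s hs => ?_).trans (mul_le_mul_of_nonneg_right
      ((M.elem i).len_edge_le_diam l.2) (by positivity))
    refine abs_dotProduct_le (by positivity) (fun a => ?_)
      (hvw _ (Side.pt_mem_carrier (elem := M.elem) ⟨i, l⟩ hs))
    obtain ⟨d', hd'⟩ := Side.exists_isOrtho (elem := M.elem) ⟨i, l⟩ (hM i)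
    rcases Bool.eq_or_eq_not d' d with rfl | rfl
    · -- an edge orthogonal to the direction of the correction
      have h0 : coord (!d') (Side.normal (elem := M.elem) ⟨i, l⟩) = 0 := by
        rcases hd'.normal with ⟨h, -⟩ | ⟨h, -⟩ <;> rw [h] <;> cases d' <;> simp [coord, unitVec]
      rw [h0, zero_smul, sub_zero, ρ.outFlux_corr_eq_zero hM ζ hd', Pi.zero_apply, abs_zero]
      positivity
    · -- an edge parallel to the direction of the correction
      have hn : coord (!d) (Side.normal (elem := M.elem) ⟨i, l⟩) •
          normalMatrix B₁ B₂ (unitVec (!d))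
            = normalMatrix B₁ B₂ (Side.normal (elem := M.elem) ⟨i, l⟩) := by
        rcases hd'.normal with ⟨h, -⟩ | ⟨h, -⟩ <;> rw [h]
        · cases d <;> simp [coord, unitVec]
        · rw [normalMatrix_neg]; cases d <;> simp [coord, unitVec]
      rw [← Matrix.smul_mulVec, hn]
      refine abs_outFlux_sub_le M hκ (fun i => ρ.corr (M.elem i) d (ζ i)) ⟨i, l⟩ _
        (fun a => ?_) a
      have hwd := PeriodicMesh.wd_nbr_eq hM hd'
      rw [Bool.not_not] at hwd
      have hj : ρ.corr (M.elem (M.nbr ⟨i, l⟩).1) d (ζ (M.nbr ⟨i, l⟩).1)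
            (Side.pt (elem := M.elem) ⟨i, l⟩ s - M.shift ⟨i, l⟩)
          - ρ.corr (M.elem i) d (ζ i) (Side.pt (elem := M.elem) ⟨i, l⟩ s)
          = ρ.corr (M.elem i) d (ζ (M.nbr ⟨i, l⟩).1 - ζ i)
            (Side.pt (elem := M.elem) ⟨i, l⟩ s) := by
        rw [corr_sub]
        congr 1
        simp only [corr, hwd.1, hwd.2, coord_sub, sub_sub_sub_cancel_right]
      have hj' := congrFun hj a
      rw [Pi.sub_apply] at hj'
      rw [hj']
      exact ρ.abs_corr_le (hM i) hκ'0 hκ' hω (fun a => hz l hd' a)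
        ((hM i).coord_mem (Side.pt_mem_carrier (elem := M.elem) ⟨i, l⟩ hs) d) a
  refine (Finset.abs_sum_le_sum_abs _ _).trans
    ((Finset.sum_le_card_nsmul _ _ _ fun l _ => hside l).trans ?_)
  rw [nsmul_eq_mul, Finset.card_univ, Fintype.card_fin]
  have h4 : ((M.elem i).numSides : ℝ) ≤ 4 := by exact_mod_cast (M.elem i).numSides_le
  exact mul_le_mul_of_nonneg_right h4 (by positivity)

end RadauSplitting

end Correction

/-! ### Consistent approximations of the exact solution -/

section Approximation

variable {m k : ℕ} {L₁ L₂ : ℝ} {B₁ B₂ : Matrix (Fin m) (Fin m) ℝ}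
  {S : ℝ × ℝ → Matrix (Fin m) (Fin m) ℝ} {lam : ℝ × ℝ → Fin m → ℝ}

theorem exists_flux_const (hd : IsPairedDecomposition B₁ B₂ S lam) : ∃ κ : ℝ, 0 ≤ κ ∧
    (∀ a d, |B₁ a d| ≤ κ) ∧ (∀ a d, |B₂ a d| ≤ κ) ∧ ∀ n, len n = 1 →
      ∀ a b, |normalMatrix B₁ B₂ n a b| ≤ κ ∧ |stabMatrix S lam n a b| ≤ κ := by
  obtain ⟨κ, h0, h⟩ := exists_flux_bound hd
  refine ⟨κ, h0, fun a b => ?_, fun a b => ?_, h⟩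
  · have := (h _ (len_unitVec true) a b).1
    simpa [normalMatrix, unitVec] using this
  · have := (h _ (len_unitVec false) a b).1
    simpa [normalMatrix, unitVec] using this

/-- On general meshes the Taylor polynomials of degree `k` are consistent of order `k`. -/
theorem exists_isConsistent (k : ℕ) (hd : IsPairedDecomposition B₁ B₂ S lam) {R β γ H : ℝ}
    (hR : 0 ≤ R) (hβ : 0 ≤ β) (hγ : 0 ≤ γ) (hH : 0 ≤ H) :
    ∃ A : ℝ, 0 ≤ A ∧ ∀ (M : PeriodicMesh L₁ L₂) (B₀ : ℝ × ℝ → Fin m → ℝ)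
      (b : Fin M.N → Fin m → ℝ) (T h : ℝ) (u : ℝ → ℝ × ℝ → Fin m → ℝ),
      IsRegular M (k + 2) T R b B₁ B₂ u → IsLocallyUniform M γ H →
      (∀ i, ∀ x ∈ interior (M.elem i).carrier, B₀ x = b i) → (∀ i a, |b i a| ≤ β) →
      (∀ i, (M.elem i).diam ≤ h) →
      ∃ V V', IsConsistent M k B₀ B₁ B₂ S lam T (A * h ^ k) u V V' := by
  obtain ⟨κ, hκ0, hκ₁, hκ₂, hκ⟩ := exists_flux_const hd
  have hA0 : 0 ≤ taylorConst m k R β κ γ H := by unfold taylorConst; positivity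
  refine ⟨taylorConst m k R β κ γ H + R * 4 ^ (k + 1) * H, by positivity, ?_⟩
  intro M B₀ b T h u hu hM hb hb0 hh
  choose c hc using fun i => (M.elem i).interior_carrier_nonempty
  refine ⟨fun t i x a => taylor (k + 1) (c i) (fun q => u q.1 q.2 a) t x,
    fun t i x a => taylor (k + 1) (c i) (pd et fun q => u q.1 q.2 a) t x, ?_, ?_, ?_, ?_⟩
  · exact fun t _ i a => taylor_mem_localSpace _ le_rfl _ _ _
  · exact fun t ht i x a => hasDerivAt_taylor_time isOpen_timeSlab
      ((hu.bound i a).mono (by omega)) ⟨ht, hc i⟩ x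
  · intro t ht i x hx a
    have hd0 := (M.elem i).diam_pos.le
    have hh0 := hd0.trans (hh i)
    refine (hu.abs_sub_taylor_le hc (by omega) ht i hx a).trans ?_
    calc R * (4 * (M.elem i).diam) ^ (k + 1)
        = R * 4 ^ (k + 1) * (M.elem i).diam * (M.elem i).diam ^ k := by rw [mul_pow]; ring
      _ ≤ R * 4 ^ (k + 1) * H * h ^ k := by
        have := hM.diam_le i
        have := hh i
        gcongr
      _ ≤ _ := by gcongr; linarith
  · intro t ht i v hv w hw hvw
    have hd0 := (M.elem i).diam_pos.le
    have hh0 := hd0.trans (hh i)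
    have hj := (M.elem i).jac_pos.le
    refine (hu.abs_schemeForm_taylor_le hM hR hγ hb hb0 hκ0 hβ hκ₁ hκ₂ hκ hc ht i
      (contDiff_pi.2 fun a => Element.contDiff_of_mem_localSpace (hv a)) hw hvw).trans ?_
    have := hh i
    gcongr
    have : 0 ≤ R * 4 ^ (k + 1) * H := by positivity
    linarith

/-- The coefficient of the power of degree `k + 1` of the coordinate `d` in the Taylor polynomial of
degree `k + 1`. -/
def lead (k : ℕ) (d : Bool) (f : STFun) (c : ℝ × ℝ) (t : ℝ) : ℝ :=
  (if d then coef (k + 1) 0 f c t else coef 0 (k + 1) f c t) / (k + 1).factorial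

theorem abs_lead_le {O : Set (ℝ × (ℝ × ℝ))} (hO : IsOpen O) {f : STFun} {C : ℝ}
    (h : DerivBound (k + 1) C f O) {c : ℝ × ℝ} {t : ℝ} (hc : (t, c) ∈ O) (d : Bool) :
    |lead k d f c t| ≤ C := by
  have hf : (1 : ℝ) ≤ (k + 1).factorial := by
    exact_mod_cast Nat.succ_le_of_lt (Nat.factorial_pos (k + 1))
  have key : ∀ y : ℝ, |y| ≤ C → |y / (k + 1).factorial| ≤ C := fun y hy => by
    rw [abs_div, abs_of_pos (by linarith : (0 : ℝ) < (k + 1).factorial)]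
    exact (div_le_self (abs_nonneg _) hf).trans hy
  cases d
  · exact key _ (by simpa using abs_coef_le (i := 0) (j := k + 1) hO (h.mono (by omega)) hc)
  · exact key _ (by simpa using abs_coef_le (i := k + 1) (j := 0) hO (h.mono (by omega)) hc)

theorem hasDerivAt_lead {O : Set (ℝ × (ℝ × ℝ))} (hO : IsOpen O) {f : STFun} {C : ℝ}
    (h : DerivBound (k + 2) C f O) {c : ℝ × ℝ} {t : ℝ} (hc : (t, c) ∈ O) (d : Bool) :
    HasDerivAt (fun τ => lead k d f c τ) (lead k d (pd et f) c t) t := by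
  cases d
  · exact (hasDerivAt_coef (i := 0) (j := k + 1) hO (h.mono (by omega)) hc).div_const _
  · exact (hasDerivAt_coef (i := k + 1) (j := 0) hO (h.mono (by omega)) hc).div_const _

/-- The Taylor polynomial of degree `k + 1` lies in `Q^k` up to the two pure powers of degree
`k + 1`. -/
theorem taylor_sub_lead_mem (c : ℝ × ℝ) (f : STFun) (t : ℝ) :
    (fun x => taylor (k + 2) c f t x - (coord true x - coord true c) ^ (k + 1) * lead k true f c t
      - (coord false x - coord false c) ^ (k + 1) * lead k false f c t) ∈ polyQ k := by
  set F : ℕ → ℕ → ℝ × ℝ → ℝ := fun i j x =>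
    coef i j f c t * (dpow i (x.1 - c.1) * dpow j (x.2 - c.2)) with hF
  have hmem : ∀ i j, i ≤ k → j ≤ k → F i j ∈ polyQ k := fun i j hi hj => by
    have hdeg : ∀ (s : ℝ) (l : ℕ), l ≤ k →
        ((Polynomial.X - Polynomial.C s) ^ l : Polynomial ℝ).natDegree ≤ k := fun s l hl => by
      simpa using hl
    have h := Submodule.smul_mem _ (coef i j f c t / i.factorial / j.factorial)
      (eval_mul_eval_mem_polyQ (hdeg c.1 i hi) (hdeg c.2 j hj))
    convert h using 1
    ext x
    simp [hF, dpow]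
    field_simp
  have e : (fun x => taylor (k + 2) c f t x
      - (coord true x - coord true c) ^ (k + 1) * lead k true f c t
      - (coord false x - coord false c) ^ (k + 1) * lead k false f c t)
      = (∑ i ∈ Finset.range k, ∑ j ∈ Finset.range (k + 1 - i), F (i + 1) j)
        + ∑ j ∈ Finset.range (k + 1), F 0 j := by
    ext x
    have h1 : taylor (k + 2) c f t x
        = ∑ i ∈ Finset.range (k + 2), ∑ j ∈ Finset.range (k + 2 - i), F i j x := rfl
    rw [h1, Finset.sum_range_succ, Finset.sum_range_succ', Nat.sub_zero,
      Finset.sum_range_succ _ (k + 1),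
      show k + 2 - (k + 1) = 1 by omega, Finset.sum_range_one]
    simp only [Pi.add_apply, Finset.sum_apply, show ∀ i, k + 2 - (i + 1) = k + 1 - i by omega]
    have h2 : F 0 (k + 1) x = (coord false x - coord false c) ^ (k + 1) * lead k false f c t := by
      simp [hF, dpow, lead, coord]; ring
    have h3 : F (k + 1) 0 x = (coord true x - coord true c) ^ (k + 1) * lead k true f c t := by
      simp [hF, dpow, lead, coord]; ring
    rw [h2, h3]
    ring
  rw [e]
  refine add_mem (Submodule.sum_mem _ fun i hi => Submodule.sum_mem _ fun j hj => ?_)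
    (Submodule.sum_mem _ fun j hj => ?_)
  · have := Finset.mem_range.1 hi
    have := Finset.mem_range.1 hj
    exact hmem _ _ (by omega) (by omega)
  · have := Finset.mem_range.1 hj
    exact hmem _ _ (by omega) (by omega)

/-- The restriction of the Taylor polynomial to a line parallel to an axis. The translation `σ`
serves to compare the polynomials on two elements that are neighbours up to a period. -/
theorem exists_polynomial_taylor (d : Bool) (z : ℝ) (c σ : ℝ × ℝ) (f : STFun) (t : ℝ) :
    ∃ p : Polynomial ℝ, p.natDegree < k + 2 ∧ p.coeff (k + 1) = lead k d f c t ∧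
      ∀ x, coord (!d) x = z → taylor (k + 2) c f t (x - σ) = p.eval (coord d x) := by
  have hdeg : ∀ (s r : ℝ) (i : ℕ), i < k + 2 →
      (Polynomial.C r * (Polynomial.X - Polynomial.C s) ^ i).natDegree ≤ k + 1 := fun s r i hi =>
    (Polynomial.natDegree_C_mul_le _ _).trans (by simp; omega)
  have hcoeff : ∀ (s r : ℝ) (i : ℕ), i < k + 2 →
      (Polynomial.C r * (Polynomial.X - Polynomial.C s) ^ i).coeff (k + 1)
        = if i = k + 1 then r else 0 := fun s r i hi => by
    rw [Polynomial.coeff_C_mul]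
    split_ifs with h
    · subst h
      have hm := (Polynomial.monic_X_sub_C s).pow (k + 1)
      have := hm.coeff_natDegree
      simp only [Polynomial.natDegree_pow, Polynomial.natDegree_X_sub_C, mul_one] at this
      rw [this, mul_one]
    · rw [Polynomial.coeff_eq_zero_of_natDegree_lt, mul_zero]
      simp; omega
  cases d
  · refine ⟨∑ i ∈ Finset.range (k + 2), ∑ j ∈ Finset.range (k + 2 - i),
      Polynomial.C (coef i j f c t * dpow i (z - σ.1 - c.1) / j.factorial)
        * (Polynomial.X - Polynomial.C (σ.2 + c.2)) ^ j, ?_, ?_, ?_⟩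
    · refine Nat.lt_succ_of_le (Polynomial.natDegree_sum_le_of_forall_le _ _ fun i hi =>
        Polynomial.natDegree_sum_le_of_forall_le _ _ fun j hj => hdeg _ _ _ ?_)
      have := Finset.mem_range.1 hj
      omega
    · simp only [Polynomial.finsetSum_coeff]
      rw [Finset.sum_range_succ', Finset.sum_eq_zero, zero_add, Nat.sub_zero,
        Finset.sum_range_succ, Finset.sum_eq_zero, zero_add, hcoeff _ _ _ (by omega), if_pos rfl]
      · simp [dpow_zero, lead]
      · intro j hj
        have := Finset.mem_range.1 hj
        rw [hcoeff _ _ _ (by omega), if_neg (by omega)]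
      · intro i hi
        refine Finset.sum_eq_zero fun j hj => ?_
        have := Finset.mem_range.1 hj
        rw [hcoeff _ _ _ (by omega), if_neg (by omega)]
    · intro x hx
      have hx1 : x.1 = z := by simpa [coord] using hx
      simp only [taylor, Polynomial.eval_finsetSum]
      refine Finset.sum_congr rfl fun i _ => Finset.sum_congr rfl fun j _ => ?_
      simp only [Polynomial.eval_mul, Polynomial.eval_C, Polynomial.eval_pow, Polynomial.eval_sub,
        Polynomial.eval_X, Prod.fst_sub, Prod.snd_sub, hx1, coord, Bool.false_eq_true, if_false,
        ← sub_sub]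
      simp only [dpow]
      ring
  · refine ⟨∑ i ∈ Finset.range (k + 2), ∑ j ∈ Finset.range (k + 2 - i),
      Polynomial.C (coef i j f c t * dpow j (z - σ.2 - c.2) / i.factorial)
        * (Polynomial.X - Polynomial.C (σ.1 + c.1)) ^ i, ?_, ?_, ?_⟩
    · refine Nat.lt_succ_of_le (Polynomial.natDegree_sum_le_of_forall_le _ _ fun i hi =>
        Polynomial.natDegree_sum_le_of_forall_le _ _ fun j hj => hdeg _ _ _ ?_)
      have := Finset.mem_range.1 hi
      omega
    · simp only [Polynomial.finsetSum_coeff]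
      rw [Finset.sum_range_succ, Finset.sum_eq_zero, zero_add,
        show k + 2 - (k + 1) = 1 by omega, Finset.sum_range_one, hcoeff _ _ _ (by omega),
        if_pos rfl]
      · simp [dpow_zero, lead]
      · intro i hi
        have := Finset.mem_range.1 hi
        refine Finset.sum_eq_zero fun j hj => ?_
        rw [hcoeff _ _ _ (by omega), if_neg (by omega)]
    · intro x hx
      have hx1 : x.2 = z := by simpa [coord] using hx
      simp only [taylor, Polynomial.eval_finsetSum]
      refine Finset.sum_congr rfl fun i _ => Finset.sum_congr rfl fun j _ => ?_
      simp only [Polynomial.eval_mul, Polynomial.eval_C, Polynomial.eval_pow, Polynomial.eval_sub,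
        Polynomial.eval_X, Prod.fst_sub, Prod.snd_sub, hx1, coord, if_true, ← sub_sub]
      simp only [dpow]
      ring

/-- The jumps of the leading coefficients in the direction of an edge are controlled by the jump of
the Taylor polynomials on the edge. -/
theorem exists_lead_jump_le (k : ℕ) : ∃ C : ℝ, 0 ≤ C ∧ ∀ {L₁ L₂ : ℝ} (M : PeriodicMesh L₁ L₂),
    (∀ i, (M.elem i).IsAxisParallel) → ∀ (e : Side M.elem) (d : Bool), e.IsOrtho (!d) →
    ∀ (f : STFun) (c c' : ℝ × ℝ) (t δ : ℝ),
    (∀ s ∈ Icc (0 : ℝ) 1, |taylor (k + 2) c' f t (e.pt s - M.shift e)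
      - taylor (k + 2) c f t (e.pt s)| ≤ δ) →
    (M.elem e.1).wd d ^ (k + 1) * |lead k d f c' t - lead k d f c t| ≤ C * δ := by
  obtain ⟨C, hC, h⟩ := exists_abs_leading_le (k + 1)
  refine ⟨C, hC, fun {L₁ L₂} M hM e d he f c c' t δ hδ => ?_⟩
  obtain ⟨z, hz⟩ : ∃ z, ∀ s, coord (!d) (e.pt s) = z := by
    rcases he.normal with ⟨-, h⟩ | ⟨-, h⟩
    · exact ⟨_, h⟩
    · exact ⟨_, h⟩
  obtain ⟨p, hp1, hp2, hp3⟩ := exists_polynomial_taylor (k := k) d z c 0 f t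
  obtain ⟨p', hp1', hp2', hp3'⟩ := exists_polynomial_taylor (k := k) d z c' (M.shift e) f t
  have hdeg : (p' - p).natDegree < k + 2 :=
    (Polynomial.natDegree_sub_le _ _).trans_lt (max_lt hp1' hp1)
  have := h (p' - p).coeff ((M.elem e.1).lo d) ((M.elem e.1).wd d) δ ((hM _).wd_pos d)
    fun τ hτ => by
      have he1 : ∑ l ∈ Finset.range (k + 1 + 1), (p' - p).coeff l
          * ((M.elem e.1).lo d + (M.elem e.1).wd d * τ) ^ l
          = (p' - p).eval ((M.elem e.1).lo d + (M.elem e.1).wd d * τ) :=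
        (Polynomial.eval_eq_sum_range' hdeg _).symm
      obtain ⟨s, hs, hsτ⟩ : ∃ s ∈ Icc (0 : ℝ) 1,
          coord d (e.pt s) = (M.elem e.1).lo d + (M.elem e.1).wd d * τ := by
        have hpar := he.param
        rw [Bool.not_not] at hpar
        rcases hpar with h1 | h1
        · exact ⟨τ, hτ, h1 τ⟩
        · exact ⟨1 - τ, ⟨by linarith [hτ.2], by linarith [hτ.1]⟩, by rw [h1, sub_sub_cancel]⟩
      have h3 := hδ s hs
      have h4 := hp3 (e.pt s) (hz s)
      rw [sub_zero] at h4
      rw [hp3' _ (hz s), h4] at h3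
      rw [he1, Polynomial.eval_sub, ← hsτ]
      exact h3
  rwa [Polynomial.coeff_sub, hp2, hp2'] at this

end Approximation

/-! ### Consistency of order `k + 1` on rectangular meshes -/

section Rectangular

variable {m k : ℕ} {L₁ L₂ : ℝ} {B₁ B₂ : Matrix (Fin m) (Fin m) ℝ}
  {S : ℝ × ℝ → Matrix (Fin m) (Fin m) ℝ} {lam : ℝ × ℝ → Fin m → ℝ}

theorem RadauSplitting.exists_bound (ρ : RadauSplitting k B₁ B₂ S lam) : ∃ κ ω : ℝ, 0 ≤ κ ∧
    (∀ d a b, |ρ.P d a b| ≤ κ ∧ |ρ.Q d a b| ≤ κ) ∧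
    ∀ τ ∈ Icc (0 : ℝ) 1, |ρ.left.eval τ| ≤ ω ∧ |ρ.right.eval τ| ≤ ω := by
  choose p hp0 hp using fun d => exists_abs_apply_le (ρ.P d)
  choose q hq0 hq using fun d => exists_abs_apply_le (ρ.Q d)
  obtain ⟨ω, hω⟩ := isCompact_Icc.exists_bound_of_continuousOn
    (s := Icc (0 : ℝ) 1) ρ.left.continuous.continuousOn
  obtain ⟨ω', hω'⟩ := isCompact_Icc.exists_bound_of_continuousOn
    (s := Icc (0 : ℝ) 1) ρ.right.continuous.continuousOn
  have hs : ∀ d, p d ≤ ∑ d, (p d + q d) ∧ q d ≤ ∑ d, (p d + q d) := fun d => by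
    have := Finset.single_le_sum (f := fun d => p d + q d)
      (fun d _ => add_nonneg (hp0 d) (hq0 d)) (Finset.mem_univ d)
    constructor <;> linarith [hp0 d, hq0 d]
  refine ⟨∑ d, (p d + q d), max ω ω', Finset.sum_nonneg fun d _ => add_nonneg (hp0 d) (hq0 d),
    fun d a b => ⟨(hp d a b).trans (hs d).1, (hq d a b).trans (hs d).2⟩,
    fun τ hτ => ⟨(hω τ hτ).trans (le_max_left _ _), (hω' τ hτ).trans (le_max_right _ _)⟩⟩

/-- On rectangular meshes there is an approximation in the space that is consistent of order
`k + 1`: the Taylor polynomial of degree `k + 1`, whose two leading terms outside `Q^k` are removed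
by subtracting corrections. -/
theorem exists_isConsistent_of_isAxisParallel (k : ℕ) (hd : IsPairedDecomposition B₁ B₂ S lam)
    {R β γ H : ℝ} (hR : 0 ≤ R) (hβ : 0 ≤ β) (hγ : 0 ≤ γ) (hH : 0 ≤ H) :
    ∃ A : ℝ, 0 ≤ A ∧ ∀ (M : PeriodicMesh L₁ L₂) (B₀ : ℝ × ℝ → Fin m → ℝ)
      (b : Fin M.N → Fin m → ℝ) (T h : ℝ) (u : ℝ → ℝ × ℝ → Fin m → ℝ),
      (∀ i, (M.elem i).IsAxisParallel) →
      IsRegular M (k + 3) T R b B₁ B₂ u → IsLocallyUniform M γ H →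
      (∀ i, ∀ x ∈ interior (M.elem i).carrier, B₀ x = b i) → (∀ i a, |b i a| ≤ β) →
      (∀ i, (M.elem i).diam ≤ h) →
      ∃ V V', IsConsistent M k B₀ B₁ B₂ S lam T (A * h ^ (k + 1)) u V V' := by
  obtain ⟨κ, hκ0, hκ₁, hκ₂, hκ⟩ := exists_flux_const hd
  obtain ⟨ρ⟩ := nonempty_radauSplitting k hd
  obtain ⟨κ', ω, hκ'0, hκ', hω⟩ := ρ.exists_bound
  obtain ⟨C, hC, hlead⟩ := exists_lead_jump_le k
  have hω0 : 0 ≤ ω := (abs_nonneg _).trans (hω 0 ⟨le_rfl, zero_le_one⟩).1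
  have hA0 : 0 ≤ taylorConst m (k + 1) R β κ γ H := by unfold taylorConst; positivity
  -- bound for the corrections
  set E := 2 * (ω * (m * (κ' * (2 ^ (k + 1) * R)))) with hE
  have hE0 : 0 ≤ E := by positivity
  -- bound for the jumps of the Taylor polynomials
  set J := R * 4 ^ (k + 2) * (1 + γ ^ (k + 2)) with hJ
  have hJ0 : 0 ≤ J := by positivity
  -- bound for the jumps of the corrections
  set G := 4 * (m * (m * (2 * κ * (2 * (ω * (m * (κ' * (C * J)))))))) * γ with hG
  have hG0 : 0 ≤ G := by positivity
  refine ⟨taylorConst m (k + 1) R β κ γ H + m * (β * (2 * E)) + 2 * G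
    + (R * 4 ^ (k + 2) * H + 2 * E), by positivity, ?_⟩
  intro M B₀ b T h u hax hu hM hb hb0 hh
  choose c hc using fun i => (M.elem i).interior_carrier_nonempty
  set f : Fin m → STFun := fun a q => u q.1 q.2 a with hf
  set ζ : Bool → ℝ → Fin M.N → Fin m → ℝ := fun d t i a => lead k d (f a) (c i) t with hζ
  set ζ' : Bool → ℝ → Fin M.N → Fin m → ℝ := fun d t i a => lead k d (pd et (f a)) (c i) t with hζ'
  set T₀ : ℝ → M.Broken m := fun t i x a => taylor (k + 2) (c i) (f a) t x with hT₀
  set T₁ : ℝ → M.Broken m := fun t i x a => taylor (k + 2) (c i) (pd et (f a)) t x with hT₁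
  have hcorr : ∀ i d (ξ : Fin m → ℝ), (∀ a, |ξ a| ≤ R) → ∀ x ∈ (M.elem i).carrier, ∀ a,
      |ρ.corr (M.elem i) d ξ x a| ≤ E * (M.elem i).diam ^ (k + 1) := by
    intro i d ξ hξ x hx a
    have hd0 := (M.elem i).diam_pos.le
    refine (ρ.abs_corr_le (hax i) hκ'0 (hκ' d) hω
      (z := (2 * (M.elem i).diam) ^ (k + 1) * R) (fun a => ?_) ((hax i).coord_mem hx d) a).trans
      (le_of_eq (by rw [hE, mul_pow]; ring))
    exact mul_le_mul (pow_le_pow_left₀ ((hax i).wd_pos d).le ((M.elem i).wd_le_diam d) _) (hξ a)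
      (abs_nonneg _) (by positivity)
  have hζb : ∀ d, ∀ t ∈ Ioo 0 T, ∀ i a, |ζ d t i a| ≤ R := fun d t ht i a =>
    abs_lead_le isOpen_timeSlab ((hu.bound i a).mono (by omega)) ⟨ht, hc i⟩ d
  have hζb' : ∀ d, ∀ t ∈ Ioo 0 T, ∀ i a, |ζ' d t i a| ≤ R := fun d t ht i a =>
    abs_lead_le isOpen_timeSlab (((hu.bound i a).mono (by omega : k + 1 + 1 ≤ k + 3)).pd
      isOpen_timeSlab norm_et_le) ⟨ht, hc i⟩ d
  refine ⟨fun t i x a => T₀ t i x a - ρ.corr (M.elem i) true (ζ true t i) x a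
      - ρ.corr (M.elem i) false (ζ false t i) x a,
    fun t i x a => T₁ t i x a - ρ.corr (M.elem i) true (ζ' true t i) x a
      - ρ.corr (M.elem i) false (ζ' false t i) x a, ?_, ?_, ?_, ?_⟩
  · intro t _ i a
    refine (hax i).mem_localSpace_iff.2 ?_
    have h1 := taylor_sub_lead_mem (k := k) (c i) (f a) t
    have h2 := ρ.pow_sub_corr_mem (hax i) true (coord true (c i)) (ζ true t i) a
    have h3 := ρ.pow_sub_corr_mem (hax i) false (coord false (c i)) (ζ false t i) a
    convert add_mem (add_mem h1 h2) h3 using 1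
    ext x
    simp only [Pi.add_apply, hT₀, hζ]
    ring
  · intro t ht i x a
    refine ((hasDerivAt_taylor_time isOpen_timeSlab ((hu.bound i a).mono (by omega))
      ⟨ht, hc i⟩ x).sub (ρ.hasDerivAt_corr _ true (fun a => ?_) x a)).sub
        (ρ.hasDerivAt_corr _ false (fun a => ?_) x a)
    · exact hasDerivAt_lead isOpen_timeSlab ((hu.bound i a).mono (by omega)) ⟨ht, hc i⟩ true
    · exact hasDerivAt_lead isOpen_timeSlab ((hu.bound i a).mono (by omega)) ⟨ht, hc i⟩ false
  · intro t ht i x hx a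
    have hd0 := (M.elem i).diam_pos.le
    have hh0 := hd0.trans (hh i)
    have h1 := hu.abs_sub_taylor_le hc (r := k + 2) (by omega) ht i hx a
    have h2 := hcorr i true _ (hζb true t ht i) x hx a
    have h3 := hcorr i false _ (hζb false t ht i) x hx a
    have h4 : |u t x a - (T₀ t i x a - ρ.corr (M.elem i) true (ζ true t i) x a
        - ρ.corr (M.elem i) false (ζ false t i) x a)|
        ≤ R * (4 * (M.elem i).diam) ^ (k + 2) + 2 * (E * (M.elem i).diam ^ (k + 1)) := by
      rw [abs_le] at h1 h2 h3 ⊢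
      simp only [hT₀, hf]
      constructor <;> linarith [h1.1, h1.2, h2.1, h2.2, h3.1, h3.2]
    refine h4.trans ?_
    calc R * (4 * (M.elem i).diam) ^ (k + 2) + 2 * (E * (M.elem i).diam ^ (k + 1))
        = (R * 4 ^ (k + 2) * (M.elem i).diam + 2 * E) * (M.elem i).diam ^ (k + 1) := by
          rw [mul_pow]; ring
      _ ≤ (R * 4 ^ (k + 2) * H + 2 * E) * h ^ (k + 1) := by
        have := hM.diam_le i
        have := hh i
        gcongr
      _ ≤ _ := by
        have : 0 ≤ taylorConst m (k + 1) R β κ γ H + m * (β * (2 * E)) + 2 * G := by positivity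
        exact mul_le_mul_of_nonneg_right (by linarith) (by positivity)
  · intro t ht i v hv w hw hvw
    have hd0 := (M.elem i).diam_pos.le
    have hh0 := hd0.trans (hh i)
    have hj := (M.elem i).jac_pos.le
    have hvd : ContDiff ℝ 1 v := contDiff_pi.2 fun a => Element.contDiff_of_mem_localSpace (hv a)
    have hTc : ∀ i, Continuous (T₀ t i) := fun i => continuous_pi fun a => continuous_taylor _ _ _ _
    have hT₁c : Continuous (T₁ t i) := continuous_pi fun a => continuous_taylor _ _ _ _
    have hcc : ∀ i d ξ, Continuous (ρ.corr (M.elem i) d ξ) := fun i d ξ =>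
      (ρ.contDiff_corr _ d ξ).continuous
    set W : Bool → M.Broken m := fun d i => ρ.corr (M.elem i) d (ζ d t i) with hW
    set W' : Bool → ℝ × ℝ → Fin m → ℝ := fun d => ρ.corr (M.elem i) d (ζ' d t i) with hW'
    -- splitting of the residual
    have hsplit : schemeForm M B₀ B₁ B₂ S lam
        (fun i x a => T₀ t i x a - ρ.corr (M.elem i) true (ζ true t i) x a
          - ρ.corr (M.elem i) false (ζ false t i) x a)
        (fun i x a => T₁ t i x a - ρ.corr (M.elem i) true (ζ' true t i) x a
          - ρ.corr (M.elem i) false (ζ' false t i) x a) i v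
        = schemeForm M B₀ B₁ B₂ S lam (T₀ t) (T₁ t) i v
          - (∫ x in (M.elem i).carrier, (b i * (W' true x + W' false x)) ⬝ᵥ v x)
          - convForm M B₁ B₂ S lam (W true) i v - convForm M B₁ B₂ S lam (W false) i v := by
      have e1 : convForm M B₁ B₂ S lam (fun i x a => T₀ t i x a
          - ρ.corr (M.elem i) true (ζ true t i) x a
          - ρ.corr (M.elem i) false (ζ false t i) x a) i v
          = convForm M B₁ B₂ S lam (T₀ t) i v - convForm M B₁ B₂ S lam (W true) i v
            - convForm M B₁ B₂ S lam (W false) i v := by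
        have hW : ∀ d i, Continuous (W d i) := fun d i => hcc i d _
        have hTW : ∀ i, Continuous fun x => T₀ t i x - W true i x := fun i =>
          (hTc i).sub (hW true i)
        have h1 := convForm_sub (B₁ := B₁) (B₂ := B₂) (S := S) (lam := lam) M hTW (hW false) i hvd
        rw [convForm_sub M hTc (hW true) i hvd] at h1
        exact h1
      have e2 : ∫ x in (M.elem i).carrier, (B₀ x * fun a => T₁ t i x a
          - ρ.corr (M.elem i) true (ζ' true t i) x a
          - ρ.corr (M.elem i) false (ζ' false t i) x a) ⬝ᵥ v x
          = (∫ x in (M.elem i).carrier, (B₀ x * T₁ t i x) ⬝ᵥ v x)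
          - ∫ x in (M.elem i).carrier, (b i * (W' true x + W' false x)) ⬝ᵥ v x := by
        rw [setIntegral_weight (hb i) (T₁ t i), setIntegral_weight (hb i) (fun x a => T₁ t i x a
          - ρ.corr (M.elem i) true (ζ' true t i) x a
          - ρ.corr (M.elem i) false (ζ' false t i) x a), ← integral_sub]
        · congr 1
          ext x
          rw [← sub_dotProduct, ← mul_sub]
          congr 2
          ext a
          simp only [hW', Pi.sub_apply, Pi.add_apply]
          ring
        · exact (M.elem i).integrableOn_carrier
            ((continuous_const.mul hT₁c).dotProduct hvd.continuous).continuousOn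
        · exact (M.elem i).integrableOn_carrier ((continuous_const.mul
            ((hcc i _ _).add (hcc i _ _))).dotProduct hvd.continuous).continuousOn
      rw [schemeForm_eq, schemeForm_eq, e1, e2]
      ring
    have hb1 : |schemeForm M B₀ B₁ B₂ S lam (T₀ t) (T₁ t) i v|
        ≤ taylorConst m (k + 1) R β κ γ H * (M.elem i).diam ^ (k + 1) * (M.elem i).jac * w :=
      hu.abs_schemeForm_taylor_le (n := k + 1) hM hR hγ hb hb0 hκ0 hβ hκ₁ hκ₂ hκ hc ht i hvd hw hvw
    have hb2 : |∫ x in (M.elem i).carrier, (b i * (W' true x + W' false x)) ⬝ᵥ v x|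
        ≤ m * (β * (2 * E * (M.elem i).diam ^ (k + 1)) * w) * (M.elem i).jac := by
      refine (M.elem i).abs_setIntegral_dotProduct_le (by positivity) hw (fun x hx a => ?_) hvw
      rw [Pi.mul_apply, abs_mul]
      refine mul_le_mul (hb0 i a) ((abs_add_le _ _).trans ?_) (abs_nonneg _) hβ
      rw [mul_assoc, two_mul]
      exact add_le_add (hcorr i true _ (hζb' true t ht i) x hx a)
        (hcorr i false _ (hζb' false t ht i) x hx a)
    have hb3 : ∀ d, |convForm M B₁ B₂ S lam (W d) i v|
        ≤ G * (M.elem i).diam ^ (k + 1) * (M.elem i).jac * w := fun d => by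
      refine (ρ.abs_convForm_corr_le hax hκ0 hκ hκ'0 (hκ' d) hω (ζ d t) i
        (z := C * (J * (M.elem i).diam ^ (k + 2))) (by positivity)
        (fun l hl a => hlead M hax ⟨i, l⟩ d hl (f a) _ _ t _ fun s hs =>
          hu.abs_jump_taylor_le hM hR hc (r := k + 2) (by omega) ht ⟨i, l⟩ hs a) hv hw hvw).trans ?_
      have hsq : (M.elem i).diam ^ 2 ≤ γ * (M.elem i).jac := hM.sq_diam_le i
      calc _ = 4 * (m * (m * (2 * κ * (2 * (ω * (m * (κ' * (C * J)))))))) * w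
            * (M.elem i).diam ^ (k + 1) * (M.elem i).diam ^ 2 := by ring
        _ ≤ 4 * (m * (m * (2 * κ * (2 * (ω * (m * (κ' * (C * J)))))))) * w
            * (M.elem i).diam ^ (k + 1) * (γ * (M.elem i).jac) := by gcongr
        _ = _ := by rw [hG]; ring
    rw [hsplit]
    have htri : ∀ {p q r s p' q' r' s' : ℝ}, |p| ≤ p' → |q| ≤ q' → |r| ≤ r' → |s| ≤ s' →
        |p - q - r - s| ≤ p' + q' + r' + s' := by
      intro p q r s p' q' r' s' h1 h2 h3 h4
      rw [abs_le] at h1 h2 h3 h4 ⊢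
      constructor <;> linarith [h1.1, h1.2, h2.1, h2.2, h3.1, h3.2, h4.1, h4.2]
    refine (htri hb1 hb2 (hb3 true) (hb3 false)).trans ?_
    calc _ = (taylorConst m (k + 1) R β κ γ H + m * (β * (2 * E)) + 2 * G)
          * (M.elem i).diam ^ (k + 1) * (M.elem i).jac * w := by ring
      _ ≤ (taylorConst m (k + 1) R β κ γ H + m * (β * (2 * E)) + 2 * G
          + (R * 4 ^ (k + 2) * H + 2 * E)) * h ^ (k + 1) * (M.elem i).jac * w := by
        have hle : taylorConst m (k + 1) R β κ γ H + m * (β * (2 * E)) + 2 * G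
            ≤ taylorConst m (k + 1) R β κ γ H + m * (β * (2 * E)) + 2 * G
              + (R * 4 ^ (k + 2) * H + 2 * E) := le_add_of_nonneg_right (by positivity)
        have hd : (M.elem i).diam ^ (k + 1) ≤ h ^ (k + 1) :=
          pow_le_pow_left₀ (M.elem i).diam_pos.le (hh i) _
        have hj := (M.elem i).jac_pos.le
        have hd' : 0 ≤ (M.elem i).diam ^ (k + 1) := pow_nonneg (M.elem i).diam_pos.le _
        refine mul_le_mul_of_nonneg_right (mul_le_mul_of_nonneg_right
          (mul_le_mul hle hd hd' ?_) hj) hw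
        positivity

end Rectangular

/-! ### Shape-regular meshes and piecewise smooth solutions -/

section Reduction

open Filter Topology

variable {m : ℕ} {L₁ L₂ T : ℝ} {B₁ B₂ : Matrix (Fin m) (Fin m) ℝ}

namespace PeriodicMesh

variable (M : PeriodicMesh L₁ L₂)

theorem carrier_subset (i : Fin M.N) : (M.elem i).carrier ⊆ Icc 0 L₁ ×ˢ Icc 0 L₂ :=
  M.cover ▸ subset_iUnion (fun i => (M.elem i).carrier) i

theorem diam_le (i : Fin M.N) : (M.elem i).diam ≤ L₁ + L₂ := by
  have h3 := (M.elem i).three_le_numSides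
  have : Nonempty (Fin (M.elem i).numSides) := ⟨⟨0, by omega⟩⟩
  refine ciSup_le fun p => ciSup_le fun q => (len_le_abs_add_abs _).trans ?_
  obtain ⟨⟨h1, h2⟩, h3, h4⟩ := M.carrier_subset i ((M.elem i).vert_mem_carrier p)
  obtain ⟨⟨h5, h6⟩, h7, h8⟩ := M.carrier_subset i ((M.elem i).vert_mem_carrier q)
  refine add_le_add ?_ ?_ <;> rw [abs_le] <;> constructor <;>
    simp only [Prod.fst_sub, Prod.snd_sub] <;> linarith

theorem diam_le_size (i : Fin M.N) : (M.elem i).diam ≤ M.size :=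
  le_ciSup (f := fun i => (M.elem i).diam) (Set.finite_range _).bddAbove i

theorem size_nonneg : 0 ≤ M.size := Real.iSup_nonneg fun i => (M.elem i).diam_pos.le

/-- Neighbouring elements have comparable diameters because they share an edge, whose length is
comparable to the diameter of either of them. -/
theorem ShapeRegular.isLocallyUniform {σ : ℝ} (h : M.ShapeRegular σ) :
    IsLocallyUniform M (σ ^ 2) (L₁ + L₂) := by
  have hsq : ∀ i, (M.elem i).diam ^ 2 ≤ σ ^ 2 * (M.elem i).jac := fun i => by
    obtain ⟨c, r, hr, hd, hsub⟩ := h i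
    exact (M.elem i).sq_diam_le_of_disc hr hd hsub
  refine ⟨M.diam_le, hsq, fun e => ?_⟩
  have hlen : len ((M.nbr e).finish - (M.nbr e).start) ≤ (M.elem e.1).diam := by
    rw [M.finish_sub_start_nbr, len_neg]
    exact (M.elem e.1).len_edge_le_diam e.2.2
  have hd := (M.elem (M.nbr e).1).diam_pos
  refine le_of_mul_le_mul_right ?_ hd
  calc (M.elem (M.nbr e).1).diam * (M.elem (M.nbr e).1).diam
      ≤ σ ^ 2 * (M.elem (M.nbr e).1).jac := by rw [← sq]; exact hsq _
    _ ≤ σ ^ 2 * (len ((M.nbr e).finish - (M.nbr e).start) * (M.elem (M.nbr e).1).diam) :=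
        mul_le_mul_of_nonneg_left
          ((M.elem (M.nbr e).1).jac_le_len_edge_mul_diam (M.nbr e).2.2) (sq_nonneg σ)
    _ ≤ σ ^ 2 * (M.elem e.1).diam * (M.elem (M.nbr e).1).diam := by
        rw [mul_assoc]; gcongr

end PeriodicMesh

namespace IsSmoothSolution

variable {s P : ℕ} {B₀ : ℝ × ℝ → Fin m → ℝ} {D : Fin P → Set (ℝ × ℝ)} {u : ℝ → ℝ × ℝ → Fin m → ℝ}

theorem continuous (hu : IsSmoothSolution s L₁ L₂ T B₀ B₁ B₂ D u) {t : ℝ} (ht : t ∈ Icc 0 T) :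
    Continuous (u t) :=
  hu.cont.comp_continuous (f := fun x : ℝ × ℝ => (t, x)) (by fun_prop) fun _ => ⟨ht, mem_univ _⟩

theorem sub_int_periods (hu : IsSmoothSolution s L₁ L₂ T B₀ B₁ B₂ D u) {t : ℝ} (ht : t ∈ Icc 0 T)
    (p q : ℤ) (x : ℝ × ℝ) : u t (x - (p * L₁, q * L₂)) = u t x := by
  have h1 : ∀ y, Function.Periodic (fun r => u t (r, y)) L₁ := fun y r => hu.periodic_x t ht (r, y)
  have h2 : ∀ y, Function.Periodic (fun r => u t (y, r)) L₂ := fun y r => hu.periodic_y t ht (y, r)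
  exact (((h1 _).int_mul p).sub_eq x.1).trans (((h2 x.1).int_mul q).sub_eq x.2)

/-- The bound does not depend on the mesh: it holds on all open subsets of the pieces. -/
theorem exists_derivBound (hu : IsSmoothSolution s L₁ L₂ T B₀ B₁ B₂ D u)
    (hD : ∀ p, IsCompact (D p)) :
    ∃ R, 0 ≤ R ∧ ∀ p a, ∀ O : Set (ℝ × ℝ), IsOpen O → O ⊆ D p →
      DerivBound s R (fun q => u q.1 q.2 a) (Ioo 0 T ×ˢ O) := by
  have hs : ∀ p a, ContDiffOn ℝ s (fun q : ℝ × (ℝ × ℝ) => u q.1 q.2 a) (Icc 0 T ×ˢ D p) :=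
    fun p a => contDiffOn_pi.1 (hu.smooth p) a
  choose C hC using fun p a => exists_iteratedFDeriv_bound (isCompact_Icc.prod (hD p)) (hs p a)
  refine ⟨∑ p, ∑ a, |C p a|, by positivity, fun p a O hO hOD => ?_⟩
  have hsub : Ioo 0 T ×ˢ O ⊆ Icc 0 T ×ˢ D p := prod_mono Ioo_subset_Icc_self hOD
  refine ⟨(hs p a).mono hsub, fun y hy j hj => ?_⟩
  calc _ ≤ C p a := hC p a _ (isOpen_Ioo.prod hO) hsub y hy j hj
    _ ≤ |C p a| := le_abs_self _
    _ ≤ ∑ a, |C p a| := Finset.single_le_sum (f := fun a => |C p a|)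
        (fun _ _ => abs_nonneg _) (Finset.mem_univ a)
    _ ≤ _ := Finset.single_le_sum (f := fun p => ∑ a, |C p a|)
        (fun _ _ => Finset.sum_nonneg fun _ _ => abs_nonneg _) (Finset.mem_univ p)

/-- The derivatives in the definition of a solution are those of the function of time and space. -/
theorem isRegular (hu : IsSmoothSolution s L₁ L₂ T B₀ B₁ B₂ D u) (hs : 1 ≤ s) {R : ℝ}
    (hR : ∀ p a, ∀ O : Set (ℝ × ℝ), IsOpen O → O ⊆ D p →
      DerivBound s R (fun q => u q.1 q.2 a) (Ioo 0 T ×ˢ O))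
    (M : PeriodicMesh L₁ L₂) {π : Fin M.N → Fin P} (hπ : ∀ i, (M.elem i).carrier ⊆ D (π i))
    {b : Fin M.N → Fin m → ℝ} (hb : ∀ i, ∀ x ∈ interior (M.elem i).carrier, B₀ x = b i) :
    IsRegular M s T R b B₁ B₂ u := by
  refine ⟨fun t ht => hu.continuous (Ioo_subset_Icc_self ht), fun t ht e x =>
    hu.sub_int_periods (Ioo_subset_Icc_self ht) _ _ x, fun i a =>
    hR (π i) a _ isOpen_interior (interior_subset.trans (hπ i)), fun t ht i x hx a => ?_⟩
  have hdiff : DifferentiableAt ℝ (fun q : ℝ × (ℝ × ℝ) => u q.1 q.2) (t, x) := by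
    have hmem : Icc 0 T ×ˢ D (π i) ∈ 𝓝 (t, x) :=
      prod_mem_nhds (Icc_mem_nhds ht.1 ht.2) (mem_of_superset
        (isOpen_interior.mem_nhds hx) (interior_subset.trans (hπ i)))
    exact ((hu.smooth (π i)).contDiffAt hmem).differentiableAt
      (by exact_mod_cast Nat.one_le_iff_ne_zero.1 hs)
  have hcomp : ∀ (c : Fin m) (v : ℝ × (ℝ × ℝ)), pd v (fun q => u q.1 q.2 c) (t, x)
      = fderiv ℝ (fun q : ℝ × (ℝ × ℝ) => u q.1 q.2) (t, x) v c := fun c v => by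
    have := (hasFDerivAt_pi'.1 hdiff.hasFDerivAt c).fderiv
    rw [pd, this]; rfl
  have hx' : ∀ d : ℝ × ℝ, fderiv ℝ (u t) x d
      = fderiv ℝ (fun q : ℝ × (ℝ × ℝ) => u q.1 q.2) (t, x) (0, d) := fun d => by
    have h := hdiff.hasFDerivAt.comp x
      ((hasFDerivAt_const t x).prodMk (hasFDerivAt_id x) : HasFDerivAt (fun y => (t, y)) _ x)
    have h2 : HasFDerivAt (u t) _ x := h
    rw [h2.fderiv]; rfl
  have ht' : derivWithin (fun τ => u τ x) (Icc 0 T) t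
      = fderiv ℝ (fun q : ℝ × (ℝ × ℝ) => u q.1 q.2) (t, x) (1, 0) := by
    have h := hdiff.hasFDerivAt.comp_hasDerivAt (f := fun τ : ℝ => (τ, x)) t
      ((hasDerivAt_id t).prodMk (hasDerivAt_const t x))
    have h : HasDerivAt (fun τ => u τ x) _ t := h
    rw [derivWithin_of_mem_nhds (Icc_mem_nhds ht.1 ht.2), h.deriv]
  have h := congrFun (hu.pde t (Ioo_subset_Ioc_self ht) (π i) x (interior_mono (hπ i) hx)) a
  rw [hb i x hx, hx', hx', ht'] at h
  simp only [hcomp]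
  exact h

end IsSmoothSolution

theorem IsRegular.mono {M : PeriodicMesh L₁ L₂} {n n' : ℕ} {R : ℝ} {b : Fin M.N → Fin m → ℝ}
    {u : ℝ → ℝ × ℝ → Fin m → ℝ} (hu : IsRegular M n T R b B₁ B₂ u) (hn : n' ≤ n) :
    IsRegular M n' T R b B₁ B₂ u :=
  ⟨hu.cont, hu.periodic, fun i a => (hu.bound i a).mono hn, hu.pde⟩

/-- The positive ones among finitely many numbers are bounded away from zero. The value of the
weight on a piece is only known to be positive if the piece has interior points. -/
theorem exists_pos_le_of_pos {ι : Type*} [Finite ι] (f : ι → ℝ) :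
    ∃ ε > 0, ∀ x, 0 < f x → ε ≤ f x := by
  have h : ∀ᶠ ε in 𝓝[>] (0 : ℝ), ∀ x, 0 < f x → ε ≤ f x := eventually_all.2 fun x => by
    by_cases hx : 0 < f x
    · filter_upwards [Ioc_mem_nhdsGT hx] with ε hε _ using hε.2
    · exact Eventually.of_forall fun ε h => absurd h hx
  obtain ⟨ε, h1, h2⟩ := (h.and self_mem_nhdsWithin).exists
  exact ⟨ε, h2, h1⟩

end Reduction

end EnergyDG

end

theorem mainTheorem8 (k : ℕ) :
    ∃ s : ℕ, ∀ (m : ℕ) (L₁ L₂ : ℝ) (_ : 0 < L₁) (_ : 0 < L₂)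
      (B₁ B₂ : Matrix (Fin m) (Fin m) ℝ) (_ : B₁.IsSymm) (_ : B₂.IsSymm)
      (S : ℝ × ℝ → Matrix (Fin m) (Fin m) ℝ) (lam : ℝ × ℝ → Fin m → ℝ)
      (_ : EnergyDG.IsPairedDecomposition B₁ B₂ S lam)
      (P : ℕ) (D : Fin P → Set (ℝ × ℝ)) (_ : ∀ p, IsCompact (D p))
      (B₀ : ℝ × ℝ → Fin m → ℝ) (_ : ∀ x i, 0 < B₀ x i)
      (_ : ∀ p, ∃ b : Fin m → ℝ, ∀ x ∈ interior (D p), B₀ x = b)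
      (T : ℝ) (_ : 0 < T) (u : ℝ → ℝ × ℝ → Fin m → ℝ)
      (_ : EnergyDG.IsSmoothSolution s L₁ L₂ T B₀ B₁ B₂ D u) (σ : ℝ),
      ∃ C : ℝ, ∀ (M : EnergyDG.PeriodicMesh L₁ L₂) (_ : M.ShapeRegular σ)
        (_ : ∀ i, ∃ p, (M.elem i).carrier ⊆ D p)
        (U : ℝ → M.Broken m) (_ : EnergyDG.IsDGSolution M k B₀ B₁ B₂ S lam T U),
        -- general meshes: order `k`
        ((∀ t ∈ Icc 0 T,
            M.l2Error (u t) (U t) ≤ C * (M.l2Error (u 0) (U 0) + M.size ^ k)) ∧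
          (M.IsL2Projection k (u 0) (U 0) →
            ∀ t ∈ Icc 0 T, M.l2Error (u t) (U t) ≤ C * M.size ^ k)) ∧
        -- rectangular meshes: order `k + 1`
        (M.IsCartesian →
          (∀ t ∈ Icc 0 T,
            M.l2Error (u t) (U t) ≤ C * (M.l2Error (u 0) (U 0) + M.size ^ (k + 1))) ∧
          (M.IsL2Projection k (u 0) (U 0) →
            ∀ t ∈ Icc 0 T, M.l2Error (u t) (U t) ≤ C * M.size ^ (k + 1))) := by
  refine ⟨k + 3, fun m L₁ L₂ hL₁ hL₂ B₁ B₂ hB₁ hB₂ S lam hd P D hD B₀ hB₀ hBD T hT u hu σ => ?_⟩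
  choose w hw using hBD
  obtain ⟨R, hR, hbound⟩ := hu.exists_derivBound hD
  obtain ⟨β₁, hβ₁, hβ₁w⟩ := EnergyDG.exists_pos_le_of_pos fun q : Fin P × Fin m => w q.1 q.2
  obtain ⟨C₀, hC₀, hstab⟩ := EnergyDG.exists_l2Error_le m k hL₁ hL₂ hT hβ₁
    (β₂ := ∑ q : Fin P × Fin m, |w q.1 q.2|)
  have hβ₂ : ∀ p j, |w p j| ≤ ∑ q : Fin P × Fin m, |w q.1 q.2| := fun p j =>
    Finset.single_le_sum (f := fun q : Fin P × Fin m => |w q.1 q.2|)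
      (fun _ _ => abs_nonneg _) (Finset.mem_univ (p, j))
  have hβ0 : 0 ≤ ∑ q : Fin P × Fin m, |w q.1 q.2| := Finset.sum_nonneg fun _ _ => abs_nonneg _
  obtain ⟨A, hA, hcons⟩ := EnergyDG.exists_isConsistent (L₁ := L₁) (L₂ := L₂) k hd hR hβ0
    (sq_nonneg σ) (add_pos hL₁ hL₂).le
  obtain ⟨A', hA', hcons'⟩ := EnergyDG.exists_isConsistent_of_isAxisParallel (L₁ := L₁) (L₂ := L₂)
    k hd hR hβ0 (sq_nonneg σ) (add_pos hL₁ hL₂).le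
  refine ⟨C₀ * (1 + A + A'), fun M hM hMD U hU => ?_⟩
  choose π hπ using hMD
  have hb : ∀ i, ∀ x ∈ interior (M.elem i).carrier, B₀ x = w (π i) := fun i x hx =>
    hw _ x (interior_mono (hπ i) hx)
  have hwpos : ∀ i j, 0 < w (π i) j := fun i j => by
    obtain ⟨x, hx⟩ := (M.elem i).interior_carrier_nonempty
    exact hb i x hx ▸ hB₀ x j
  have hreg := hu.isRegular (by omega) hbound M hπ hb
  have hunif := hM.isLocallyUniform
  have hh := M.size_nonneg
  -- convergence at the order `n` of consistency
  have main : ∀ (A₀ : ℝ) (n : ℕ), 0 ≤ A₀ → A₀ ≤ 1 + A + A' →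
      (∃ V V', EnergyDG.IsConsistent M k B₀ B₁ B₂ S lam T (A₀ * M.size ^ n) u V V') →
      (∀ t ∈ Icc 0 T, M.l2Error (u t) (U t)
          ≤ C₀ * (1 + A + A') * (M.l2Error (u 0) (U 0) + M.size ^ n)) ∧
        (M.IsL2Projection k (u 0) (U 0) →
          ∀ t ∈ Icc 0 T, M.l2Error (u t) (U t) ≤ C₀ * (1 + A + A') * M.size ^ n) := by
    rintro A₀ n hA₀ hle ⟨V, V', hV⟩
    have hn : 0 ≤ M.size ^ n := pow_nonneg hh n
    have he : 0 ≤ M.l2Error (u 0) (U 0) := Real.sqrt_nonneg _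
    have h := hstab M B₀ B₁ B₂ S lam (fun i => w (π i)) (A₀ * M.size ^ n) u U V V' hB₁ hB₂ hb
      (fun i j => hβ₁w (π i, j) (hwpos i j)) (fun i j => (le_abs_self _).trans (hβ₂ _ _))
      (mul_nonneg hA₀ hn) hu.cont hU hV
    refine ⟨fun t ht => (h.1 t ht).trans ?_, fun hP t ht => (h.2 hP t ht).trans ?_⟩
    · rw [mul_assoc, mul_add (1 + A + A')]
      gcongr
      exact le_mul_of_one_le_left he (by linarith)
    · rw [mul_assoc]
      gcongr
  refine ⟨main A k hA (by linarith) ?_, fun hC => main A' (k + 1) hA' (by linarith) ?_⟩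
  · exact hcons M B₀ _ T M.size u (hreg.mono (by omega)) hunif hb (fun i j => hβ₂ _ _)
      M.diam_le_size
  · exact hcons' M B₀ _ T M.size u hC hreg hunif hb (fun i j => hβ₂ _ _) M.diam_le_size
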